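/- A knot is a smoothly embedded circle in $\mathbb{R}^3$. Two knots have the same type if, possibly after reversing the orientation of one of them, they are joined by a smooth isotopy through knots; a conformation of a knot $K$ is any knot of the same type as $K$. For a unit vector $v$, the orthogonal projection of a knot to the plane $v^{\perp}$ is in spiral form if it is a regular (immersed, cusp-free) smooth curve whose signed planar curvature never switches sign, i.e. is everywhere $\ge 0$ or everywhere $\le 0$. Its spiral number is the number of its local maxima with respect to a direction $w\in v^{\perp}$ (a flat piece at a maximum counts once), which is the same for every direction. The spiral index $sp[K]\in\mathbb{N}\cup\{\infty\}$ is the minimum of the spiral numbers over all projections in spiral form of all conformations of $K$ (and $\infty$ if there were no such projection). A knot $K$ is a connected sum $K_1\# K_2$ if there are conformations $c_1$ of $K_1$ and $c_2$ of $K_2$ such that $c_1$ lies in the half-space $x<0$ except for the semicircle $\{x^2+y^2=1,\ z=0,\ x\ge 0\}$, $c_2$ lies in the half-space $x>0$ except for the semicircle $\{x^2+y^2=1,\ z=0,\ x\le 0\}$, and $K$ has the type of the knot obtained from $c_1\cup c_2$ by deleting the interiors of these two semicircles (the orientations of $c_1$ and $c_2$ being matched at the two joining points; any choice of orientations of $K_1$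 and $K_2$ is allowed). **Proposition.** Let $K_1$, $K_2$ be knots and let $K$ be a connected sum $K_1\# K_2$. Then $$sp[K]+1\le sp[K_1]+sp[K_2],\qquad\text{i.e.}\qquad sp[K_1\# K_2]\le sp[K_1]+sp[K_2]-1 .$$ -/

import Mathlib

namespace SpiralIndex

open Set Filter Topology
open scoped ContDiff

noncomputable section

/-- Euclidean three-space. -/
abbrev E3 : Type := EuclideanSpace ℝ (Fin 3)

/-- A smooth (parametrised) knot in `ℝ³`: a smooth embedding of the circle `ℝ/ℤ`, written as a
`1`-periodic smooth immersion of `ℝ` that is injective on one period. -/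
structure Knot where
  toFun : ℝ → E3
  smooth : ContDiff ℝ ∞ toFun
  periodic : Function.Periodic toFun 1
  immersed : ∀ t, deriv toFun t ≠ 0
  injOn : InjOn toFun (Ico 0 1)

instance : CoeFun Knot (fun _ => ℝ → E3) := ⟨Knot.toFun⟩

/-- Two parametrised knots are isotopic (as oriented knots) if they are joined by a smooth family
of knots `H s`, `0 ≤ s ≤ 1`. -/
def Isotopic (K K' : Knot) : Prop :=
  ∃ H : ℝ → ℝ → E3, ContDiff ℝ ∞ (fun p : ℝ × ℝ => H p.1 p.2) ∧
    (∀ s ∈ Icc (0 : ℝ) 1, ∃ L : Knot, H s = L) ∧ H 0 = K ∧ H 1 = K'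

/-- `K'` is `K` with the opposite orientation. -/
def IsReverse (K K' : Knot) : Prop := ∀ t, K' t = K (-t)

/-- `K` and `K'` represent the same (unoriented) knot type, i.e. `K'` is a conformation of `K`:
`K'` is isotopic to `K` or to the reverse of `K`. -/
def SameType (K K' : Knot) : Prop :=
  Isotopic K K' ∨ ∃ R : Knot, IsReverse K R ∧ Isotopic R K'

/-- The projection of `K` onto the plane through the origin orthogonal to `v`. -/
def projection (K : Knot) (v : E3) : ℝ → E3 :=
  fun t => (Submodule.span ℝ {v})ᗮ.starProjection (K t)

/-- The signed curvature of a curve `p` in the plane orthogonal to the unit vector `v`, the plane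
being oriented by `v`. -/
def planarCurvature (v : E3) (p : ℝ → E3) (t : ℝ) : ℝ :=
  Matrix.det (Matrix.of fun i j : Fin 3 => (![v, deriv p t, deriv (deriv p) t] i) j) /
    ‖deriv p t‖ ^ 3

/-- The projection of `K` along `v` is smooth (it has no cusps) and is in spiral form: its planar
curvature never switches sign, so it is everywhere nonnegative or everywhere nonpositive. -/
def IsSpiralForm (K : Knot) (v : E3) : Prop :=
  (∀ t, deriv (projection K v) t ≠ 0) ∧
    ((∀ t, 0 ≤ planarCurvature v (projection K v) t) ∨
      (∀ t, planarCurvature v (projection K v) t ≤ 0))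

/-- A local maximum of `h` begins at `a`: `h` is constant on some interval `[a, b]` with `a ≤ b`
and is strictly smaller immediately before `a` and immediately after `b`. For an isolated maximum
`a = b`; a flat piece at the top counts as a single maximum. -/
def MaximumBeginsAt (h : ℝ → ℝ) (a : ℝ) : Prop :=
  ∃ b, a ≤ b ∧ (∀ t ∈ Icc a b, h t = h a) ∧
    (∀ᶠ t in 𝓝[<] a, h t < h a) ∧ (∀ᶠ t in 𝓝[>] b, h t < h a)

/-- The number of local maxima, over one period, of a `1`-periodic function. -/
def numMaxima (h : ℝ → ℝ) : ℕ∞ := {a ∈ Ico (0 : ℝ) 1 | MaximumBeginsAt h a}.encard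

/-- The projection of `K` along `v` has spiral number `n`: it has `n` local maxima with respect
to every direction `w` of the plane of projection. -/
def HasSpiralNumber (K : Knot) (v : E3) (n : ℕ∞) : Prop :=
  ∀ w : E3, ‖w‖ = 1 → inner ℝ v w = 0 →
    numMaxima (fun t => inner ℝ (projection K v t) w) = n

/-- The spiral index of the knot type of `K`: the minimum of the spiral numbers of the
projections in spiral form of all conformations of `K`. -/
def spiralIndex (K : Knot) : ℕ∞ :=
  sInf {n | ∃ (K' : Knot) (v : E3), SameType K K' ∧ ‖v‖ = 1 ∧ IsSpiralForm K' v ∧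
    HasSpiralNumber K' v n}

/-- The unit circle in the plane `z = 0`; it is in `x < 0` for `0 < t < 1/2` and in `x > 0` for
`1/2 < t < 1`. -/
def unitCircle (t : ℝ) : E3 :=
  !₂[-Real.sin (2 * Real.pi * t), Real.cos (2 * Real.pi * t), 0]

/-- `K` is a connected sum `K₁ # K₂`. There are conformations `c₁` of `K₁` and `c₂` of `K₂` such
that `c₁` is in the half-space `x < 0` except for the semicircle `x ≥ 0` of the unit circle, `c₂`
is in the half-space `x > 0` except for the semicircle `x ≤ 0` of the unit circle, and `K` has the
type of the knot `c` formed by the remaining arcs once both semicircles have been deleted. Since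
the deleted arcs are traversed consistently, the orientations of `c₁` and `c₂` match in `c`; as
`SameType` ignores orientation, `K₁` and `K₂` may be given either orientation. -/
def IsConnectedSum (K K₁ K₂ : Knot) : Prop :=
  ∃ c c₁ c₂ : Knot, SameType K c ∧ SameType K₁ c₁ ∧ SameType K₂ c₂ ∧
    (∀ t ∈ Ioo (0 : ℝ) (1 / 2), c₁ t 0 < 0) ∧
    (∀ t ∈ Icc (1 / 2 : ℝ) 1, c₁ t = unitCircle t) ∧
    (∀ t ∈ Ioo (1 / 2 : ℝ) 1, 0 < c₂ t 0) ∧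
    (∀ t ∈ Icc (0 : ℝ) (1 / 2), c₂ t = unitCircle t) ∧
    (∀ t ∈ Icc (0 : ℝ) (1 / 2), c t = c₁ t) ∧
    (∀ t ∈ Icc (1 / 2 : ℝ) 1, c t = c₂ t)

end

end SpiralIndex

namespace SpiralIndex

open Set Filter Topology
open scoped ContDiff

noncomputable section

/-! A planar curve of nonnegative curvature has a monotone tangent angle θ, and its height in the
direction φ has a derivative with the sign of cos (θ - φ). A maximum therefore begins exactly when θ
- φ first reaches a value π/2 + 2πk, so the spiral number is the turning number, that is, `turn`
divided by 2π (`numMaxima_eq`, `Spiral.exists_turn`). The inequality thus becomes an additivity of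
total curvature: if two spirals contain complementary halves of the unit circle, deleting both
halves and joining what remains keeps the curvature nonnegative and removes exactly 2π from its
integral (`Spiral.glue`).

Two facts make this applicable.

A spiral can be isotoped, with the same total curvature, into a half-space except for a semicircle
(`Spiral.exists_leftHalf`). The projection is strictly curved at a point farthest from the origin. A
bump makes such a point be passed only once, an affine map puts it in contact with the unit circle,
and a short arc there is replaced by an arc of the circle without losing the sign of the curvature.
The projective maps `proj k` preserve the unit circle and the sign of curvature; for large k, such a
map stretches the short arc to a semicircle and throws the rest into x < 0.

The isotopy class of the sum depends only on the classes of the summands (`iso_glue`). The same maps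
`proj k` shrink the left knotted arc into a small neighbourhood of (-1, 0, 0). An isotopy of the
right summand can be corrected to be constant near that point, and then it carries the tiny arc
along unchanged. The half turn `swap` exchanges the two sides.

Hence spirals realising the two indices m₁ and m₂ glue to a conformation of the sum that has spiral
number m₁ + m₂ - 1. -/

/-! ### Knots modulo the period; isotopy as an equivalence relation. -/

/-- `f` is a parametrised knot, the injectivity being stated modulo the period. -/
structure IsKnot (f : ℝ → E3) : Prop where
  smooth : ContDiff ℝ ∞ f
  periodic : Function.Periodic f 1
  immersed : ∀ t, deriv f t ≠ 0
  inj : ∀ t t', f t = f t' → ∃ n : ℤ, t = t' + n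

theorem Knot.isKnot (K : Knot) : IsKnot K where
  smooth := K.smooth
  periodic := K.periodic
  immersed := K.immersed
  inj := fun t t' h => by
    have key : ∀ s : ℝ, K (Int.fract s) = K s := fun s => by
      have := K.periodic.sub_zsmul_eq (x := s) ⌊s⌋
      rw [← this]
      congr 1
      rw [zsmul_one, Int.fract]
    have h' : K (Int.fract t) = K (Int.fract t') := by rw [key, key, h]
    have := K.injOn ⟨Int.fract_nonneg t, Int.fract_lt_one t⟩
      ⟨Int.fract_nonneg t', Int.fract_lt_one t'⟩ h'
    exact ⟨⌊t⌋ - ⌊t'⌋, by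
      have h1 := Int.floor_add_fract t
      have h2 := Int.floor_add_fract t'
      push_cast
      linarith⟩

/-- The bundled knot given by a parametrised knot. -/
def IsKnot.toKnot {f : ℝ → E3} (h : IsKnot f) : Knot where
  toFun := f
  smooth := h.smooth
  periodic := h.periodic
  immersed := h.immersed
  injOn := fun t ht t' ht' e => by
    obtain ⟨n, hn⟩ := h.inj t t' e
    have h1 : (n : ℝ) < 1 := by linarith [ht.2, ht'.1]
    have h2 : (-1 : ℝ) < n := by linarith [ht.1, ht'.2]
    have h3 : n < 1 := by exact_mod_cast h1
    have h4 : -1 < n := by exact_mod_cast h2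
    obtain rfl : n = 0 := by omega
    simpa using hn

/-- Two curves are joined by a smooth family of knots, defined for all real parameters. -/
def Iso (f g : ℝ → E3) : Prop :=
  ∃ H : ℝ → ℝ → E3, ContDiff ℝ ∞ (fun p : ℝ × ℝ => H p.1 p.2) ∧
    (∀ s, IsKnot (H s)) ∧ H 0 = f ∧ H 1 = g

theorem smoothTransition_mem (s : ℝ) : Real.smoothTransition s ∈ Icc (0 : ℝ) 1 :=
  ⟨Real.smoothTransition.nonneg s, Real.smoothTransition.le_one s⟩

/-- `Real.smoothTransition` maps the whole line into [0, 1] and fixes 0 and 1, so reparametrising by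
it extends a family on [0, 1] to all real parameters. -/
theorem Iso.of_Icc (H : ℝ → ℝ → E3) (hs : ContDiff ℝ ∞ (fun p : ℝ × ℝ => H p.1 p.2))
    (hk : ∀ s ∈ Icc (0 : ℝ) 1, IsKnot (H s)) : Iso (H 0) (H 1) := by
  refine ⟨fun s => H (Real.smoothTransition s), ?_, fun s => hk _ (smoothTransition_mem s), ?_, ?_⟩
  · exact hs.comp ((Real.smoothTransition.contDiff.comp contDiff_fst).prodMk contDiff_snd)
  · simp
  · simp

theorem Iso.of_Icc' {f g : ℝ → E3} (H : ℝ → ℝ → E3)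
    (hs : ContDiff ℝ ∞ (fun p : ℝ × ℝ => H p.1 p.2))
    (hk : ∀ s ∈ Icc (0 : ℝ) 1, IsKnot (H s)) (h0 : ∀ t, H 0 t = f t) (h1 : ∀ t, H 1 t = g t) :
    Iso f g := by
  have := Iso.of_Icc H hs hk
  rwa [funext h0, funext h1] at this

theorem isotopic_iff (K K' : Knot) : Isotopic K K' ↔ Iso K K' := by
  constructor
  · rintro ⟨H, hs, hk, h0, h1⟩
    rw [← h0, ← h1]
    refine Iso.of_Icc H hs fun s hs => ?_
    obtain ⟨L, hL⟩ := hk s hs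
    rw [hL]
    exact L.isKnot
  · rintro ⟨H, hs, hk, h0, h1⟩
    exact ⟨H, hs, fun s _ => ⟨(hk s).toKnot, rfl⟩, h0, h1⟩

theorem Iso.right {f g : ℝ → E3} : Iso f g → IsKnot g := by
  rintro ⟨H, -, hk, -, rfl⟩
  exact hk 1

theorem Iso.symm {f g : ℝ → E3} : Iso f g → Iso g f := by
  rintro ⟨H, hs, hk, h0, h1⟩
  refine ⟨fun s => H (1 - s), ?_, fun s => hk _, by simpa using h1, by simpa using h0⟩
  exact hs.comp ((contDiff_const.sub contDiff_fst).prodMk contDiff_snd)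

theorem Iso.trans {f g h : ℝ → E3} : Iso f g → Iso g h → Iso f h := by
  rintro ⟨H, hs, hk, h0, h1⟩ ⟨H', hs', hk', h0', h1'⟩
  have hg : IsKnot g := h1 ▸ hk 1
  let φ := Real.smoothTransition
  have hφ : ContDiff ℝ ∞ φ := Real.smoothTransition.contDiff
  -- The first family has stopped at `g` when s ≥ 1/2, and the second still stands at `g` when s ≤
  -- 1/2. At each s one of the two cancels against `- g`, and the sum is smooth with no gluing at s
  -- = 1/2.
  refine ⟨fun s t => H (φ (2 * s)) t + H' (φ (2 * s - 1)) t - g t, ?_, fun s => ?_, ?_, ?_⟩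
  · refine ContDiff.sub (ContDiff.add ?_ ?_) (hg.smooth.comp contDiff_snd)
    · exact hs.comp ((hφ.comp (contDiff_const.mul contDiff_fst)).prodMk contDiff_snd)
    · exact hs'.comp ((hφ.comp ((contDiff_const.mul contDiff_fst).sub contDiff_const)).prodMk
        contDiff_snd)
  · rcases le_total s (1 / 2) with h | h
    · have e : φ (2 * s - 1) = 0 := Real.smoothTransition.zero_of_nonpos (by linarith)
      simpa [e, h0'] using hk (φ (2 * s))
    · have e : φ (2 * s) = 1 := Real.smoothTransition.one_of_one_le (by linarith)
      simpa [e, h1] using hk' (φ (2 * s - 1))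
  · funext t
    have e : φ (2 * 0 - 1) = 0 := Real.smoothTransition.zero_of_nonpos (by norm_num)
    have e' : φ (2 * 0) = 0 := Real.smoothTransition.zero_of_nonpos (by norm_num)
    simp only [e, e', h0, h0']
    abel
  · funext t
    have e : φ (2 * 1 - 1) = 1 := Real.smoothTransition.one_of_one_le (by norm_num)
    have e' : φ (2 * 1) = 1 := Real.smoothTransition.one_of_one_le (by norm_num)
    simp only [e, e', h1, h1']
    abel

theorem smooth_slice {F : Type*} [NormedAddCommGroup F] [NormedSpace ℝ F] {H : ℝ → ℝ → F}
    (hs : ContDiff ℝ ∞ (fun p : ℝ × ℝ => H p.1 p.2)) (s : ℝ) : ContDiff ℝ ∞ (H s) :=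
  hs.comp (contDiff_const.prodMk contDiff_id)

/-- Precomposition with a diffeomorphism of the line commuting with the unit translation. -/
theorem IsKnot.comp {f : ℝ → E3} (hf : IsKnot f) {g : ℝ → ℝ} (hg : ContDiff ℝ ∞ g)
    (hp : ∀ t, g (t + 1) = g t + 1) (hd : ∀ t, deriv g t ≠ 0) (hi : Function.Injective g) :
    IsKnot (fun t => f (g t)) where
  smooth := hf.smooth.comp hg
  periodic := fun t => by simp only [hp]; exact hf.periodic _
  immersed := fun t => by
    have h1 : HasDerivAt f (deriv f (g t)) (g t) :=
      (hf.smooth.differentiable (by simp) _).hasDerivAt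
    have h2 : HasDerivAt g (deriv g t) t := (hg.differentiable (by simp) _).hasDerivAt
    have := h1.scomp t h2
    rw [show (fun t => f (g t)) = f ∘ g from rfl, this.deriv]
    exact smul_ne_zero (hd t) (hf.immersed _)
  inj := fun t t' h => by
    obtain ⟨n, hn⟩ := hf.inj _ _ h
    refine ⟨n, hi ?_⟩
    rw [hn]
    have key : ∀ (m : ℕ) (t : ℝ), g (t + m) = g t + m := by
      intro m
      induction m with
      | zero => simp
      | succ m ih => intro t; push_cast; rw [← add_assoc, hp, ih]; ring
    rcases Int.eq_nat_or_neg n with ⟨m, rfl | rfl⟩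
    · simpa using (key m t').symm
    · have := key m (t' - m)
      push_cast
      rw [sub_add_cancel] at this
      rw [← sub_eq_add_neg, ← sub_eq_add_neg, this]
      ring

theorem IsKnot.shift {f : ℝ → E3} (hf : IsKnot f) (a : ℝ) : IsKnot (fun t => f (t + a)) := by
  refine hf.comp (contDiff_id.add contDiff_const) (fun t => add_right_comm t 1 a) (fun t => ?_)
    (add_left_injective a)
  simp

theorem Iso.shift {f : ℝ → E3} (hf : IsKnot f) (a : ℝ) : Iso f (fun t => f (t + a)) := by
  refine Iso.of_Icc' (fun s t => f (t + s * a)) ?_ (fun s _ => hf.shift _) (by simp) (by simp)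
  exact hf.smooth.comp (contDiff_snd.add (contDiff_fst.mul contDiff_const))

theorem IsKnot.reverse {f : ℝ → E3} (hf : IsKnot f) : IsKnot (fun t => f (-t)) where
  smooth := hf.smooth.comp contDiff_neg
  periodic := fun t => by
    have := hf.periodic (-(t + 1))
    simpa using this.symm
  immersed := fun t => by
    rw [deriv_comp_neg]
    exact neg_ne_zero.2 (hf.immersed _)
  inj := fun t t' h => by
    obtain ⟨n, hn⟩ := hf.inj _ _ h
    exact ⟨-n, by push_cast; linarith⟩

theorem Iso.reverse {f g : ℝ → E3} : Iso f g → Iso (fun t => f (-t)) (fun t => g (-t)) := by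
  rintro ⟨H, hs, hk, h0, h1⟩
  exact ⟨fun s t => H s (-t), hs.comp (contDiff_fst.prodMk contDiff_snd.neg),
    fun s => (hk s).reverse, by simp [h0], by simp [h1]⟩

theorem sameType_iff (K K' : Knot) : SameType K K' ↔ Iso K K' ∨ Iso (fun t => K (-t)) K' := by
  unfold SameType
  rw [isotopic_iff]
  refine or_congr Iff.rfl ⟨?_, fun h => ?_⟩
  · rintro ⟨R, hR, h⟩
    rw [isotopic_iff] at h
    rwa [← (funext hR : (R : ℝ → E3) = fun t => K (-t))]
  · exact ⟨K.isKnot.reverse.toKnot, fun t => rfl, (isotopic_iff _ _).2 h⟩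

theorem SameType.symm {K K' : Knot} (h : SameType K K') : SameType K' K := by
  rw [sameType_iff] at h ⊢
  rcases h with h | h
  · exact Or.inl h.symm
  · refine Or.inr ?_
    simpa using h.reverse.symm

theorem SameType.trans {K K' K'' : Knot} (h : SameType K K') (h' : SameType K' K'') :
    SameType K K'' := by
  rw [sameType_iff] at h h' ⊢
  rcases h with h | h <;> rcases h' with h' | h'
  · exact Or.inl (h.trans h')
  · exact Or.inr (h.reverse.trans h')
  · exact Or.inr (h.trans h')
  · refine Or.inl ?_
    have := h.reverse
    simp only [neg_neg] at this
    exact this.trans h'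

/-! ### Linear maps and the two components of GL(3, ℝ). -/

/-- Postcomposition of a curve with an invertible affine map. -/
def act (M : Matrix (Fin 3) (Fin 3) ℝ) : E3 →L[ℝ] E3 := Matrix.toEuclideanCLM (𝕜 := ℝ) M

theorem act_apply (M : Matrix (Fin 3) (Fin 3) ℝ) (w : E3) (i : Fin 3) :
    act M w i = M i 0 * w 0 + M i 1 * w 1 + M i 2 * w 2 := by
  simp [act, Matrix.mulVec, dotProduct, Fin.sum_univ_three]

theorem act_injective {M : Matrix (Fin 3) (Fin 3) ℝ} (h : M.det ≠ 0) :
    Function.Injective (act M) := by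
  have h' : IsUnit M.det := isUnit_iff_ne_zero.2 h
  intro x y e
  have h2 : act (M⁻¹) (act M x) = act (M⁻¹) (act M y) := by rw [e]
  unfold act at h2
  rw [← mul_apply_eq_comp, ← mul_apply_eq_comp, ← map_mul,
    Matrix.nonsing_inv_mul _ h', map_one] at h2
  simpa using h2

theorem IsKnot.linear_comp {f : ℝ → E3} (hf : IsKnot f) {A : E3 →L[ℝ] E3}
    (hA : Function.Injective A) (b : E3) : IsKnot (fun t => A (f t) + b) where
  smooth := (A.contDiff.comp hf.smooth).add contDiff_const
  periodic := fun t => by simp only [hf.periodic t]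
  immersed := fun t => by
    have h1 : HasDerivAt f (deriv f t) t := (hf.smooth.differentiable (by simp) _).hasDerivAt
    have h2 : HasDerivAt (fun t => A (f t) + b) (A (deriv f t)) t :=
      (A.hasFDerivAt.comp_hasDerivAt t h1).add_const b
    rw [h2.deriv]
    intro h
    exact hf.immersed t (hA (by simpa using h))
  inj := fun t t' h => hf.inj _ _ (hA (by simpa using h))

/-- A smooth path of invertible matrices. -/
def MatrixPath (A B : Matrix (Fin 3) (Fin 3) ℝ) : Prop :=
  ∃ P : ℝ → Matrix (Fin 3) (Fin 3) ℝ, (∀ i j, ContDiff ℝ ∞ (fun s => P s i j)) ∧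
    (∀ s ∈ Icc (0 : ℝ) 1, (P s).det ≠ 0) ∧ P 0 = A ∧ P 1 = B

theorem MatrixPath.mul {A B A' B' : Matrix (Fin 3) (Fin 3) ℝ} :
    MatrixPath A B → MatrixPath A' B' → MatrixPath (A * A') (B * B') := by
  rintro ⟨P, hs, hd, rfl, rfl⟩ ⟨Q, hs', hd', rfl, rfl⟩
  refine ⟨fun s => P s * Q s, fun i j => ?_, fun s h => ?_, rfl, rfl⟩
  · simp only [Matrix.mul_apply]
    exact ContDiff.sum fun k _ => (hs i k).mul (hs' k j)
  · rw [Matrix.det_mul]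
    exact mul_ne_zero (hd s h) (hd' s h)

/-- The reflection in the first coordinate. -/
def refl₀ : Matrix (Fin 3) (Fin 3) ℝ := Matrix.diagonal ![-1, 1, 1]

/-- Corresponding entries have the same sign, so the straight segment between them avoids 0. -/
theorem matrixPath_diagonal {d e : Fin 3 → ℝ} (h : ∀ i, 0 < d i * e i) :
    MatrixPath (Matrix.diagonal d) (Matrix.diagonal e) := by
  refine ⟨fun s => Matrix.diagonal fun i => (1 - s) * d i + s * e i, fun i j => ?_, fun s hs => ?_,
    by simp, by simp⟩
  · by_cases hij : i = j
    · subst hij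
      simp only [Matrix.diagonal_apply_eq]
      fun_prop
    · simp only [Matrix.diagonal_apply_ne _ hij]
      fun_prop
  · rw [Matrix.det_diagonal]
    refine Finset.prod_ne_zero_iff.2 fun i _ h0 => ?_
    have h1 : ((1 - s) * d i + s * e i) * d i = 0 := by rw [h0, zero_mul]
    have h2 : ((1 - s) * d i + s * e i) * e i = 0 := by rw [h0, zero_mul]
    have hi := h i
    have hd : d i ≠ 0 := fun h => by rw [h] at hi; simp at hi
    have he : e i ≠ 0 := fun h => by rw [h] at hi; simp at hi
    have a1 : 0 < d i ^ 2 := by positivity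
    have a2 : 0 < e i ^ 2 := by positivity
    have b1 := mul_nonneg (sub_nonneg.2 hs.2) a1.le
    have b2 := mul_nonneg hs.1 a2.le
    have b3 := mul_nonneg (sub_nonneg.2 hs.2) hi.le
    have b4 := mul_nonneg hs.1 hi.le
    nlinarith

theorem MatrixPath.trans {A B C : Matrix (Fin 3) (Fin 3) ℝ} :
    MatrixPath A B → MatrixPath B C → MatrixPath A C := by
  rintro ⟨P, hs, hd, rfl, rfl⟩ ⟨Q, hs', hd', h, rfl⟩
  let φ := Real.smoothTransition
  have hφ : ContDiff ℝ ∞ φ := Real.smoothTransition.contDiff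
  refine ⟨fun s => P (φ (2 * s)) + Q (φ (2 * s - 1)) - P 1, fun i j => ?_, fun s _ => ?_, ?_, ?_⟩
  · exact (((hs i j).comp (hφ.comp (by fun_prop))).add
      ((hs' i j).comp (hφ.comp (by fun_prop)))).sub contDiff_const
  · rcases le_total s (1 / 2) with h1 | h1
    · have e : φ (2 * s - 1) = 0 := Real.smoothTransition.zero_of_nonpos (by linarith)
      simpa [e, h] using hd _ (smoothTransition_mem _)
    · have e : φ (2 * s) = 1 := Real.smoothTransition.one_of_one_le (by linarith)
      simpa [e] using hd' _ (smoothTransition_mem _)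
  · have e : φ (2 * 0 - 1) = 0 := Real.smoothTransition.zero_of_nonpos (by norm_num)
    have e' : φ (2 * 0) = 0 := Real.smoothTransition.zero_of_nonpos (by norm_num)
    simp only [e, e', h]
    abel
  · have e : φ (2 * 1 - 1) = 1 := Real.smoothTransition.one_of_one_le (by norm_num)
    have e' : φ (2 * 1) = 1 := Real.smoothTransition.one_of_one_le (by norm_num)
    simp only [e, e']
    abel

/-- The mirror is rotated: every matrix of the path is a reflection, of determinant -1. -/
theorem matrixPath_refl₀_one :
    MatrixPath refl₀ (Matrix.diagonal ![1, -1, 1]) := by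
  refine ⟨fun s => !![-Real.cos (Real.pi * s), Real.sin (Real.pi * s), 0;
    Real.sin (Real.pi * s), Real.cos (Real.pi * s), 0; 0, 0, 1], fun i j => ?_, fun s _ => ?_,
    ?_, ?_⟩
  · fin_cases i <;> fin_cases j <;> simp <;> fun_prop
  · rw [Matrix.det_fin_three]
    simp
    nlinarith [Real.sin_sq_add_cos_sq (Real.pi * s)]
  · ext i j; fin_cases i <;> fin_cases j <;> simp [refl₀]
  · ext i j; fin_cases i <;> fin_cases j <;> simp

theorem matrixPath_refl₀_two :
    MatrixPath refl₀ (Matrix.diagonal ![1, 1, -1]) := by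
  refine ⟨fun s => !![-Real.cos (Real.pi * s), 0, Real.sin (Real.pi * s); 0, 1, 0;
    Real.sin (Real.pi * s), 0, Real.cos (Real.pi * s)], fun i j => ?_, fun s _ => ?_,
    ?_, ?_⟩
  · fin_cases i <;> fin_cases j <;> simp <;> fun_prop
  · rw [Matrix.det_fin_three]
    simp
    nlinarith [Real.sin_sq_add_cos_sq (Real.pi * s)]
  · ext i j; fin_cases i <;> fin_cases j <;> simp [refl₀]
  · ext i j; fin_cases i <;> fin_cases j <;> simp

theorem refl₀_mul_self : refl₀ * refl₀ = 1 := by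
  rw [refl₀, Matrix.diagonal_mul_diagonal, ← Matrix.diagonal_one]
  congr 1
  ext i; fin_cases i <;> simp

theorem det_refl₀ : refl₀.det = -1 := by
  rw [refl₀, Matrix.det_diagonal, Fin.prod_univ_three]
  simp

/-- An invertible matrix is a product of transvections and a diagonal matrix. A transvection shrinks
to the identity, a diagonal matrix with a single nontrivial entry is joined to 1 or to `refl₀`
according to the sign of that entry, and the alternatives multiply because `refl₀` squares to 1. -/
theorem matrixPath_one_or (M : Matrix (Fin 3) (Fin 3) ℝ) (hM : M.det ≠ 0) :
    MatrixPath 1 M ∨ MatrixPath refl₀ M := by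
  have hmul : ∀ A B : Matrix (Fin 3) (Fin 3) ℝ, (MatrixPath 1 A ∨ MatrixPath refl₀ A) →
      (MatrixPath 1 B ∨ MatrixPath refl₀ B) →
      (MatrixPath 1 (A * B) ∨ MatrixPath refl₀ (A * B)) := by
    rintro A B (hA | hA) (hB | hB)
    · exact Or.inl (by simpa using hA.mul hB)
    · exact Or.inr (by simpa using hA.mul hB)
    · exact Or.inr (by simpa using hA.mul hB)
    · exact Or.inl (by simpa [refl₀_mul_self] using hA.mul hB)
  refine Matrix.diagonal_transvection_induction_of_det_ne_zero _ M hM (fun D hD => ?_)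
    (fun T => ?_) (fun A B _ _ => hmul A B)
  · rw [Matrix.det_diagonal, Finset.prod_ne_zero_iff] at hD
    have e : Matrix.diagonal D = Matrix.diagonal ![D 0, 1, 1] * (Matrix.diagonal ![1, D 1, 1] *
        Matrix.diagonal ![1, 1, D 2]) := by
      rw [Matrix.diagonal_mul_diagonal, Matrix.diagonal_mul_diagonal]
      congr 1
      ext i; fin_cases i <;> simp
    rw [e]
    have one : (1 : Matrix (Fin 3) (Fin 3) ℝ) = Matrix.diagonal ![1, 1, 1] := by
      rw [← Matrix.diagonal_one]
      congr 1
      ext i; fin_cases i <;> simp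
    refine hmul _ _ ?_ (hmul _ _ ?_ ?_)
    · rcases lt_or_gt_of_ne (hD 0 (Finset.mem_univ _)) with h | h
      · refine Or.inr (matrixPath_diagonal fun i => ?_)
        fin_cases i <;> simp [h]
      · refine Or.inl (one ▸ matrixPath_diagonal fun i => ?_)
        fin_cases i <;> simp [h]
    · rcases lt_or_gt_of_ne (hD 1 (Finset.mem_univ _)) with h | h
      · refine Or.inr (matrixPath_refl₀_one.trans (matrixPath_diagonal fun i => ?_))
        fin_cases i <;> simp [h]
      · refine Or.inl (one ▸ matrixPath_diagonal fun i => ?_)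
        fin_cases i <;> simp [h]
    · rcases lt_or_gt_of_ne (hD 2 (Finset.mem_univ _)) with h | h
      · refine Or.inr (matrixPath_refl₀_two.trans (matrixPath_diagonal fun i => ?_))
        fin_cases i <;> simp [h]
      · refine Or.inl (one ▸ matrixPath_diagonal fun i => ?_)
        fin_cases i <;> simp [h]
  · refine Or.inl ⟨fun s => Matrix.transvection T.i T.j (s * T.c), fun i j => ?_, fun s _ => ?_,
      by simp, by simp [Matrix.TransvectionStruct.toMatrix]⟩
    · simp only [Matrix.transvection, Matrix.add_apply, Matrix.single_apply]
      split_ifs <;> fun_prop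
    · rw [Matrix.det_transvection_of_ne _ _ T.hij]
      exact one_ne_zero

theorem MatrixPath.det_pos {A B : Matrix (Fin 3) (Fin 3) ℝ} (h : MatrixPath A B) :
    0 < A.det * B.det := by
  obtain ⟨P, hs, hd, rfl, rfl⟩ := h
  have hc : Continuous fun s => (P s).det :=
    Continuous.matrix_det (continuous_matrix fun i j => (hs i j).continuous)
  by_contra hneg
  have h0 := hd 0 (by simp)
  have h1 := hd 1 (by simp)
  have : ∃ s ∈ Icc (0 : ℝ) 1, (P s).det = 0 := by
    rcases lt_or_gt_of_ne h0 with h | h <;> rcases lt_or_gt_of_ne h1 with h' | h'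
    · exact absurd (mul_pos_of_neg_of_neg h h') hneg
    · exact intermediate_value_Icc zero_le_one hc.continuousOn ⟨h.le, h'.le⟩
    · exact intermediate_value_Icc' zero_le_one hc.continuousOn ⟨h'.le, h.le⟩
    · exact absurd (mul_pos h h') hneg
  obtain ⟨s, hs, h⟩ := this
  exact hd s hs h

/-- An orientation preserving affine map does not change the isotopy class of a knot. -/
theorem Iso.affine {f : ℝ → E3} (hf : IsKnot f) {M : Matrix (Fin 3) (Fin 3) ℝ} (hM : 0 < M.det)
    (b : E3) : Iso f (fun t => act M (f t) + b) := by
  have hP : MatrixPath 1 M := by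
    rcases matrixPath_one_or M hM.ne' with h | h
    · exact h
    · have := h.det_pos
      rw [det_refl₀] at this
      linarith
  obtain ⟨P, hs, hd, h0, h1⟩ := hP
  refine Iso.of_Icc' (fun s t => act (P s) (f t) + s • b) ?_
    (fun s h => hf.linear_comp (act_injective (hd s h)) _) (fun t => ?_) (fun t => ?_)
  · refine ContDiff.add ?_ (contDiff_fst.smul contDiff_const)
    rw [contDiff_euclidean]
    intro i
    simp only [act_apply]
    have hcoord : ∀ j : Fin 3, ContDiff ℝ ∞ fun p : ℝ × ℝ => f p.2 j := fun j =>
      (contDiff_euclidean.1 hf.smooth j).comp contDiff_snd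
    have hm : ∀ j : Fin 3, ContDiff ℝ ∞ fun p : ℝ × ℝ => P p.1 i j := fun j =>
      (hs i j).comp contDiff_fst
    exact (((hm 0).mul (hcoord 0)).add ((hm 1).mul (hcoord 1))).add ((hm 2).mul (hcoord 2))
  · simp [h0, act]
  · simp [h1]

/-! ### Smooth gluing of two curves along the zeros of sin 2πt. -/

/-- A smooth function that vanishes near enough to the zero set of `g` may be cut off along it. -/
theorem contDiff_ite_of_flat {E : Type} [NormedAddCommGroup E] [NormedSpace ℝ E] {g : E → ℝ}
    (hg : Continuous g) {F : Type} [NormedAddCommGroup F] [NormedSpace ℝ F] {D : E → F}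
    (hD : ContDiff ℝ ∞ D) (hflat : ∀ p, g p = 0 → p ∈ closure (interior {q | D q = 0})) :
    ContDiff ℝ ∞ (fun p => if 0 ≤ g p then 0 else D p) := by
  rw [contDiff_infty]
  intro n
  -- The derivative of the cut-off function is the cut-off derivative, and the flatness hypothesis
  -- passes to the derivative. This closes the induction on the order of smoothness, in which the
  -- target space changes.
  have hdiff : ∀ {F : Type} [NormedAddCommGroup F] [NormedSpace ℝ F] {D : E → F}
      (_ : ContDiff ℝ ∞ D) (_ : ∀ p, g p = 0 → p ∈ closure (interior {q | D q = 0})) (p : E),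
      HasFDerivAt (fun p => if 0 ≤ g p then 0 else D p)
        (if 0 ≤ g p then 0 else fderiv ℝ D p) p ∧
        (g p = 0 → p ∈ closure (interior {q | fderiv ℝ D q = 0})) := by
    intro F _ _ D hD hflat p
    have hsub : interior {q | D q = 0} ⊆ interior {q | fderiv ℝ D q = 0} := by
      refine interior_maximal (fun q hq => ?_) isOpen_interior
      have : D =ᶠ[𝓝 q] fun _ => 0 := by
        filter_upwards [isOpen_interior.mem_nhds hq] with x hx
        exact (interior_subset hx : x ∈ {q | D q = 0})
      simp [this.fderiv_eq]
    have hfl : g p = 0 → p ∈ closure (interior {q | fderiv ℝ D q = 0}) := fun h =>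
      closure_mono hsub (hflat p h)
    refine ⟨?_, hfl⟩
    have hDp : HasFDerivAt D (fderiv ℝ D p) p := (hD.differentiable (by simp) p).hasFDerivAt
    rcases lt_trichotomy (g p) 0 with h | h | h
    · rw [if_neg (not_le.2 h)]
      refine hDp.congr_of_eventuallyEq ?_
      filter_upwards [hg.continuousAt.eventually_lt_const h] with q hq
      rw [if_neg (not_le.2 hq)]
    · have e1 : D p = 0 := by
        have hc : IsClosed {q | D q = 0} := isClosed_eq hD.continuous continuous_const
        exact hc.closure_subset_iff.2 interior_subset (hflat p h)
      have e2 : fderiv ℝ D p = 0 := by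
        have hc : IsClosed {q | fderiv ℝ D q = 0} :=
          isClosed_eq (hD.continuous_fderiv (by simp)) continuous_const
        exact hc.closure_subset_iff.2 interior_subset (hfl h)
      rw [if_pos h.ge]
      rw [e2] at hDp
      rw [hasFDerivAt_iff_isLittleO_nhds_zero] at hDp ⊢
      -- On the boundary both `D` and its derivative vanish by continuity, and the cut-off function
      -- is dominated by `D`, which is little-o there.
      refine (Asymptotics.IsBigO.of_bound 1 (Eventually.of_forall fun x => ?_)).trans_isLittleO hDp
      simp only [h, le_refl, if_true, e1, sub_zero, zero_apply, one_mul]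
      split_ifs
      · simp
      · exact le_rfl
    · rw [if_pos h.le]
      refine (hasFDerivAt_const (0 : F) p).congr_of_eventuallyEq ?_
      filter_upwards [hg.continuousAt.eventually_const_lt h] with q hq
      rw [if_pos hq.le]
  induction n generalizing F with
  | zero =>
    rw [CharP.cast_eq_zero, contDiff_zero, continuous_iff_continuousAt]
    exact fun p => (hdiff hD hflat p).1.continuousAt
  | succ n ih =>
    have hfd : fderiv ℝ (fun p => if 0 ≤ g p then 0 else D p) =
        fun p => if 0 ≤ g p then 0 else fderiv ℝ D p :=
      funext fun p => (hdiff hD hflat p).1.fderiv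
    push_cast
    rw [contDiff_succ_iff_fderiv]
    refine ⟨fun p => (hdiff hD hflat p).1.differentiableAt, by simp, ?_⟩
    rw [hfd]
    exact ih (hD.fderiv_right (by simp)) fun p => (hdiff hD hflat p).2

/-- The curve that is `A` on `[n, n + 1/2]` and `B` elsewhere. -/
def glue (A B : ℝ → E3) (t : ℝ) : E3 := if 0 ≤ Real.sin (2 * Real.pi * t) then A t else B t

theorem sin_two_pi_add_one (t : ℝ) :
    Real.sin (2 * Real.pi * (t + 1)) = Real.sin (2 * Real.pi * t) := by
  rw [mul_add, mul_one, Real.sin_add_two_pi]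

theorem glue_periodic {A B : ℝ → E3} (hA : Function.Periodic A 1) (hB : Function.Periodic B 1) :
    Function.Periodic (glue A B) 1 := fun t => by
  unfold glue
  rw [sin_two_pi_add_one, hA, hB]

theorem glue_left {A B : ℝ → E3} {t : ℝ} (h : t ∈ Icc (0 : ℝ) (1 / 2)) : glue A B t = A t := by
  refine if_pos (Real.sin_nonneg_of_nonneg_of_le_pi ?_ ?_)
  · have := Real.pi_pos
    have := h.1
    positivity
  · nlinarith [Real.pi_pos, h.2]

theorem glue_right_Ioo {A B : ℝ → E3} {t : ℝ} (h : t ∈ Ioo (1 / 2 : ℝ) 1) : glue A B t = B t := by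
  refine if_neg (not_le.2 ?_)
  rw [← Real.sin_sub_two_pi]
  refine Real.sin_neg_of_neg_of_neg_pi_lt ?_ ?_
  · nlinarith [Real.pi_pos, h.2]
  · nlinarith [Real.pi_pos, h.1]

/-- At the endpoints 1/2 and 1 the sine vanishes and the definition selects `A`; only continuity
gives the value of `B`. -/
theorem glue_right {A B : ℝ → E3} (hg : Continuous (glue A B)) (hB : Continuous B) {t : ℝ}
    (h : t ∈ Icc (1 / 2 : ℝ) 1) : glue A B t = B t := by
  have hc : IsClosed {t | glue A B t = B t} := isClosed_eq hg hB
  have : closure (Ioo (1 / 2 : ℝ) 1) ⊆ {t | glue A B t = B t} :=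
    hc.closure_subset_iff.2 fun t ht => glue_right_Ioo ht
  rw [closure_Ioo (by norm_num)] at this
  exact this h

theorem periodic_fract {F : Type*} {f : ℝ → F} (hf : Function.Periodic f 1) (t : ℝ) :
    f (Int.fract t) = f t := by
  have := hf.sub_zsmul_eq (x := t) ⌊t⌋
  rw [← this, zsmul_one, Int.fract]

theorem periodic_add_int {F : Type*} {f : ℝ → F} (hf : Function.Periodic f 1) (t : ℝ) (n : ℤ) :
    f (t + n) = f t := by
  rw [← periodic_fract hf (t + n), Int.fract_add_intCast, periodic_fract hf]

theorem periodic_ext {F : Type*} {f g : ℝ → F} (hf : Function.Periodic f 1)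
    (hg : Function.Periodic g 1) (h : ∀ t ∈ Ico (0 : ℝ) 1, f t = g t) : f = g := by
  funext t
  rw [← periodic_fract hf, ← periodic_fract hg]
  exact h _ ⟨Int.fract_nonneg t, Int.fract_lt_one t⟩

theorem eq_glue {A B c : ℝ → E3} (hc : Function.Periodic c 1) (hA : Function.Periodic A 1)
    (hB : Function.Periodic B 1) (h1 : ∀ t ∈ Icc (0 : ℝ) (1 / 2), c t = A t)
    (h2 : ∀ t ∈ Icc (1 / 2 : ℝ) 1, c t = B t) : c = glue A B := by
  refine periodic_ext hc (glue_periodic hA hB) fun t ht => ?_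
  rcases le_or_gt t (1 / 2) with h | h
  · rw [h1 t ⟨ht.1, h⟩, glue_left ⟨ht.1, h⟩]
  · rw [h2 t ⟨h.le, ht.2.le⟩, glue_right_Ioo ⟨h, ht.2⟩]

theorem deriv_glue_left {A B : ℝ → E3} (hs : ContDiff ℝ ∞ (glue A B)) (hA : ContDiff ℝ ∞ A) {t : ℝ}
    (h : t ∈ Icc (0 : ℝ) (1 / 2)) : deriv (glue A B) t = deriv A t := by
  have hc : IsClosed {t | deriv (glue A B) t = deriv A t} :=
    isClosed_eq (hs.continuous_deriv (by simp)) (hA.continuous_deriv (by simp))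
  have : closure (Ioo (0 : ℝ) (1 / 2)) ⊆ {t | deriv (glue A B) t = deriv A t} := by
    refine hc.closure_subset_iff.2 fun t ht => Filter.EventuallyEq.deriv_eq ?_
    filter_upwards [Ioo_mem_nhds ht.1 ht.2] with x hx using glue_left ⟨hx.1.le, hx.2.le⟩
  rw [closure_Ioo (by norm_num)] at this
  exact this h

theorem deriv_glue_right {A B : ℝ → E3} (hs : ContDiff ℝ ∞ (glue A B)) (hB : ContDiff ℝ ∞ B)
    {t : ℝ} (h : t ∈ Icc (1 / 2 : ℝ) 1) : deriv (glue A B) t = deriv B t := by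
  have hc : IsClosed {t | deriv (glue A B) t = deriv B t} :=
    isClosed_eq (hs.continuous_deriv (by simp)) (hB.continuous_deriv (by simp))
  have : closure (Ioo (1 / 2 : ℝ) 1) ⊆ {t | deriv (glue A B) t = deriv B t} := by
    refine hc.closure_subset_iff.2 fun t ht => Filter.EventuallyEq.deriv_eq ?_
    filter_upwards [Ioo_mem_nhds ht.1 ht.2] with x hx using glue_right_Ioo hx
  rw [closure_Ioo (by norm_num)] at this
  exact this h

/-- Disjointness is required of the open left arc only. The joints belong to the right arc as well,
since smoothness of the glued curve forces `A 0 = B 1` and the analogous equality at 1/2, and there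
the injectivity of `B` decides. -/
theorem isKnot_glue {A B : ℝ → E3} (hA : ContDiff ℝ ∞ A) (hB : ContDiff ℝ ∞ B)
    (pA : Function.Periodic A 1) (pB : Function.Periodic B 1) (hs : ContDiff ℝ ∞ (glue A B))
    (iA : ∀ t ∈ Icc (0 : ℝ) (1 / 2), deriv A t ≠ 0) (iB : ∀ t ∈ Icc (1 / 2 : ℝ) 1, deriv B t ≠ 0)
    (jA : InjOn A (Icc 0 (1 / 2))) (jB : InjOn B (Icc (1 / 2) 1))
    (hAB : ∀ t ∈ Ioo (0 : ℝ) (1 / 2), ∀ t' ∈ Icc (1 / 2 : ℝ) 1, A t ≠ B t') :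
    IsKnot (glue A B) := by
  have hp := glue_periodic pA pB
  have hr : ∀ {t : ℝ}, t ∈ Icc (1 / 2 : ℝ) 1 → glue A B t = B t :=
    glue_right hs.continuous hB.continuous
  have hdp : Function.Periodic (deriv (glue A B)) 1 := fun t => by
    have : (fun x => glue A B (x + 1)) = glue A B := funext hp
    rw [← deriv_comp_add_const, this]
  have himm : ∀ t, deriv (glue A B) t ≠ 0 := fun t => by
    rw [← periodic_fract hdp]
    have h0 := Int.fract_nonneg t
    have h1 := (Int.fract_lt_one t).le
    rcases le_total (Int.fract t) (1 / 2) with h | h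
    · rw [deriv_glue_left hs hA ⟨h0, h⟩]
      exact iA _ ⟨h0, h⟩
    · rw [deriv_glue_right hs hB ⟨h, h1⟩]
      exact iB _ ⟨h, h1⟩
  have h01 : A 0 = B 1 := by
    rw [← glue_left (A := A) (B := B) (t := 0) (by norm_num), ← hr (t := 1) (by norm_num)]
    have := hp 0
    rw [zero_add] at this
    exact this.symm
  have hmix : ∀ t t' : ℝ, 0 ≤ t → t ≤ 1 / 2 → 1 / 2 < t' → t' < 1 →
      glue A B t ≠ glue A B t' := by
    intro t t' h0 h1 h2 h3 e
    rw [hr ⟨h2.le, h3.le⟩] at e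
    rcases h0.eq_or_lt with rfl | h0
    · rw [glue_left ⟨le_rfl, h1⟩, h01] at e
      have := jB ⟨by norm_num, le_rfl⟩ ⟨h2.le, h3.le⟩ e
      linarith
    · rcases h1.eq_or_lt with rfl | h1
      · rw [hr ⟨le_rfl, by norm_num⟩] at e
        have := jB ⟨le_rfl, by norm_num⟩ ⟨h2.le, h3.le⟩ e
        linarith
      · rw [glue_left ⟨h0.le, h1.le⟩] at e
        exact hAB t ⟨h0, h1⟩ t' ⟨h2.le, h3.le⟩ e
  refine Knot.isKnot ⟨glue A B, hs, hp, himm, fun t ht t' ht' e => ?_⟩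
  rcases le_or_gt t (1 / 2) with h | h <;> rcases le_or_gt t' (1 / 2) with h' | h'
  · rw [glue_left ⟨ht.1, h⟩, glue_left ⟨ht'.1, h'⟩] at e
    exact jA ⟨ht.1, h⟩ ⟨ht'.1, h'⟩ e
  · exact absurd e (hmix t t' ht.1 h h' ht'.2)
  · exact absurd e.symm (hmix t' t ht'.1 h' h ht.2)
  · rw [hr ⟨h.le, ht.2.le⟩, hr ⟨h'.le, ht'.2.le⟩] at e
    exact jB ⟨h.le, ht.2.le⟩ ⟨h'.le, ht'.2.le⟩ e

/-- A zero that is not a limit of negative values would be a local minimum, so the cosine would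
vanish together with the sine. -/
theorem mem_closure_sin_neg {t : ℝ} (h : Real.sin (2 * Real.pi * t) = 0) :
    t ∈ closure {t : ℝ | Real.sin (2 * Real.pi * t) < 0} := by
  by_contra hn
  have hmin : IsLocalMin (fun t => Real.sin (2 * Real.pi * t)) t := by
    have : (closure {t : ℝ | Real.sin (2 * Real.pi * t) < 0})ᶜ ∈ 𝓝 t :=
      isClosed_closure.isOpen_compl.mem_nhds hn
    filter_upwards [this] with x hx
    rw [h]
    exact not_lt.1 fun h' => hx (subset_closure h')
  have hd : HasDerivAt (fun t => Real.sin (2 * Real.pi * t))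
      (Real.cos (2 * Real.pi * t) * (2 * Real.pi * 1)) t :=
    ((hasDerivAt_id t).const_mul _).sin
  have h0 := hmin.hasDerivAt_eq_zero hd
  have hc : Real.cos (2 * Real.pi * t) = 0 := by
    have := Real.pi_pos
    rcases mul_eq_zero.1 h0 with h0 | h0
    · exact h0
    · linarith
  have := Real.sin_sq_add_cos_sq (2 * Real.pi * t)
  rw [h, hc] at this
  norm_num at this

theorem mem_closure_sin_pos {t : ℝ} (h : Real.sin (2 * Real.pi * t) = 0) :
    t ∈ closure {t : ℝ | 0 < Real.sin (2 * Real.pi * t)} := by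
  have h' : Real.sin (2 * Real.pi * (-t)) = 0 := by
    rw [mul_neg, Real.sin_neg, h, neg_zero]
  have := mem_closure_sin_neg h'
  have h2 : (Homeomorph.neg ℝ) t ∈ closure {t : ℝ | Real.sin (2 * Real.pi * t) < 0} := this
  rw [← mem_preimage, Homeomorph.preimage_closure] at h2
  convert h2 using 2
  ext x
  simp

theorem fract_mem_of_sin_neg {t : ℝ} (h : Real.sin (2 * Real.pi * t) < 0) :
    Int.fract t ∈ Ioo (1 / 2 : ℝ) 1 := by
  refine ⟨?_, Int.fract_lt_one t⟩
  by_contra hn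
  have hp : Function.Periodic (fun t => Real.sin (2 * Real.pi * t)) 1 := sin_two_pi_add_one
  rw [← periodic_fract hp] at h
  have := Real.pi_pos
  have h0 := Int.fract_nonneg t
  refine absurd h (not_lt.2 (Real.sin_nonneg_of_nonneg_of_le_pi (by positivity) ?_))
  nlinarith

theorem fract_mem_of_sin_nonneg {t : ℝ} (h : 0 ≤ Real.sin (2 * Real.pi * t)) :
    Int.fract t ∈ Icc (0 : ℝ) (1 / 2) := by
  refine ⟨Int.fract_nonneg t, ?_⟩
  by_contra hn
  have hp : Function.Periodic (fun t => Real.sin (2 * Real.pi * t)) 1 := sin_two_pi_add_one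
  rw [← periodic_fract hp] at h
  have := Real.pi_pos
  have h1 := Int.fract_lt_one t
  refine absurd h (not_le.2 ?_)
  rw [← Real.sin_sub_two_pi]
  refine Real.sin_neg_of_neg_of_neg_pi_lt ?_ ?_ <;> nlinarith

/-- Two families may be glued if each continues a common family `C` beyond the joints. -/
theorem contDiff_glue_family {A B C : ℝ → ℝ → E3}
    (hA : ContDiff ℝ ∞ fun p : ℝ × ℝ => A p.1 p.2)
    (hB : ContDiff ℝ ∞ fun p : ℝ × ℝ => B p.1 p.2) (hC : ContDiff ℝ ∞ fun p : ℝ × ℝ => C p.1 p.2)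
    (pA : ∀ s, Function.Periodic (A s) 1) (pB : ∀ s, Function.Periodic (B s) 1)
    (pC : ∀ s, Function.Periodic (C s) 1) (h1 : ∀ s, ∀ t ∈ Icc (1 / 2 : ℝ) 1, A s t = C s t)
    (h2 : ∀ s, ∀ t ∈ Icc (0 : ℝ) (1 / 2), B s t = C s t) :
    ContDiff ℝ ∞ fun p : ℝ × ℝ => glue (A p.1) (B p.1) p.2 := by
  have h1' : ∀ s t, Real.sin (2 * Real.pi * t) < 0 → A s t = C s t := fun s t h => by
    have := fract_mem_of_sin_neg h
    rw [← periodic_fract (pA s), ← periodic_fract (pC s)]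
    exact h1 s _ ⟨this.1.le, this.2.le⟩
  have h2' : ∀ s t, 0 ≤ Real.sin (2 * Real.pi * t) → B s t = C s t := fun s t h => by
    rw [← periodic_fract (pB s), ← periodic_fract (pC s)]
    exact h2 s _ (fract_mem_of_sin_nonneg h)
  have hg : Continuous fun p : ℝ × ℝ => Real.sin (2 * Real.pi * p.2) := by fun_prop
  have hflat : ∀ {U : Set ℝ} {V : Set (ℝ × ℝ)} (_ : IsOpen U) (_ : ∀ p : ℝ × ℝ, p.2 ∈ U → p ∈ V)
      (p : ℝ × ℝ), p.2 ∈ closure U → p ∈ closure (interior V) := by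
    intro U V hU hV p hp
    have : (univ : Set ℝ) ×ˢ U ⊆ interior V :=
      interior_maximal (fun q hq => hV q hq.2) (isOpen_univ.prod hU)
    refine closure_mono this ?_
    rw [closure_prod_eq, closure_univ]
    exact ⟨mem_univ _, hp⟩
  -- The glued family is C + (A - C) + (B - C), each difference being cut off to its own half of the
  -- period. On the other half it vanishes identically, which is the flatness needed at the joints.
  have kB : ContDiff ℝ ∞ fun p : ℝ × ℝ =>
      if 0 ≤ Real.sin (2 * Real.pi * p.2) then (0 : E3) else B p.1 p.2 - C p.1 p.2 := by
    refine contDiff_ite_of_flat hg (D := fun p : ℝ × ℝ => B p.1 p.2 - C p.1 p.2) (hB.sub hC)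
      fun p hp => ?_
    refine hflat (U := {t | 0 < Real.sin (2 * Real.pi * t)})
      (isOpen_lt continuous_const (by fun_prop)) (fun q hq => ?_) p (mem_closure_sin_pos hp)
    rw [mem_ofPred_eq] at hq ⊢
    rw [h2' _ _ hq.le, sub_self]
  have kA : ContDiff ℝ ∞ fun p : ℝ × ℝ =>
      if 0 ≤ -Real.sin (2 * Real.pi * p.2) then (0 : E3) else A p.1 p.2 - C p.1 p.2 := by
    refine contDiff_ite_of_flat hg.neg (D := fun p : ℝ × ℝ => A p.1 p.2 - C p.1 p.2) (hA.sub hC)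
      fun p hp => ?_
    refine hflat (U := {t | Real.sin (2 * Real.pi * t) < 0})
      (isOpen_lt (by fun_prop) continuous_const) (fun q hq => ?_) p
      (mem_closure_sin_neg (neg_eq_zero.1 hp))
    rw [mem_ofPred_eq] at hq ⊢
    rw [h1' _ _ hq, sub_self]
  have h0 : ∀ p : ℝ × ℝ, Real.sin (2 * Real.pi * p.2) = 0 → A p.1 p.2 = C p.1 p.2 := by
    intro p hp
    have hcl : IsClosed {t | A p.1 t = C p.1 t} :=
      isClosed_eq (smooth_slice hA p.1).continuous (smooth_slice hC p.1).continuous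
    exact hcl.closure_subset_iff.2 (fun t ht => h1' _ _ ht) (mem_closure_sin_neg hp)
  have := (hC.add kA).add kB
  convert this using 1
  funext p
  unfold glue
  rcases lt_trichotomy (Real.sin (2 * Real.pi * p.2)) 0 with h | h | h
  · simp [h.le, not_le.2 h]
  · simp [h, h0 p h]
  · simp [h.le, not_le.2 h]

theorem contDiff_glue {A B C : ℝ → E3} (hA : ContDiff ℝ ∞ A) (hB : ContDiff ℝ ∞ B)
    (hC : ContDiff ℝ ∞ C) (pA : Function.Periodic A 1) (pB : Function.Periodic B 1)
    (pC : Function.Periodic C 1) (h1 : ∀ t ∈ Icc (1 / 2 : ℝ) 1, A t = C t)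
    (h2 : ∀ t ∈ Icc (0 : ℝ) (1 / 2), B t = C t) : ContDiff ℝ ∞ (glue A B) :=
  smooth_slice (H := fun _ => glue A B) (contDiff_glue_family (A := fun _ => A) (B := fun _ => B)
    (C := fun _ => C) (hA.comp contDiff_snd) (hB.comp contDiff_snd) (hC.comp contDiff_snd)
    (fun _ => pA) (fun _ => pB) (fun _ => pC) (fun _ => h1) (fun _ => h2)) 0

/-! ### Projective maps preserving the unit circle, and their lift to the parameter line. -/

/-- The denominator of `proj k`. -/
def projDen (k : ℝ) (w : E3) : ℝ := (k ^ 2 + 1) - (k ^ 2 - 1) * w 0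

/-- The projective transformation of space that preserves the unit sphere, fixes `(1, 0, 0)` and
`(-1, 0, 0)`, and moves the other points of the sphere towards the latter if `1 < k`. -/
def proj (k : ℝ) (w : E3) : E3 :=
  !₂[((k ^ 2 + 1) * w 0 - (k ^ 2 - 1)) / projDen k w, 2 * k * w 1 / projDen k w,
    2 * k * w 2 / projDen k w]

theorem proj_zero (k : ℝ) (w : E3) :
    proj k w 0 = ((k ^ 2 + 1) * w 0 - (k ^ 2 - 1)) / projDen k w := by simp [proj]

theorem proj_one (k : ℝ) (w : E3) : proj k w 1 = 2 * k * w 1 / projDen k w := by simp [proj]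

theorem proj_two (k : ℝ) (w : E3) : proj k w 2 = 2 * k * w 2 / projDen k w := by simp [proj]

theorem E3_ext {v w : E3} (h0 : v 0 = w 0) (h1 : v 1 = w 1) (h2 : v 2 = w 2) : v = w := by
  ext i
  fin_cases i
  exacts [h0, h1, h2]

theorem contDiff_E3 {E : Type*} [NormedAddCommGroup E] [NormedSpace ℝ E] {f : E → E3}
    (h0 : ContDiff ℝ ∞ fun p => f p 0) (h1 : ContDiff ℝ ∞ fun p => f p 1)
    (h2 : ContDiff ℝ ∞ fun p => f p 2) : ContDiff ℝ ∞ f := by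
  rw [contDiff_euclidean]
  intro i
  fin_cases i
  exacts [h0, h1, h2]

theorem contDiff_coord {E : Type*} [NormedAddCommGroup E] [NormedSpace ℝ E] {f : E → E3}
    (h : ContDiff ℝ ∞ f) (i : Fin 3) : ContDiff ℝ ∞ fun p => f p i :=
  contDiff_euclidean.1 h i

theorem proj_one_eq (w : E3) : proj 1 w = w := by
  refine E3_ext ?_ ?_ ?_
  · rw [proj_zero, projDen]; ring
  · rw [proj_one, projDen]; ring
  · rw [proj_two, projDen]; ring

theorem contDiff_proj {E : Type*} [NormedAddCommGroup E] [NormedSpace ℝ E] {f : E → E3}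
    {k : E → ℝ} (hf : ContDiff ℝ ∞ f) (hk : ContDiff ℝ ∞ k) (h : ∀ p, projDen (k p) (f p) ≠ 0) :
    ContDiff ℝ ∞ fun p => proj (k p) (f p) := by
  have h0 := contDiff_coord hf 0
  have h1 := contDiff_coord hf 1
  have h2 := contDiff_coord hf 2
  have hd : ContDiff ℝ ∞ fun p => projDen (k p) (f p) := by unfold projDen; fun_prop
  refine contDiff_E3 ?_ ?_ ?_
  · simp only [proj_zero]; exact ContDiff.div (by fun_prop) hd h
  · simp only [proj_one]; exact ContDiff.div (by fun_prop) hd h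
  · simp only [proj_two]; exact ContDiff.div (by fun_prop) hd h

/-- Since this is nonzero, `proj k⁻¹` is defined and differentiable at the image point, where it
inverts `proj k`. -/
theorem projDen_inv_proj {k : ℝ} (hk : 0 < k) {w : E3} (hw : projDen k w ≠ 0) :
    projDen k⁻¹ (proj k w) = 4 / projDen k w := by
  rw [projDen, proj_zero]
  field_simp
  unfold projDen
  ring

theorem proj_inv_proj {k : ℝ} (hk : 0 < k) {w : E3} (hw : projDen k w ≠ 0) :
    proj k⁻¹ (proj k w) = w := by
  refine E3_ext ?_ ?_ ?_
  · rw [proj_zero, projDen_inv_proj hk hw, proj_zero]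
    field_simp
    unfold projDen
    ring
  · rw [proj_one, projDen_inv_proj hk hw, proj_one]
    field_simp
    ring
  · rw [proj_two, projDen_inv_proj hk hw, proj_two]
    field_simp
    ring

theorem differentiableAt_proj (k : ℝ) {w : E3} (h : projDen k w ≠ 0) :
    DifferentiableAt ℝ (proj k) w := by
  have hc : ∀ i : Fin 3, DifferentiableAt ℝ (fun w : E3 => w i) w := fun i =>
    (contDiff_coord contDiff_id i).differentiable (by simp) w
  have h0 := hc 0
  have h1 := hc 1
  have h2 := hc 2
  have hd : DifferentiableAt ℝ (fun w => projDen k w) w := by unfold projDen; fun_prop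
  rw [differentiableAt_euclidean]
  intro i
  fin_cases i
  · show DifferentiableAt ℝ (fun w => proj k w 0) w
    simp only [proj_zero, div_eq_mul_inv]
    exact DifferentiableAt.mul (by fun_prop) (hd.fun_inv h)
  · show DifferentiableAt ℝ (fun w => proj k w 1) w
    simp only [proj_one, div_eq_mul_inv]
    exact DifferentiableAt.mul (by fun_prop) (hd.fun_inv h)
  · show DifferentiableAt ℝ (fun w => proj k w 2) w
    simp only [proj_two, div_eq_mul_inv]
    exact DifferentiableAt.mul (by fun_prop) (hd.fun_inv h)

/-- Injectivity and immersion both come from the differentiable left inverse `proj k⁻¹`: a vanishing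
velocity of the image would, by the chain rule, be a vanishing velocity of `f`. -/
theorem isKnot_proj {f : ℝ → E3} (hf : IsKnot f) {k : ℝ} (hk : 0 < k)
    (h : ∀ t, projDen k (f t) ≠ 0) : IsKnot (fun t => proj k (f t)) where
  smooth := contDiff_proj hf.smooth contDiff_const h
  periodic := fun t => by simp only [hf.periodic t]
  immersed := fun t h0 => by
    have h1 : DifferentiableAt ℝ (fun t => proj k (f t)) t :=
      (contDiff_proj hf.smooth contDiff_const h).differentiable (by simp) t
    have h2 : DifferentiableAt ℝ (proj k⁻¹) (proj k (f t)) := by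
      refine differentiableAt_proj _ ?_
      rw [projDen_inv_proj hk (h t)]
      exact div_ne_zero (by norm_num) (h t)
    have h3 := h2.hasFDerivAt.comp_hasDerivAt t h1.hasDerivAt
    have h4 : (proj k⁻¹ ∘ fun t => proj k (f t)) = f := funext fun t => proj_inv_proj hk (h t)
    rw [h4, h0, map_zero] at h3
    exact hf.immersed t h3.deriv
  inj := fun t t' e => by
    refine hf.inj t t' ?_
    rw [← proj_inv_proj hk (h t), ← proj_inv_proj hk (h t'), e]

theorem unitCircle_zero (t : ℝ) : unitCircle t 0 = -Real.sin (2 * Real.pi * t) := by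
  simp [unitCircle]

theorem unitCircle_one (t : ℝ) : unitCircle t 1 = Real.cos (2 * Real.pi * t) := by
  simp [unitCircle]

theorem unitCircle_two (t : ℝ) : unitCircle t 2 = 0 := by
  simp [unitCircle]

theorem contDiff_unitCircle : ContDiff ℝ ∞ unitCircle := by
  refine contDiff_E3 ?_ ?_ ?_
  · simp only [unitCircle_zero]; fun_prop
  · simp only [unitCircle_one]; fun_prop
  · simp only [unitCircle_two]; fun_prop

theorem unitCircle_periodic : Function.Periodic unitCircle 1 := fun t => by
  refine E3_ext ?_ ?_ ?_
  · rw [unitCircle_zero, unitCircle_zero, sin_two_pi_add_one]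
  · rw [unitCircle_one, unitCircle_one, mul_add, mul_one, Real.cos_add_two_pi]
  · rw [unitCircle_two, unitCircle_two]

theorem hasDerivAt_coord {f : ℝ → E3} {f' : E3} {t : ℝ} (h : HasDerivAt f f' t) (i : Fin 3) :
    HasDerivAt (fun t => f t i) (f' i) t :=
  (EuclideanSpace.proj i : E3 →L[ℝ] ℝ).hasFDerivAt.comp_hasDerivAt t h

theorem deriv_coord {f : ℝ → E3} (hf : ContDiff ℝ ∞ f) (i : Fin 3) (t : ℝ) :
    deriv (fun t => f t i) t = deriv f t i :=
  (hasDerivAt_coord (hf.differentiable (by simp) t).hasDerivAt i).deriv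

theorem deriv_unitCircle_zero (t : ℝ) :
    deriv unitCircle t 0 = -(2 * Real.pi * Real.cos (2 * Real.pi * t)) := by
  rw [← deriv_coord contDiff_unitCircle]
  simp only [unitCircle_zero]
  have : HasDerivAt (fun t => -Real.sin (2 * Real.pi * t))
      (-(Real.cos (2 * Real.pi * t) * (2 * Real.pi * 1))) t :=
    ((hasDerivAt_id t).const_mul _).sin.neg
  rw [this.deriv]; ring

theorem deriv_unitCircle_one (t : ℝ) :
    deriv unitCircle t 1 = -(2 * Real.pi * Real.sin (2 * Real.pi * t)) := by
  rw [← deriv_coord contDiff_unitCircle]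
  simp only [unitCircle_one]
  have : HasDerivAt (fun t => Real.cos (2 * Real.pi * t))
      (-Real.sin (2 * Real.pi * t) * (2 * Real.pi * 1)) t :=
    ((hasDerivAt_id t).const_mul _).cos
  rw [this.deriv]; ring

theorem deriv_unitCircle_two (t : ℝ) : deriv unitCircle t 2 = 0 := by
  rw [← deriv_coord contDiff_unitCircle]
  simp only [unitCircle_two]
  simp

theorem isKnot_unitCircle : IsKnot unitCircle where
  smooth := contDiff_unitCircle
  periodic := unitCircle_periodic
  immersed := fun t h => by
    have h0 := deriv_unitCircle_zero t
    have h1 := deriv_unitCircle_one t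
    rw [h] at h0 h1
    have := Real.pi_pos
    have a0 : Real.cos (2 * Real.pi * t) = 0 := by
      have : (2 * Real.pi) * Real.cos (2 * Real.pi * t) = 0 := by simpa using h0.symm
      exact (mul_eq_zero.1 this).resolve_left (by positivity)
    have a1 : Real.sin (2 * Real.pi * t) = 0 := by
      have : (2 * Real.pi) * Real.sin (2 * Real.pi * t) = 0 := by simpa using h1.symm
      exact (mul_eq_zero.1 this).resolve_left (by positivity)
    have := Real.sin_sq_add_cos_sq (2 * Real.pi * t)
    rw [a0, a1] at this
    norm_num at this
  inj := fun t t' h => by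
    have h0 : unitCircle t 0 = unitCircle t' 0 := by rw [h]
    have h1 : unitCircle t 1 = unitCircle t' 1 := by rw [h]
    rw [unitCircle_zero, unitCircle_zero, neg_inj] at h0
    rw [unitCircle_one, unitCircle_one] at h1
    obtain ⟨n, hn⟩ := Real.Angle.angle_eq_iff_two_pi_dvd_sub.1 (Real.Angle.cos_sin_inj h1 h0)
    refine ⟨n, ?_⟩
    have := Real.pi_pos
    have h2 : 2 * Real.pi * (t - t' - n) = 0 := by linarith
    have := (mul_eq_zero.1 h2).resolve_left (by positivity)
    linarith

theorem unitCircle_zero_mem (t : ℝ) : unitCircle t 0 ∈ Icc (-1 : ℝ) 1 := by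
  rw [unitCircle_zero]
  exact ⟨by linarith [Real.sin_le_one (2 * Real.pi * t)],
    by linarith [Real.neg_one_le_sin (2 * Real.pi * t)]⟩

theorem projDen_pos_of_mem {k : ℝ} (hk : 0 < k) {w : E3} (h : w 0 ∈ Icc (-1 : ℝ) 1) :
    0 < projDen k w := by
  unfold projDen
  nlinarith [h.1, h.2, mul_nonneg (sq_nonneg k) (sub_nonneg.2 h.2), pow_pos hk 2]

/-- The denominator is 2 + (k² - 1)(1 - x): the plane sent to infinity lies beyond x = 1. -/
theorem projDen_pos_of_le {k : ℝ} (hk : 1 ≤ k) {w : E3} (h : w 0 ≤ 1) : 0 < projDen k w := by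
  unfold projDen
  nlinarith [mul_nonneg (sub_nonneg.2 h) (show 0 ≤ k ^ 2 - 1 by nlinarith)]

/-- The lift to the line of the action of `proj k` on the unit circle. -/
def lift (k t : ℝ) : ℝ :=
  t + Real.pi⁻¹ * Real.arctan ((k - 1) * Real.sin (Real.pi * (t - 3 / 4)) *
    Real.cos (Real.pi * (t - 3 / 4)) /
    (Real.cos (Real.pi * (t - 3 / 4)) ^ 2 + k * Real.sin (Real.pi * (t - 3 / 4)) ^ 2))

theorem lift_den_pos {k : ℝ} (hk : 0 < k) (α : ℝ) : 0 < Real.cos α ^ 2 + k * Real.sin α ^ 2 := by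
  have h := Real.sin_sq_add_cos_sq α
  rcases eq_or_ne (Real.sin α) 0 with h0 | h0
  · rw [h0] at h ⊢
    nlinarith
  · have := mul_pos hk (pow_pos (abs_pos.2 h0) 2)
    rw [sq_abs] at this
    positivity

theorem contDiff_lift {E : Type*} [NormedAddCommGroup E] [NormedSpace ℝ E] {k g : E → ℝ}
    (hk : ContDiff ℝ ∞ k) (hg : ContDiff ℝ ∞ g) (h : ∀ p, 0 < k p) :
    ContDiff ℝ ∞ fun p => lift (k p) (g p) := by
  unfold lift
  refine hg.add (contDiff_const.mul (Real.contDiff_arctan.comp (ContDiff.div ?_ ?_ fun p =>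
    (lift_den_pos (h p) _).ne'))) <;> fun_prop

theorem lift_add_one (k t : ℝ) : lift k (t + 1) = lift k t + 1 := by
  unfold lift
  have e : Real.pi * (t + 1 - 3 / 4) = Real.pi * (t - 3 / 4) + Real.pi := by ring
  rw [e, Real.sin_add_pi, Real.cos_add_pi]
  ring_nf

theorem lift_one (t : ℝ) : lift 1 t = t := by simp [lift]

/-- Let 2α be the angle on the circle measured from (1, 0, 0). The projective map acts as tan α ↦ k
tan α, and the arctangent in `lift` is the increment δ of α given by the subtraction formula for
tangents. Its denominator never vanishes, so no branch has to be chosen. -/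
theorem unitCircle_lift {k : ℝ} (hk : 0 < k) (t : ℝ) :
    unitCircle (lift k t) = proj k (unitCircle t) := by
  set α := Real.pi * (t - 3 / 4) with hα
  set D := Real.cos α ^ 2 + k * Real.sin α ^ 2 with hD
  have hDpos : 0 < D := lift_den_pos hk α
  set N := (k - 1) * Real.sin α * Real.cos α with hN
  set δ := Real.arctan (N / D) with hδ
  have hsc := Real.sin_sq_add_cos_sq α
  have ht : 2 * Real.pi * t = 2 * α + Real.pi + Real.pi / 2 := by rw [hα]; ring
  have hl : 2 * Real.pi * lift k t = 2 * (α + δ) + Real.pi + Real.pi / 2 := by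
    unfold lift
    rw [← hα, ← hD, ← hN, ← hδ]
    have := Real.pi_ne_zero
    field_simp
    rw [hα]; ring
  have x0 : unitCircle t 0 = Real.cos (2 * α) := by
    rw [unitCircle_zero, ht, Real.sin_add_pi_div_two, Real.cos_add_pi, neg_neg]
  have y0 : unitCircle t 1 = Real.sin (2 * α) := by
    rw [unitCircle_one, ht, Real.cos_add_pi_div_two, Real.sin_add_pi, neg_neg]
  have x1 : unitCircle (lift k t) 0 = Real.cos (2 * (α + δ)) := by
    rw [unitCircle_zero, hl, Real.sin_add_pi_div_two, Real.cos_add_pi, neg_neg]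
  have y1 : unitCircle (lift k t) 1 = Real.sin (2 * (α + δ)) := by
    rw [unitCircle_one, hl, Real.cos_add_pi_div_two, Real.sin_add_pi, neg_neg]
  have hcδ : 0 < Real.cos δ := Real.cos_arctan_pos _
  have hsδ : Real.sin δ * D = N * Real.cos δ := by
    have : Real.tan δ = N / D := Real.tan_arctan _
    rw [Real.tan_eq_sin_div_cos] at this
    field_simp at this
    linarith
  have hscδ := Real.sin_sq_add_cos_sq δ
  have hDD : Real.cos δ ^ 2 * (D ^ 2 + N ^ 2) = D ^ 2 := by
    linear_combination D ^ 2 * hscδ - (Real.sin δ * D + N * Real.cos δ) * hsδ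
  have hDN : D ^ 2 + N ^ 2 = Real.cos α ^ 2 + k ^ 2 * Real.sin α ^ 2 := by
    rw [hD, hN]
    linear_combination (Real.cos α ^ 2 + k ^ 2 * Real.sin α ^ 2) * hsc
  set c := Real.cos α
  set s := Real.sin α
  set q := c ^ 2 + k ^ 2 * s ^ 2 with hq
  have hqpos : 0 < q := by rw [← hDN]; positivity
  have hden : projDen k (unitCircle t) = 2 * q := by
    rw [projDen, x0, Real.cos_two_mul]
    change k ^ 2 + 1 - (k ^ 2 - 1) * (2 * c ^ 2 - 1) = _
    rw [hq]; linear_combination (-2 * k ^ 2) * hsc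
  -- Together with `hsa` this says tan (α + δ) = k tan α, written without division by cosines.
  have hca : Real.cos (α + δ) * D = Real.cos δ * c := by
    rw [Real.cos_add]
    change (c * Real.cos δ - s * Real.sin δ) * D = _
    have : D * c - s * N = c := by
      rw [hD, hN]; linear_combination c * hsc
    linear_combination (-s) * hsδ + Real.cos δ * this
  have hsa : Real.sin (α + δ) * D = Real.cos δ * (k * s) := by
    rw [Real.sin_add]
    change (s * Real.cos δ + c * Real.sin δ) * D = _
    have : D * s + c * N = k * s := by
      rw [hD, hN]; linear_combination (k * s) * hsc
    linear_combination c * hsδ + Real.cos δ * this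
  have hcc : Real.cos (α + δ) ^ 2 * q = c ^ 2 := by
    have h1 : (Real.cos (α + δ) ^ 2 * q - c ^ 2) * D ^ 2 = 0 := by
      linear_combination (Real.cos (α + δ) * D + Real.cos δ * c) * q * hca +
        c ^ 2 * hDD - c ^ 2 * Real.cos δ ^ 2 * hDN
    have := (mul_eq_zero.1 h1).resolve_right (by positivity)
    linarith
  have hcs : Real.sin (α + δ) * Real.cos (α + δ) * q = k * s * c := by
    have h1 : (Real.sin (α + δ) * Real.cos (α + δ) * q - k * s * c) * D ^ 2 = 0 := by
      linear_combination (Real.cos (α + δ) * D) * q * hsa + Real.cos δ * (k * s) * q * hca +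
        k * s * c * hDD - k * s * c * Real.cos δ ^ 2 * hDN
    have := (mul_eq_zero.1 h1).resolve_right (by positivity)
    linarith
  refine E3_ext ?_ ?_ ?_
  · rw [x1, proj_zero, hden, x0, Real.cos_two_mul, Real.cos_two_mul,
      eq_div_iff (by positivity)]
    change _ = (k ^ 2 + 1) * (2 * c ^ 2 - 1) - (k ^ 2 - 1)
    linear_combination 4 * hcc - 2 * hq - 2 * k ^ 2 * hsc
  · rw [y1, proj_one, hden, y0, Real.sin_two_mul, Real.sin_two_mul, eq_div_iff (by positivity)]
    change _ = 2 * k * (2 * s * c)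
    linear_combination 4 * hcs
  · rw [proj_two, unitCircle_two, unitCircle_two]; simp

theorem lift_add_int (k t : ℝ) (n : ℤ) : lift k (t + n) = lift k t + n := by
  have hp : Function.Periodic (fun t => lift k t - t) 1 := fun t => by
    simp only [lift_add_one]; ring
  have := periodic_add_int hp t n
  linarith

theorem isKnot_proj_unitCircle {k : ℝ} (hk : 0 < k) :
    IsKnot (fun t => proj k (unitCircle t)) :=
  isKnot_proj isKnot_unitCircle hk fun t => (projDen_pos_of_mem hk (unitCircle_zero_mem t)).ne'

theorem contDiff_lift_right {k : ℝ} (hk : 0 < k) : ContDiff ℝ ∞ (lift k) :=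
  contDiff_lift (k := fun _ : ℝ => k) contDiff_const contDiff_id fun _ => hk

/-- `lift k` covers the injective map `proj k` of the circle, so two parameters with equal lifts
differ by an integer, and `lift k` commutes with integer translations. -/
theorem lift_injective {k : ℝ} (hk : 0 < k) : Function.Injective (lift k) := fun t t' h => by
  have h1 : proj k (unitCircle t) = proj k (unitCircle t') := by
    rw [← unitCircle_lift hk, ← unitCircle_lift hk, h]
  obtain ⟨n, hn⟩ := (isKnot_proj_unitCircle hk).inj t t' h1
  rw [hn, lift_add_int] at h
  have : (n : ℝ) = 0 := by linarith
  rw [hn, this, add_zero]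

theorem lift_strictMono {k : ℝ} (hk : 0 < k) : StrictMono (lift k) := by
  rcases (contDiff_lift_right hk).continuous.strictMono_of_inj (lift_injective hk) with h | h
  · exact h
  · have := h (show (0 : ℝ) < 0 + 1 by norm_num)
    rw [lift_add_one] at this
    linarith

theorem deriv_lift_ne_zero {k : ℝ} (hk : 0 < k) (t : ℝ) : deriv (lift k) t ≠ 0 := fun h0 => by
  refine (isKnot_proj_unitCircle hk).immersed t ?_
  have h1 : HasDerivAt unitCircle (deriv unitCircle (lift k t)) (lift k t) :=
    (contDiff_unitCircle.differentiable (by simp) _).hasDerivAt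
  have h2 : HasDerivAt (lift k) (deriv (lift k) t) t :=
    ((contDiff_lift_right hk).differentiable (by simp) _).hasDerivAt
  have h3 := h1.scomp t h2
  have h4 : unitCircle ∘ lift k = fun t => proj k (unitCircle t) :=
    funext fun t => unitCircle_lift hk t
  rw [h4, h0, zero_smul] at h3
  exact h3.deriv

theorem isKnot_comp_lift {f : ℝ → E3} (hf : IsKnot f) {k : ℝ} (hk : 0 < k) :
    IsKnot (fun t => f (lift k t)) :=
  hf.comp (contDiff_lift_right hk) (lift_add_one k) (deriv_lift_ne_zero hk) (lift_injective hk)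

/-- This value and the one at 1 locate the image of a semicircle: as k grows the arctangent tends to
π/4, and the image of [0, 1/2] contracts to 1/4. -/
theorem lift_half (k : ℝ) :
    lift k (1 / 2) = 1 / 2 - Real.pi⁻¹ * Real.arctan ((k - 1) / (k + 1)) := by
  unfold lift
  have e : Real.pi * (1 / 2 - 3 / 4) = -(Real.pi / 4) := by ring
  have h2 : Real.sqrt 2 ^ 2 = 2 := Real.sq_sqrt (by norm_num)
  rw [e, Real.sin_neg, Real.cos_neg, Real.sin_pi_div_four, Real.cos_pi_div_four,
    sub_eq_add_neg (1 / 2 : ℝ), ← mul_neg, ← Real.arctan_neg]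
  congr 3
  have h3 : (k - 1) * -(Real.sqrt 2 / 2) * (Real.sqrt 2 / 2) = -(k - 1) / 2 := by
    linear_combination (-(k - 1) / 4) * h2
  have h4 : (Real.sqrt 2 / 2) ^ 2 + k * (-(Real.sqrt 2 / 2)) ^ 2 = (k + 1) / 2 := by
    linear_combination ((k + 1) / 4) * h2
  rw [h3, h4, div_div_div_cancel_right₀ (by norm_num), neg_div]

theorem lift_one_right (k : ℝ) :
    lift k 1 = 1 + Real.pi⁻¹ * Real.arctan ((k - 1) / (k + 1)) := by
  unfold lift
  have e : Real.pi * (1 - 3 / 4) = Real.pi / 4 := by ring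
  have h2 : Real.sqrt 2 ^ 2 = 2 := Real.sq_sqrt (by norm_num)
  rw [e, Real.sin_pi_div_four, Real.cos_pi_div_four]
  congr 3
  have h3 : (k - 1) * (Real.sqrt 2 / 2) * (Real.sqrt 2 / 2) = (k - 1) / 2 := by
    linear_combination ((k - 1) / 4) * h2
  have h4 : (Real.sqrt 2 / 2) ^ 2 + k * (Real.sqrt 2 / 2) ^ 2 = (k + 1) / 2 := by
    linear_combination ((k + 1) / 4) * h2
  rw [h3, h4, div_div_div_cancel_right₀ (by norm_num)]

/-- The first coordinate of `proj k w` compared with that of the image of the plane `x = 0`. -/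
theorem proj_zero_add {k : ℝ} {w : E3} (h : projDen k w ≠ 0) :
    proj k w 0 + (k ^ 2 - 1) / (k ^ 2 + 1) = 4 * k ^ 2 * w 0 / (projDen k w * (k ^ 2 + 1)) := by
  rw [proj_zero]
  have : k ^ 2 + 1 ≠ 0 := by positivity
  field_simp
  unfold projDen
  ring

theorem proj_zero_lt {k : ℝ} (hk : 0 < k) {w : E3} (h : 0 < projDen k w) (hw : w 0 < 0) :
    proj k w 0 < -((k ^ 2 - 1) / (k ^ 2 + 1)) := by
  have e := proj_zero_add h.ne'
  have : 4 * k ^ 2 * w 0 / (projDen k w * (k ^ 2 + 1)) < 0 :=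
    div_neg_of_neg_of_pos (mul_neg_of_pos_of_neg (by positivity) hw) (by positivity)
  linarith

theorem le_proj_zero {k : ℝ} {w : E3} (h : 0 < projDen k w) (hw : 0 ≤ w 0) :
    -((k ^ 2 - 1) / (k ^ 2 + 1)) ≤ proj k w 0 := by
  have e := proj_zero_add h.ne'
  have : 0 ≤ 4 * k ^ 2 * w 0 / (projDen k w * (k ^ 2 + 1)) := by positivity
  linarith

theorem unitCircle_zero_nonneg {t : ℝ} (h : t ∈ Icc (1 / 2 : ℝ) 1) : 0 ≤ unitCircle t 0 := by
  rw [unitCircle_zero, neg_nonneg, ← Real.sin_sub_two_pi]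
  refine Real.sin_nonpos_of_nonpos_of_neg_pi_le ?_ ?_ <;> nlinarith [Real.pi_pos, h.1, h.2]

theorem unitCircle_zero_neg {t : ℝ} (h : t ∈ Ioo (0 : ℝ) (1 / 2)) : unitCircle t 0 < 0 := by
  rw [unitCircle_zero, neg_lt_zero]
  refine Real.sin_pos_of_pos_of_lt_pi ?_ ?_ <;> nlinarith [Real.pi_pos, h.1, h.2]

/-! ### Stability of knots under perturbations that are small in C¹. -/

theorem contDiff_deriv_right {F : Type*} [NormedAddCommGroup F] [NormedSpace ℝ F] {H : ℝ → ℝ → F}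
    (hs : ContDiff ℝ ∞ fun p : ℝ × ℝ => H p.1 p.2) :
    ContDiff ℝ ∞ fun p : ℝ × ℝ => deriv (H p.1) p.2 := by
  have h1 : ContDiff ℝ ∞ fun p : ℝ × ℝ =>
      fderiv ℝ (fun p : ℝ × ℝ => H p.1 p.2) p ((0 : ℝ), (1 : ℝ)) :=
    (hs.fderiv_right (by simp)).clm_apply contDiff_const
  convert h1 using 1
  funext p
  have h2 : HasFDerivAt (fun p : ℝ × ℝ => H p.1 p.2) _ (p.1, p.2) :=
    (hs.differentiable (by simp) p).hasFDerivAt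
  have h3 : HasDerivAt (fun t : ℝ => (p.1, t)) ((0 : ℝ), (1 : ℝ)) p.2 :=
    (hasDerivAt_const _ _).prodMk (hasDerivAt_id _)
  exact (h2.comp_hasDerivAt p.2 h3).deriv

theorem deriv_periodic {F : Type*} [NormedAddCommGroup F] [NormedSpace ℝ F] {f : ℝ → F}
    (h : Function.Periodic f 1) : Function.Periodic (deriv f) 1 := fun t => by
  have : (fun x => f (x + 1)) = f := funext h
  rw [← deriv_comp_add_const, this]

theorem contDiff_deriv {F : Type*} [NormedAddCommGroup F] [NormedSpace ℝ F] {f : ℝ → F}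
    (h : ContDiff ℝ ∞ f) : ContDiff ℝ ∞ (deriv f) :=
  (contDiff_infty_iff_deriv.1 h).2

theorem exists_int_abs_sub_le (t a : ℝ) : ∃ n : ℤ, |t - n - a| ≤ 1 / 2 := by
  refine ⟨round (t - a), ?_⟩
  have := abs_sub_round (t - a)
  rwa [sub_right_comm] at this

/-- A smooth family of knots is uniformly bi-Lipschitz on pairs of nearby parameters. -/
theorem exists_biLipschitz {H : ℝ → ℝ → E3} (hs : ContDiff ℝ ∞ fun p : ℝ × ℝ => H p.1 p.2)
    (hk : ∀ s ∈ Icc (0 : ℝ) 1, IsKnot (H s)) :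
    ∃ m > 0, ∀ s ∈ Icc (0 : ℝ) 1, ∀ t t', |t - t'| ≤ 1 / 2 →
      m * |t - t'| ≤ ‖H s t - H s t'‖ := by
  have hd := contDiff_deriv_right hs
  -- The difference quotient in the increment h, continued to h = 0 by the derivative. It is
  -- continuous, and nonzero for |h| ≤ 1/2 by injectivity modulo 1 and immersion, so its norm has a
  -- positive minimum on a compact set.
  let q : ℝ × ℝ × ℝ → E3 := fun p => ∫ r in (0 : ℝ)..1, deriv (H p.1) (p.2.1 + r * p.2.2)
  have hq : Continuous q := by
    refine intervalIntegral.continuous_parametric_intervalIntegral_of_continuous' ?_ 0 1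
    exact hd.continuous.comp (by fun_prop : Continuous fun x : (ℝ × ℝ × ℝ) × ℝ =>
      (x.1.1, x.1.2.1 + x.2 * x.1.2.2))
  have hqe : ∀ s t h, h • q (s, t, h) = H s (t + h) - H s t := by
    intro s t h
    have hsm := smooth_slice hs s
    have := intervalIntegral.integral_eq_sub_of_hasDerivAt (a := 0) (b := 1)
      (f := fun r => H s (t + r * h)) (f' := fun r => h • deriv (H s) (t + r * h))
      (fun r _ => by
        have h1 : HasDerivAt (H s) (deriv (H s) (t + r * h)) (t + r * h) :=
          (hsm.differentiable (by simp) _).hasDerivAt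
        have h2 : HasDerivAt (fun r : ℝ => t + r * h) h r := by
          simpa using ((hasDerivAt_id r).mul_const h).const_add t
        exact h1.scomp r h2)
      (Continuous.intervalIntegrable (by
        have := hsm.continuous_deriv (by simp)
        fun_prop) _ _)
    rw [intervalIntegral.integral_smul] at this
    simpa using this
  have hne : ∀ s ∈ Icc (0 : ℝ) 1, ∀ t h, |h| ≤ 1 / 2 → q (s, t, h) ≠ 0 := by
    intro s hs t h hh h0
    rcases eq_or_ne h 0 with rfl | hne
    · simp only [q, mul_zero, add_zero, intervalIntegral.integral_const, sub_zero, one_smul] at h0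
      exact (hk s hs).immersed t h0
    · have := hqe s t h
      rw [h0, smul_zero, eq_comm, sub_eq_zero] at this
      obtain ⟨n, hn⟩ := (hk s hs).inj _ _ this
      have hn' : h = n := by linarith
      have h1 : |(n : ℝ)| < 1 := by rw [← hn']; linarith
      have h2 : |n| < 1 := by exact_mod_cast h1
      rw [Int.abs_lt_one_iff] at h2
      rw [h2] at hn'
      exact hne (by simpa using hn')
  have hcomp : IsCompact (Icc (0 : ℝ) 1 ×ˢ (Icc (0 : ℝ) 1 ×ˢ Icc (-(1 / 2) : ℝ) (1 / 2))) :=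
    isCompact_Icc.prod (isCompact_Icc.prod isCompact_Icc)
  obtain ⟨p, hp, hmin⟩ := hcomp.exists_isMinOn
    ⟨(0, 0, 0), by simp⟩ hq.norm.continuousOn
  refine ⟨‖q p‖, norm_pos_iff.2 (hne p.1 hp.1 p.2.1 p.2.2 (abs_le.2 hp.2.2)), ?_⟩
  intro s hs t t' htt
  have hper := (hk s hs).periodic
  have e1 : H s t' = H s (Int.fract t') := (periodic_fract hper t').symm
  have e2 : H s t = H s (Int.fract t' + (t - t')) := by
    rw [show Int.fract t' + (t - t') = t + (-⌊t'⌋ : ℤ) by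
      push_cast; rw [← Int.self_sub_floor]; ring, periodic_add_int hper]
  have := isMinOn_iff.1 hmin (s, Int.fract t', t - t')
    ⟨hs, ⟨Int.fract_nonneg _, (Int.fract_lt_one _).le⟩, abs_le.1 htt⟩
  rw [e1, e2, ← hqe, norm_smul, Real.norm_eq_abs, mul_comm]
  exact mul_le_mul_of_nonneg_left this (abs_nonneg _)

theorem lipschitz_of_deriv {F : Type*} [NormedAddCommGroup F] [NormedSpace ℝ F] {P : ℝ → F}
    (hP : ContDiff ℝ ∞ P) {c : ℝ} (hc : ∀ t, ‖deriv P t‖ ≤ c) (t t' : ℝ) :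
    ‖P t - P t'‖ ≤ c * |t - t'| :=
  convex_univ.norm_image_sub_le_of_norm_deriv_le
    (fun x _ => hP.differentiable (by simp) x) (fun x _ => hc x) (mem_univ t') (mem_univ t)

/-- Knots are stable under perturbations with small derivative. -/
theorem IsKnot.perturb {f P : ℝ → E3} (hf : IsKnot f) {m c : ℝ}
    (hm : ∀ t t', |t - t'| ≤ 1 / 2 → m * |t - t'| ≤ ‖f t - f t'‖) (hP : ContDiff ℝ ∞ P)
    (hp : Function.Periodic P 1) (hc : ∀ t, ‖deriv P t‖ ≤ c) (hcm : c < m) :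
    IsKnot (fun t => f t + P t) where
  smooth := hf.smooth.add hP
  periodic := fun t => by simp only [hf.periodic t, hp t]
  immersed := fun t h0 => by
    have h1 : HasDerivAt f (deriv f t) t := (hf.smooth.differentiable (by simp) _).hasDerivAt
    have h2 : HasDerivAt P (deriv P t) t := (hP.differentiable (by simp) _).hasDerivAt
    have h3 : ‖deriv f t‖ = ‖deriv P t‖ := by
      rw [(h1.fun_add h2).deriv] at h0
      rw [eq_neg_of_add_eq_zero_left h0, norm_neg]
    -- The bi-Lipschitz constant bounds the speed as a limit of chord slopes.
    have h4 : m ≤ ‖deriv f t‖ := by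
      refine ge_of_tendsto (hasDerivAt_iff_tendsto_slope.1 h1).norm ?_
      have : ∀ᶠ x in 𝓝[≠] t, |x - t| ≤ 1 / 2 := by
        refine eventually_nhdsWithin_of_eventually_nhds ?_
        filter_upwards [Metric.ball_mem_nhds t (by norm_num : (0 : ℝ) < 1 / 2)] with x hx
        rw [Metric.mem_ball, Real.dist_eq] at hx
        exact hx.le
      filter_upwards [this, self_mem_nhdsWithin] with x hx hne
      have hpos : 0 < |x - t| := abs_pos.2 (sub_ne_zero.2 hne)
      rw [slope_def_module, norm_smul, norm_inv, Real.norm_eq_abs, inv_mul_eq_div,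
        le_div_iff₀ hpos]
      exact hm x t hx
    linarith [hc t]
  inj := fun t t' e => by
    obtain ⟨n, hn⟩ := exists_int_abs_sub_le t t'
    refine ⟨n, ?_⟩
    have e1 : f (t - n) = f t := by
      have := periodic_add_int hf.periodic t (-n)
      push_cast at this
      rwa [← sub_eq_add_neg] at this
    have e2 : P (t - n) = P t := by
      have := periodic_add_int hp t (-n)
      push_cast at this
      rwa [← sub_eq_add_neg] at this
    have h1 := hm (t - n) t' hn
    have h2 := lipschitz_of_deriv hP hc (t - n) t'
    have h3 : f (t - n) - f t' = -(P (t - n) - P t') := by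
      rw [e1, e2]
      have : f t = f t' + P t' - P t := eq_sub_of_add_eq e
      rw [this]; abel
    rw [h3, norm_neg] at h1
    have h4 : |t - n - t'| = 0 := by
      by_contra hne
      have : 0 < |t - n - t'| := lt_of_le_of_ne (abs_nonneg _) (Ne.symm hne)
      nlinarith
    have := abs_eq_zero.1 h4
    linarith

/-! ### Periodic cutoffs at scale ε, and Taylor bounds in terms of |sin π(t - a)|. -/

/-- A smooth profile equal to `1` on `[-1, 1]` and to `0` beyond `√2`. -/
def profile (r : ℝ) : ℝ := Real.smoothTransition (2 - r ^ 2)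

theorem contDiff_profile : ContDiff ℝ ∞ profile :=
  Real.smoothTransition.contDiff.comp (by fun_prop)

theorem profile_mem (r : ℝ) : profile r ∈ Icc (0 : ℝ) 1 := smoothTransition_mem _

theorem profile_eq_zero {r : ℝ} (h : 2 ≤ r ^ 2) : profile r = 0 :=
  Real.smoothTransition.zero_of_nonpos (by linarith)

theorem profile_eq_one {r : ℝ} (h : r ^ 2 ≤ 1) : profile r = 1 :=
  Real.smoothTransition.one_of_one_le (by linarith)

theorem exists_profile_bound :
    ∃ C > 0, ∀ r, |deriv profile r| ≤ C ∧ |deriv (deriv profile) r| ≤ C := by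
  have hcs : HasCompactSupport profile := by
    refine HasCompactSupport.of_support_subset_isCompact (K := Icc (-2) 2) isCompact_Icc ?_
    intro r hr
    rw [Function.mem_support] at hr
    by_contra hn
    refine hr (profile_eq_zero ?_)
    rw [mem_Icc, not_and_or, not_le, not_le] at hn
    rcases hn with h | h <;> nlinarith
  have h1 := contDiff_deriv contDiff_profile
  have h2 := contDiff_deriv h1
  obtain ⟨C₁, hC₁⟩ := hcs.deriv.exists_bound_of_continuous h1.continuous
  obtain ⟨C₂, hC₂⟩ := hcs.deriv.deriv.exists_bound_of_continuous h2.continuous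
  refine ⟨max 1 (max C₁ C₂), by positivity, fun r => ⟨(hC₁ r).trans ?_, (hC₂ r).trans ?_⟩⟩
  · exact (le_max_left _ _).trans (le_max_right _ _)
  · exact (le_max_right _ _).trans (le_max_right _ _)

/-- A smooth periodic cutoff at the parameter `a`, of width comparable to `ε`. -/
def cutoff (a ε t : ℝ) : ℝ := profile (Real.sin (Real.pi * (t - a)) / ε)

theorem contDiff_cutoff (a ε : ℝ) : ContDiff ℝ ∞ (cutoff a ε) :=
  contDiff_profile.comp (by fun_prop)

theorem cutoff_mem (a ε t : ℝ) : cutoff a ε t ∈ Icc (0 : ℝ) 1 := profile_mem _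

theorem cutoff_periodic (a ε : ℝ) : Function.Periodic (cutoff a ε) 1 := fun t => by
  unfold cutoff profile
  rw [show Real.pi * (t + 1 - a) = Real.pi * (t - a) + Real.pi by ring, Real.sin_add_pi, neg_div,
    neg_sq]

theorem cutoff_eq_zero {a ε t : ℝ} (hε : 0 < ε)
    (h : 2 * ε ^ 2 ≤ Real.sin (Real.pi * (t - a)) ^ 2) : cutoff a ε t = 0 := by
  refine profile_eq_zero ?_
  rw [div_pow, le_div_iff₀ (by positivity)]
  exact h

theorem cutoff_eq_one {a ε t : ℝ} (hε : 0 < ε)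
    (h : Real.sin (Real.pi * (t - a)) ^ 2 ≤ ε ^ 2) : cutoff a ε t = 1 := by
  refine profile_eq_one ?_
  rw [div_pow, div_le_one (by positivity)]
  exact h

theorem cutoff_eventuallyEq_zero {a ε t : ℝ} (hε : 0 < ε)
    (h : 2 * ε ^ 2 < Real.sin (Real.pi * (t - a)) ^ 2) : cutoff a ε =ᶠ[𝓝 t] fun _ => 0 := by
  have : ContinuousAt (fun t => Real.sin (Real.pi * (t - a)) ^ 2) t := by fun_prop
  filter_upwards [this.eventually_const_lt h] with x hx using cutoff_eq_zero hε hx.le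

theorem hasDerivAt_cutoff (a ε t : ℝ) : HasDerivAt (cutoff a ε)
    (deriv profile (Real.sin (Real.pi * (t - a)) / ε) *
      (Real.pi * Real.cos (Real.pi * (t - a)) / ε)) t := by
  have h1 : HasDerivAt (fun t => Real.sin (Real.pi * (t - a)) / ε)
      (Real.cos (Real.pi * (t - a)) * (Real.pi * 1) / ε) t :=
    ((((hasDerivAt_id t).sub_const a).const_mul _).sin).div_const _
  have h2 : HasDerivAt profile _ (Real.sin (Real.pi * (t - a)) / ε) :=
    (contDiff_profile.differentiable (by simp) _).hasDerivAt
  exact (h2.comp t h1).congr_deriv (by ring)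

/-- Each derivative costs a factor 1/ε by the chain rule; restricting to ε ≤ 1 absorbs the lower
order term of the second derivative. -/
theorem exists_cutoff_bound : ∃ C > 0, ∀ a t : ℝ, ∀ ε ∈ Ioc (0 : ℝ) 1,
    |deriv (cutoff a ε) t| ≤ C / ε ∧ |deriv (deriv (cutoff a ε)) t| ≤ C / ε ^ 2 := by
  obtain ⟨C, hC, hb⟩ := exists_profile_bound
  have hpi := Real.pi_pos
  refine ⟨C * Real.pi + 2 * C * Real.pi ^ 2, by positivity, fun a t ε hε => ?_⟩
  obtain ⟨hε, hε1⟩ := hε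
  have hcos := Real.abs_cos_le_one (Real.pi * (t - a))
  have hsin := Real.abs_sin_le_one (Real.pi * (t - a))
  constructor
  · rw [(hasDerivAt_cutoff a ε t).deriv, abs_mul, abs_div, abs_mul, abs_of_pos hpi, abs_of_pos hε,
      ← mul_div_assoc]
    refine div_le_div_of_nonneg_right ?_ hε.le
    have : |deriv profile (Real.sin (Real.pi * (t - a)) / ε)| *
        (Real.pi * |Real.cos (Real.pi * (t - a))|) ≤ C * (Real.pi * 1) := by
      gcongr
      exact (hb _).1
    have h2 : 0 ≤ 2 * C * Real.pi ^ 2 := by positivity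
    linarith
  · have e : deriv (cutoff a ε) = fun t => deriv profile (Real.sin (Real.pi * (t - a)) / ε) *
      (Real.pi * Real.cos (Real.pi * (t - a)) / ε) := funext fun t =>
        (hasDerivAt_cutoff a ε t).deriv
    have h1 : HasDerivAt (fun t => Real.sin (Real.pi * (t - a)) / ε)
        (Real.cos (Real.pi * (t - a)) * (Real.pi * 1) / ε) t :=
      ((((hasDerivAt_id t).sub_const a).const_mul _).sin).div_const _
    have h2 : HasDerivAt (deriv profile) _ (Real.sin (Real.pi * (t - a)) / ε) :=
      ((contDiff_deriv contDiff_profile).differentiable (by simp) _).hasDerivAt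
    have h3 : HasDerivAt (fun t => Real.pi * Real.cos (Real.pi * (t - a)) / ε)
        (Real.pi * (-Real.sin (Real.pi * (t - a)) * (Real.pi * 1)) / ε) t :=
      (((((hasDerivAt_id t).sub_const a).const_mul _).cos).const_mul _).div_const _
    have h4 := (h2.comp t h1).mul h3
    rw [e]
    have h5 := h4.deriv
    simp only [Function.comp_def, Pi.mul_def] at h5
    rw [h5]
    set p := deriv profile (Real.sin (Real.pi * (t - a)) / ε)
    set p' := deriv (deriv profile) (Real.sin (Real.pi * (t - a)) / ε)
    set c := Real.cos (Real.pi * (t - a))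
    set σ := Real.sin (Real.pi * (t - a))
    have hp : |p| ≤ C := (hb _).1
    have hp' : |p'| ≤ C := (hb _).2
    have e2 : p' * (c * (Real.pi * 1) / ε) * (Real.pi * c / ε) + p * (Real.pi * (-σ * (Real.pi * 1)) / ε)
        = (p' * c ^ 2 * Real.pi ^ 2 - p * σ * Real.pi ^ 2 * ε) / ε ^ 2 := by
      field_simp
      ring
    rw [e2, abs_div, abs_of_pos (by positivity : 0 < ε ^ 2)]
    refine div_le_div_of_nonneg_right ((abs_sub _ _).trans ?_) (by positivity)
    have b1 : |p' * c ^ 2 * Real.pi ^ 2| ≤ C * 1 ^ 2 * Real.pi ^ 2 := by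
      rw [abs_mul, abs_mul, abs_pow, abs_of_pos (by positivity : 0 < Real.pi ^ 2)]
      gcongr
    have b2 : |p * σ * Real.pi ^ 2 * ε| ≤ C * 1 * Real.pi ^ 2 * 1 := by
      rw [abs_mul, abs_mul, abs_mul, abs_of_pos (by positivity : 0 < Real.pi ^ 2), abs_of_pos hε]
      gcongr
    have : 0 ≤ C * Real.pi := by positivity
    linarith

/-- The mean value inequality: each integration from a zero at `a` gains one power of |t - a|. -/
theorem norm_le_pow_of_deriv {F : Type*} [NormedAddCommGroup F] [NormedSpace ℝ F] {f : ℝ → F}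
    (hf : ContDiff ℝ ∞ f) {a C : ℝ} (hC : 0 ≤ C) {n : ℕ} (h0 : f a = 0)
    (h : ∀ t, |t - a| ≤ 1 / 2 → ‖deriv f t‖ ≤ C * |t - a| ^ n) :
    ∀ t, |t - a| ≤ 1 / 2 → ‖f t‖ ≤ C * |t - a| ^ (n + 1) := by
  intro t ht
  have hsub : ∀ x ∈ uIcc a t, |x - a| ≤ |t - a| := fun x hx => abs_sub_left_of_mem_uIcc hx
  have := (convex_uIcc a t).norm_image_sub_le_of_norm_deriv_le (f := f)
    (C := C * |t - a| ^ n) (fun x _ => hf.differentiable (by simp) x)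
    (fun x hx => (h x ((hsub x hx).trans ht)).trans (by
      have := hsub x hx
      gcongr)) left_mem_uIcc right_mem_uIcc
  rw [h0, sub_zero, Real.norm_eq_abs] at this
  rwa [pow_succ, ← mul_assoc]

theorem two_mul_abs_le_abs_sin {x : ℝ} (h : |x| ≤ 1 / 2) : 2 * |x| ≤ |Real.sin (Real.pi * x)| := by
  have hpi := Real.pi_pos
  have h1 : |Real.pi * x| ≤ Real.pi / 2 := by
    rw [abs_mul, abs_of_pos hpi]; nlinarith
  have := Real.mul_abs_le_abs_sin h1
  rw [abs_mul, abs_of_pos hpi] at this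
  calc 2 * |x| = 2 / Real.pi * (Real.pi * |x|) := by field_simp
    _ ≤ _ := this

theorem abs_sin_pi_sub_int (x : ℝ) (n : ℤ) :
    |Real.sin (Real.pi * (x - n))| = |Real.sin (Real.pi * x)| := by
  rw [mul_sub, mul_comm Real.pi (n : ℝ), Real.sin_sub_int_mul_pi, abs_mul, abs_zpow]
  simp

/-- A periodic family vanishing to second order at `a` is quadratically small near `a`. -/
theorem exists_second_order_bound {D : ℝ → ℝ → E3}
    (hs : ContDiff ℝ ∞ fun p : ℝ × ℝ => D p.1 p.2) {a : ℝ}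
    (hp : ∀ s ∈ Icc (0 : ℝ) 1, Function.Periodic (D s) 1) (h0 : ∀ s ∈ Icc (0 : ℝ) 1, D s a = 0)
    (h1 : ∀ s ∈ Icc (0 : ℝ) 1, deriv (D s) a = 0) :
    ∃ C > 0, ∀ s ∈ Icc (0 : ℝ) 1, ∀ t, ‖D s t‖ ≤ C * |Real.sin (Real.pi * (t - a))| ^ 2 ∧
      ‖deriv (D s) t‖ ≤ C * |Real.sin (Real.pi * (t - a))| := by
  have hd := contDiff_deriv_right hs
  have hdd := contDiff_deriv_right (H := fun s t => deriv (D s) t) hd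
  obtain ⟨C, hC⟩ := (isCompact_Icc.prod isCompact_Icc :
    IsCompact (Icc (0 : ℝ) 1 ×ˢ Icc (a - 1 / 2) (a + 1 / 2))).exists_bound_of_continuousOn
      hdd.continuous.continuousOn
  have hC0 : 0 ≤ max C 1 := by positivity
  refine ⟨max C 1, by positivity, fun s hs' t => ?_⟩
  have sm := smooth_slice hs s
  have k2 : ∀ t, |t - a| ≤ 1 / 2 → ‖deriv (deriv (D s)) t‖ ≤ max C 1 * |t - a| ^ 0 := by
    intro t ht
    rw [abs_le] at ht
    rw [pow_zero, mul_one]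
    exact (hC (s, t) ⟨hs', by constructor <;> linarith⟩).trans (le_max_left _ _)
  have k1 := norm_le_pow_of_deriv (contDiff_deriv sm) hC0 (h1 s hs') k2
  have k0 := norm_le_pow_of_deriv sm hC0 (h0 s hs') k1
  obtain ⟨n, hn⟩ := exists_int_abs_sub_le t a
  have e0 : D s t = D s (t - n) := by
    have := periodic_add_int (hp s hs') t (-n)
    push_cast at this
    rw [← this, ← sub_eq_add_neg]
  have e1 : deriv (D s) t = deriv (D s) (t - n) := by
    have := periodic_add_int (deriv_periodic (hp s hs')) t (-n)
    push_cast at this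
    rw [← this, ← sub_eq_add_neg]
  have e2 : |Real.sin (Real.pi * (t - a))| = |Real.sin (Real.pi * (t - n - a))| := by
    rw [← abs_sin_pi_sub_int (t - a) n, sub_right_comm]
  have hle : |t - n - a| ≤ |Real.sin (Real.pi * (t - n - a))| := by
    linarith [two_mul_abs_le_abs_sin hn, abs_nonneg (t - n - a)]
  rw [e0, e1, e2]
  constructor
  · refine (k0 _ hn).trans ?_
    gcongr
  · refine (k1 _ hn).trans ?_
    rw [zero_add, pow_one]
    gcongr

/-- Cutting off a family that vanishes to second order gives a family small in `C¹`. -/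
theorem exists_cutoff_small {D : ℝ → ℝ → E3}
    (hs : ContDiff ℝ ∞ fun p : ℝ × ℝ => D p.1 p.2) {a : ℝ}
    (hp : ∀ s ∈ Icc (0 : ℝ) 1, Function.Periodic (D s) 1) (h0 : ∀ s ∈ Icc (0 : ℝ) 1, D s a = 0)
    (h1 : ∀ s ∈ Icc (0 : ℝ) 1, deriv (D s) a = 0) {m : ℝ} (hm : 0 < m) :
    ∃ ε₀ > 0, ∀ ε ∈ Ioo 0 ε₀, ∀ s ∈ Icc (0 : ℝ) 1, ∀ t,
      ‖deriv (fun t => cutoff a ε t • D s t) t‖ ≤ m := by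
  obtain ⟨C, hC, hb⟩ := exists_second_order_bound hs hp h0 h1
  obtain ⟨B, hB, hc⟩ := exists_cutoff_bound
  refine ⟨min 1 (m / (2 * B * C + 2 * C)), by positivity, fun ε hε s hs' t => ?_⟩
  have hε0 : 0 < ε := hε.1
  have hε1 : ε ≤ 1 := (hε.2.trans_le (min_le_left _ _)).le
  have hεm : ε * (2 * B * C + 2 * C) ≤ m := by
    rw [← le_div_iff₀ (by positivity)]
    exact (hε.2.trans_le (min_le_right _ _)).le
  have sm := smooth_slice hs s
  rcases lt_or_ge (2 * ε ^ 2) (Real.sin (Real.pi * (t - a)) ^ 2) with h | h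
  · have : (fun t => cutoff a ε t • D s t) =ᶠ[𝓝 t] fun _ => 0 := by
      filter_upwards [cutoff_eventuallyEq_zero hε0 h] with x hx
      rw [hx, zero_smul]
    rw [this.deriv_eq]
    simp [hm.le]
  · have d1 : HasDerivAt (cutoff a ε) (deriv (cutoff a ε) t) t :=
      ((contDiff_cutoff a ε).differentiable (by simp) t).hasDerivAt
    have d2 : HasDerivAt (D s) (deriv (D s) t) t :=
      (sm.differentiable (by simp) t).hasDerivAt
    rw [(d1.fun_smul d2).deriv]
    have hσ : |Real.sin (Real.pi * (t - a))| ^ 2 ≤ 2 * ε ^ 2 := by rwa [sq_abs]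
    have hσ' : |Real.sin (Real.pi * (t - a))| ≤ 2 * ε := by
      refine abs_le_of_sq_le_sq' ?_ (by positivity) |>.2
      nlinarith
    obtain ⟨b0, b1⟩ := hb s hs' t
    have b2 := (hc a t ε ⟨hε0, hε1⟩).1
    have b3 : |cutoff a ε t| ≤ 1 := by
      rw [abs_of_nonneg (cutoff_mem a ε t).1]
      exact (cutoff_mem a ε t).2
    refine (norm_add_le _ _).trans ?_
    rw [norm_smul, norm_smul, Real.norm_eq_abs, Real.norm_eq_abs]
    have c1 : |cutoff a ε t| * ‖deriv (D s) t‖ ≤ 1 * (C * (2 * ε)) := by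
      refine mul_le_mul b3 (b1.trans ?_) (norm_nonneg _) zero_le_one
      gcongr
    -- On the support of the cutoff |sin π(t - a)| is O(ε), so D is O(ε²) and D' is O(ε). The factor
    -- 1/ε from the derivative of the cutoff still leaves O(ε).
    have c2 : |deriv (cutoff a ε) t| * ‖D s t‖ ≤ B / ε * (C * (2 * ε ^ 2)) := by
      refine mul_le_mul b2 (b0.trans ?_) (norm_nonneg _) (by positivity)
      gcongr
    have c3 : B / ε * (C * (2 * ε ^ 2)) = ε * (2 * B * C) := by
      field_simp
    linarith

/-! ### The two halves of a connected sum, and shrinking the left one. -/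

/-- A knot in `x < 0` except for the right half of the unit circle. -/
structure LeftHalf (c : ℝ → E3) : Prop where
  isKnot : IsKnot c
  neg : ∀ t ∈ Ioo (0 : ℝ) (1 / 2), c t 0 < 0
  circ : ∀ t ∈ Icc (1 / 2 : ℝ) 1, c t = unitCircle t

/-- A knot in `x > 0` except for the left half of the unit circle. -/
structure RightHalf (c : ℝ → E3) : Prop where
  isKnot : IsKnot c
  pos : ∀ t ∈ Ioo (1 / 2 : ℝ) 1, 0 < c t 0
  circ : ∀ t ∈ Icc (0 : ℝ) (1 / 2), c t = unitCircle t

theorem IsKnot.injOn {f : ℝ → E3} (hf : IsKnot f) {a b : ℝ} (h : b - a < 1) :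
    InjOn f (Icc a b) := fun t ht t' ht' e => by
  obtain ⟨n, hn⟩ := hf.inj t t' e
  have h1 : (n : ℝ) < 1 := by linarith [ht.2, ht'.1]
  have h2 : (-1 : ℝ) < n := by linarith [ht.1, ht'.2]
  have h3 : n < 1 := by exact_mod_cast h1
  have h4 : -1 < n := by exact_mod_cast h2
  obtain rfl : n = 0 := by omega
  simpa using hn

theorem isKnot_glue_of_isKnot {A B : ℝ → E3} (hA : IsKnot A) (hB : IsKnot B)
    (hs : ContDiff ℝ ∞ (glue A B))
    (hAB : ∀ t ∈ Ioo (0 : ℝ) (1 / 2), ∀ t' ∈ Icc (1 / 2 : ℝ) 1, A t ≠ B t') : IsKnot (glue A B) :=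
  isKnot_glue hA.smooth hB.smooth hA.periodic hB.periodic hs (fun t _ => hA.immersed t)
    (fun t _ => hB.immersed t) (hA.injOn (by norm_num)) (hB.injOn (by norm_num)) hAB

theorem LeftHalf.le_one {c : ℝ → E3} (h : LeftHalf c) (t : ℝ) : c t 0 ≤ 1 := by
  rw [← periodic_fract h.isKnot.periodic t]
  have hle : ∀ t ∈ Icc (0 : ℝ) (1 / 2), c t 0 ≤ 0 := by
    have hc : IsClosed {t | c t 0 ≤ 0} :=
      isClosed_le (contDiff_coord h.isKnot.smooth 0).continuous continuous_const
    have : closure (Ioo (0 : ℝ) (1 / 2)) ⊆ {t | c t 0 ≤ 0} :=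
      hc.closure_subset_iff.2 fun t ht => (h.neg t ht).le
    rwa [closure_Ioo (by norm_num)] at this
  rcases le_total (Int.fract t) (1 / 2) with h1 | h1
  · linarith [hle _ ⟨Int.fract_nonneg t, h1⟩]
  · rw [h.circ _ ⟨h1, (Int.fract_lt_one t).le⟩]
    exact (unitCircle_zero_mem _).2

theorem RightHalf.eq_or_nonneg {c : ℝ → E3} (h : RightHalf c) (t : ℝ) :
    c t = unitCircle t ∨ 0 ≤ c t 0 := by
  rw [← periodic_fract h.isKnot.periodic t, ← periodic_fract unitCircle_periodic t]
  rcases le_or_gt (Int.fract t) (1 / 2) with h1 | h1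
  · exact Or.inl (h.circ _ ⟨Int.fract_nonneg t, h1⟩)
  · exact Or.inr (h.pos _ ⟨h1, Int.fract_lt_one t⟩).le

/-- The bound on the right tends to 0 as k grows: the left semicircle is traversed by `lift k` in an
arbitrarily short interval around 1/4. -/
theorem lift_mem {k : ℝ} (hk : 1 ≤ k) {t : ℝ} (ht : t ∈ Icc (0 : ℝ) (1 / 2)) :
    |lift k t - 1 / 4| ≤ 1 / 4 - Real.pi⁻¹ * Real.arctan ((k - 1) / (k + 1)) := by
  have hk0 : 0 < k := by linarith
  have h1 := (lift_strictMono hk0).monotone ht.1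
  have h2 := (lift_strictMono hk0).monotone ht.2
  have h3 := lift_one_right k
  rw [← zero_add (1 : ℝ), lift_add_one] at h3
  rw [lift_half] at h2
  rw [abs_le]
  constructor <;> linarith

theorem arctan_nonneg_of_one_le {k : ℝ} (hk : 1 ≤ k) : 0 ≤ Real.arctan ((k - 1) / (k + 1)) :=
  Real.arctan_nonneg.2 (div_nonneg (by linarith) (by linarith))

theorem lift_mem_Icc {k : ℝ} (hk : 1 ≤ k) {t : ℝ} (ht : t ∈ Icc (0 : ℝ) (1 / 2)) :
    lift k t ∈ Icc (0 : ℝ) (1 / 2) := by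
  have h := abs_le.1 (lift_mem hk ht)
  have : 0 ≤ Real.pi⁻¹ * Real.arctan ((k - 1) / (k + 1)) :=
    mul_nonneg (inv_nonneg.2 Real.pi_pos.le) (arctan_nonneg_of_one_le hk)
  constructor <;> linarith [h.1, h.2]

theorem LeftHalf.projDen_pos {c : ℝ → E3} (h : LeftHalf c) {k : ℝ} (hk : 1 ≤ k) (t : ℝ) :
    0 < projDen k (c t) := projDen_pos_of_le hk (h.le_one t)

/-- The points of the shrunk left part of a sum are separated from the circle. -/
theorem LeftHalf.proj_ne {c : ℝ → E3} (h : LeftHalf c) {k : ℝ} (hk : 1 ≤ k) {t t' : ℝ}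
    (ht : t ∈ Ioo (0 : ℝ) (1 / 2)) (ht' : t' ∈ Icc (1 / 2 : ℝ) 1) :
    proj k (c t) ≠ unitCircle (lift k t') := fun e => by
  have hk0 : 0 < k := by linarith
  have h1 := proj_zero_lt hk0 (h.projDen_pos hk t) (h.neg t ht)
  have h2 := le_proj_zero (projDen_pos_of_mem hk0 (unitCircle_zero_mem t'))
    (unitCircle_zero_nonneg ht')
  rw [unitCircle_lift hk0] at e
  rw [e] at h1
  linarith

theorem isKnot_glue_halves {c₁ c₂ : ℝ → E3} (h₁ : LeftHalf c₁) (h₂ : RightHalf c₂) :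
    IsKnot (glue c₁ c₂) := by
  have hs := contDiff_glue h₁.isKnot.smooth h₂.isKnot.smooth contDiff_unitCircle h₁.isKnot.periodic
    h₂.isKnot.periodic unitCircle_periodic h₁.circ h₂.circ
  refine isKnot_glue_of_isKnot h₁.isKnot h₂.isKnot hs fun t ht t' ht' e => ?_
  rcases h₂.eq_or_nonneg t' with h | h
  · have := h₁.proj_ne le_rfl ht ht'
    rw [proj_one_eq, lift_one, ← h] at this
    exact this e
  · have := h₁.neg t ht
    rw [e] at this
    linarith

/-- The left part of a connected sum can be shrunk to a small knotted arc. -/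
theorem iso_shrink {c₁ c₂ : ℝ → E3} (h₁ : LeftHalf c₁) (h₂ : RightHalf c₂) {K : ℝ} (hK : 1 ≤ K) :
    Iso (glue c₁ c₂) (glue (fun t => proj K (c₁ t)) (fun t => c₂ (lift K t))) := by
  -- The square keeps the factor at least 1 for every real s, not only on [0, 1]; the smooth family
  -- needs this because the left half may extend far into x < 0, where the denominator for k < 1
  -- could vanish.
  let k : ℝ → ℝ := fun s => 1 + s ^ 2 * (K - 1)
  have hk : ∀ s, 1 ≤ k s := fun s => by
    have : 0 ≤ s ^ 2 * (K - 1) := mul_nonneg (sq_nonneg s) (by linarith)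
    simp only [k]; linarith
  have hk0 : ∀ s, 0 < k s := fun s => by linarith [hk s]
  have hks : ContDiff ℝ ∞ fun p : ℝ × ℝ => k p.1 := by simp only [k]; fun_prop
  have hA : ContDiff ℝ ∞ fun p : ℝ × ℝ => proj (k p.1) (c₁ p.2) :=
    contDiff_proj (h₁.isKnot.smooth.comp contDiff_snd) hks fun p =>
      (h₁.projDen_pos (hk p.1) p.2).ne'
  have hB : ContDiff ℝ ∞ fun p : ℝ × ℝ => c₂ (lift (k p.1) p.2) :=
    h₂.isKnot.smooth.comp (contDiff_lift hks contDiff_snd fun p => hk0 p.1)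
  have hC : ContDiff ℝ ∞ fun p : ℝ × ℝ => proj (k p.1) (unitCircle p.2) :=
    contDiff_proj (contDiff_unitCircle.comp contDiff_snd) hks fun p =>
      (projDen_pos_of_mem (hk0 p.1) (unitCircle_zero_mem p.2)).ne'
  have kA : ∀ s, IsKnot fun t => proj (k s) (c₁ t) := fun s =>
    isKnot_proj h₁.isKnot (hk0 s) fun t => (h₁.projDen_pos (hk s) t).ne'
  have kB : ∀ s, IsKnot fun t => c₂ (lift (k s) t) := fun s => isKnot_comp_lift h₂.isKnot (hk0 s)
  have hG := contDiff_glue_family (A := fun s t => proj (k s) (c₁ t))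
    (B := fun s t => c₂ (lift (k s) t)) (C := fun s t => proj (k s) (unitCircle t)) hA hB hC
    (fun s => (kA s).periodic) (fun s => (kB s).periodic)
    (fun s => (isKnot_proj_unitCircle (hk0 s)).periodic)
    (fun s t ht => by simp only [h₁.circ t ht])
    (fun s t ht => by
      simp only [h₂.circ _ (lift_mem_Icc (hk s) ht), unitCircle_lift (hk0 s)])
  refine Iso.of_Icc' (fun s => glue (fun t => proj (k s) (c₁ t)) (fun t => c₂ (lift (k s) t)))
    hG (fun s _ => isKnot_glue_of_isKnot (kA s) (kB s)
      (smooth_slice (H := fun s => glue (fun t => proj (k s) (c₁ t)) (fun t => c₂ (lift (k s) t)))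
        hG s) fun t ht t' ht' e => ?_) (fun t => ?_) (fun t => ?_)
  -- The shrunken left arc lies strictly to the left of the plane x = -(k² - 1)/(k² + 1), which
  -- bounds the circular arc on the other side. The remaining points of the right half have x ≥ 0.
  · rcases h₂.eq_or_nonneg (lift (k s) t') with h | h
    · rw [h] at e
      exact h₁.proj_ne (hk s) ht ht' e
    · have h1 := proj_zero_lt (hk0 s) (h₁.projDen_pos (hk s) t) (h₁.neg t ht)
      have h2 : 0 ≤ (k s ^ 2 - 1) / (k s ^ 2 + 1) :=
        div_nonneg (by nlinarith [hk s]) (by positivity)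
      rw [e] at h1
      linarith
  · simp [k, glue, proj_one_eq, lift_one]
  · simp [k, glue]

/-! ### Isotopies that are constant near the joint; invariance in the right summand. -/

/-- The reflection that reverses `a`. -/
def reflectAlong (a : E3) : E3 →L[ℝ] E3 :=
  ContinuousLinearMap.id ℝ E3 - (2 / inner ℝ a a : ℝ) • (innerSL ℝ a).smulRight a

theorem reflectAlong_apply (a w : E3) :
    reflectAlong a w = w - (2 / inner ℝ a a * inner ℝ a w : ℝ) • a := by
  simp [reflectAlong, smul_smul]

theorem reflectAlong_reflectAlong {a : E3} (ha : a ≠ 0) (w : E3) :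
    reflectAlong a (reflectAlong a w) = w := by
  have h : (inner ℝ a a : ℝ) ≠ 0 := inner_self_ne_zero.2 ha
  rw [reflectAlong_apply, reflectAlong_apply, inner_sub_right, inner_smul_right]
  have : 2 / (inner ℝ a a : ℝ) * (inner ℝ a w - 2 / inner ℝ a a * inner ℝ a w * inner ℝ a a) =
      -(2 / inner ℝ a a * inner ℝ a w) := by
    field_simp
    ring
  rw [this, neg_smul, sub_neg_eq_add, sub_add_cancel]

/-- The mirror is the perpendicular bisector plane of two vectors of equal length. -/
theorem reflectAlong_sub {v w : E3} (h : ‖v‖ = ‖w‖) (hne : v ≠ w) :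
    reflectAlong (v - w) v = w := by
  have h0 : (inner ℝ (v - w) (v - w) : ℝ) ≠ 0 := inner_self_ne_zero.2 (sub_ne_zero.2 hne)
  have h1 : (inner ℝ (v - w) (v - w) : ℝ) = 2 * inner ℝ (v - w) v := by
    have e1 : (inner ℝ v v : ℝ) = inner ℝ w w := by
      rw [real_inner_self_eq_norm_sq, real_inner_self_eq_norm_sq, h]
    rw [inner_sub_right, inner_sub_left, inner_sub_left, ← e1, real_inner_comm w v]
    ring
  rw [reflectAlong_apply]
  have : 2 / (inner ℝ (v - w) (v - w) : ℝ) * inner ℝ (v - w) v = 1 := by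
    field_simp
    linarith
  rw [this, one_smul, sub_sub_cancel]

/-- A smooth curve in the unit sphere of `E3` misses a point. -/
theorem exists_unit_ne {u : ℝ → E3} (hu : ContDiff ℝ ∞ u) :
    ∃ N : E3, ‖N‖ = 1 ∧ ∀ s, ‖u s‖⁻¹ • u s ≠ N := by
  -- The cone over the curve is the C¹ image of a plane in three-space, so its complement is dense.
  -- A point off the cone gives, after normalisation, a direction that is never attained.
  have h1 : ContDiff ℝ 1 fun p : ℝ × ℝ => p.1 • u p.2 :=
    (contDiff_fst.smul (hu.comp contDiff_snd)).of_le (by exact_mod_cast le_top)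
  have hd := h1.dense_compl_range_of_finrank_lt_finrank (by simp)
  obtain ⟨N, hN⟩ := hd.nonempty
  have hN0 : N ≠ 0 := fun h => hN ⟨(0, 0), by simp [h]⟩
  refine ⟨‖N‖⁻¹ • N, norm_smul_inv_norm hN0, fun s e => hN ⟨(‖N‖ * ‖u s‖⁻¹, s), ?_⟩⟩
  simp only
  rw [mul_smul, e, smul_smul, mul_inv_cancel₀ (norm_ne_zero_iff.2 hN0), one_smul]

/-- An isotopy between knots with the same velocity at `a` can be modified so that the point and
the velocity at `a` stay constant. -/
theorem exists_iso_fixed_jet {c d U : ℝ → E3} (hiso : Iso c d) {a : ℝ} (hc : c a = U a)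
    (hd : d a = U a) (hc' : deriv c a = deriv U a) (hd' : deriv d a = deriv U a) :
    ∃ G : ℝ → ℝ → E3, ContDiff ℝ ∞ (fun p : ℝ × ℝ => G p.1 p.2) ∧ (∀ s, IsKnot (G s)) ∧
      G 0 = c ∧ G 1 = d ∧ (∀ s, G s a = U a) ∧ ∀ s, deriv (G s) a = deriv U a := by
  obtain ⟨H, hs, hk, h0, h1⟩ := hiso
  let u : ℝ → E3 := fun s => deriv (H s) a
  have hu : ContDiff ℝ ∞ u := (contDiff_deriv_right hs).comp (contDiff_id.prodMk contDiff_const)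
  have hu0 : ∀ s, u s ≠ 0 := fun s => (hk s).immersed a
  have hu0' : ∀ s, ‖u s‖ ≠ 0 := fun s => norm_ne_zero_iff.2 (hu0 s)
  obtain ⟨N, hN, hNu⟩ := exists_unit_ne hu
  let v : ℝ → E3 := fun s => ‖u s‖⁻¹ • u s
  have hv1 : ∀ s, ‖v s‖ = 1 := fun s => norm_smul_inv_norm (hu0 s)
  have hnorm : ContDiff ℝ ∞ fun s => ‖u s‖ := hu.norm ℝ hu0
  have hv : ContDiff ℝ ∞ v := (hnorm.inv hu0').smul hu
  have hvN : ∀ s, v s - N ≠ 0 := fun s => sub_ne_zero.2 (hNu s)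
  -- A similarity carrying the velocity `u s` to `u 0`, made of reflections taking `v s` to `N` and
  -- then `N` to `v 0`. As `v` misses `N`, both reflections are defined and smooth in s. When `u s =
  -- u 0` they cancel and the scale is 1, so both ends of the isotopy stay unchanged.
  let g : ℝ → E3 →L[ℝ] E3 := fun s =>
    (‖u 0‖ * ‖u s‖⁻¹) • (reflectAlong (v 0 - N)).comp (reflectAlong (v s - N))
  have hr : ∀ s, ‖u 0‖ * ‖u s‖⁻¹ ≠ 0 := fun s => mul_ne_zero (hu0' 0) (inv_ne_zero (hu0' s))
  have hg : ∀ s, Function.Injective (g s) := fun s x y e => by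
    simp only [g, smul_apply, ContinuousLinearMap.comp_apply] at e
    have e1 := smul_right_injective E3 (hr s) e
    have e2 := congrArg (reflectAlong (v 0 - N)) e1
    rw [reflectAlong_reflectAlong (hvN 0), reflectAlong_reflectAlong (hvN 0)] at e2
    have e3 := congrArg (reflectAlong (v s - N)) e2
    rwa [reflectAlong_reflectAlong (hvN s), reflectAlong_reflectAlong (hvN s)] at e3
  have hgu : ∀ s, g s (u s) = u 0 := fun s => by
    have e1 : u s = ‖u s‖ • v s := by
      simp only [v]
      rw [smul_smul, mul_inv_cancel₀ (hu0' s), one_smul]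
    have e2 : reflectAlong (v 0 - N) N = v 0 := by
      have := reflectAlong_sub ((hv1 0).trans hN.symm) (hNu 0)
      have h2 := reflectAlong_reflectAlong (hvN 0) (v 0)
      rwa [this] at h2
    simp only [g, smul_apply, ContinuousLinearMap.comp_apply]
    rw [e1, map_smul, map_smul, ← e1, reflectAlong_sub ((hv1 s).trans hN.symm) (hNu s), e2,
      smul_smul, mul_assoc, inv_mul_cancel₀ (hu0' s), mul_one]
    simp only [v]
    rw [smul_smul, mul_inv_cancel₀ (hu0' 0), one_smul]
  have hgid : ∀ s, u s = u 0 → ∀ w, g s w = w := fun s e w => by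
    simp only [g, v, e, smul_apply, ContinuousLinearMap.comp_apply]
    rw [reflectAlong_reflectAlong (hvN 0), mul_inv_cancel₀ (hu0' 0), one_smul]
  have hgs : ∀ {E : Type} [NormedAddCommGroup E] [NormedSpace ℝ E] {q : E → E3} {σ : E → ℝ},
      ContDiff ℝ ∞ q → ContDiff ℝ ∞ σ → ContDiff ℝ ∞ fun p => g (σ p) (q p) := by
    intro E _ _ q σ hq hσ
    simp only [g, smul_apply, ContinuousLinearMap.comp_apply]
    refine ContDiff.smul (contDiff_const.mul ((hnorm.comp hσ).inv fun p => hu0' _))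
      ((reflectAlong _).contDiff.comp ?_)
    simp only [reflectAlong_apply]
    have hvσ : ContDiff ℝ ∞ fun p => v (σ p) - N := (hv.comp hσ).sub contDiff_const
    exact hq.sub (ContDiff.smul ((contDiff_const.div (hvσ.inner ℝ hvσ) fun p =>
      inner_self_ne_zero.2 (hvN _)).mul (hvσ.inner ℝ hq)) hvσ)
  have e0 : u 0 = deriv U a := by simp only [u, h0, hc']
  have e1 : u 1 = u 0 := by simp only [u, h0, h1, hc', hd']
  refine ⟨fun s t => g s (H s t) + (U a - g s (H s a)), ?_, fun s => (hk s).linear_comp (hg s) _,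
    ?_, ?_, fun s => by simp, fun s => ?_⟩
  · refine (hgs hs contDiff_fst).add (contDiff_const.sub (hgs ?_ contDiff_fst))
    exact hs.comp (contDiff_fst.prodMk contDiff_const)
  · funext t
    simp only [hgid 0 rfl, h0, hc]
    simp
  · funext t
    simp only [hgid 1 e1, h1, hd]
    simp
  · have d1 : HasDerivAt (H s) (u s) a :=
      ((smooth_slice hs s).differentiable (by simp) a).hasDerivAt
    have d2 : HasDerivAt (fun t => g s (H s t) + (U a - g s (H s a))) (g s (u s)) a :=
      ((g s).hasFDerivAt.comp_hasDerivAt a d1).add_const _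
    rw [d2.deriv, hgu, e0]

theorem sin_two_pi_eq (t : ℝ) :
    Real.sin (2 * Real.pi * t) = 1 - 2 * Real.sin (Real.pi * (t - 1 / 4)) ^ 2 := by
  have h1 := Real.cos_sq' (Real.pi * (t - 1 / 4))
  have h2 := Real.cos_two_mul (Real.pi * (t - 1 / 4))
  rw [show 2 * (Real.pi * (t - 1 / 4)) = 2 * Real.pi * t - Real.pi / 2 by ring,
    Real.cos_sub_pi_div_two] at h2
  rw [h2, h1]; ring

theorem RightHalf.deriv_quarter {c : ℝ → E3} (h : RightHalf c) :
    deriv c (1 / 4) = deriv unitCircle (1 / 4) := by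
  refine Filter.EventuallyEq.deriv_eq ?_
  filter_upwards [Ioo_mem_nhds (show (0 : ℝ) < 1 / 4 by norm_num)
    (show (1 / 4 : ℝ) < 1 / 2 by norm_num)] with x hx using h.circ x ⟨hx.1.le, hx.2.le⟩

/-- Isotopic right halves are joined by an isotopy that is constant near the left end of the
circle. -/
theorem exists_iso_fixed_near {c d : ℝ → E3} (hc : RightHalf c) (hd : RightHalf d)
    (hiso : Iso c d) :
    ∃ G : ℝ → ℝ → E3, ContDiff ℝ ∞ (fun p : ℝ × ℝ => G p.1 p.2) ∧ (∀ s, Function.Periodic (G s) 1) ∧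
      (∀ s ∈ Icc (0 : ℝ) 1, IsKnot (G s)) ∧ G 0 = c ∧ G 1 = d ∧
      ∃ ε > 0, ∀ s t, Real.sin (Real.pi * (t - 1 / 4)) ^ 2 ≤ ε ^ 2 → G s t = unitCircle t := by
  obtain ⟨G, hG, hk, h0, h1, ha, ha'⟩ := exists_iso_fixed_jet (U := unitCircle) (a := 1 / 4) hiso
    (hc.circ _ (by norm_num)) (hd.circ _ (by norm_num)) hc.deriv_quarter hd.deriv_quarter
  obtain ⟨m, hm, hbl⟩ := exists_biLipschitz hG fun s _ => hk s
  -- The value and the velocity of this difference vanish at 1/4 for every s, so adding a narrowly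
  -- cut-off copy of it makes the family equal to the circle near 1/4 by a change too small in C¹ to
  -- destroy the knots.
  let D : ℝ → ℝ → E3 := fun s t => unitCircle t - G s t
  have hD : ContDiff ℝ ∞ fun p : ℝ × ℝ => D p.1 p.2 :=
    (contDiff_unitCircle.comp contDiff_snd).sub hG
  have hDp : ∀ s, Function.Periodic (D s) 1 := fun s t => by
    simp only [D, unitCircle_periodic t, (hk s).periodic t]
  obtain ⟨ε₀, hε₀, hsmall⟩ := exists_cutoff_small hD (a := 1 / 4) (fun s _ => hDp s)
    (fun s _ => by simp only [D, ha, sub_self]) (fun s _ => by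
      have d1 := contDiff_unitCircle.differentiable (by simp) (1 / 4)
      have d2 := (hk s).smooth.differentiable (by simp) (1 / 4)
      have := (d1.hasDerivAt.fun_sub d2.hasDerivAt).deriv
      rw [ha', sub_self] at this
      exact this) (half_pos hm)
  let ε := min (ε₀ / 2) (1 / 2)
  have hε : 0 < ε := by positivity
  have hε' : ε < ε₀ := (min_le_left _ _).trans_lt (by linarith)
  have hεh : ε ≤ 1 / 2 := min_le_right _ _
  -- As ε ≤ 1/2, the support of the cutoff is within the half period where a right half already is
  -- the unit circle, so the correction leaves the two ends of the isotopy alone.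
  have hend : ∀ s, RightHalf (G s) → ∀ t, cutoff (1 / 4) ε t • D s t = 0 := by
    intro s hs t
    rcases lt_or_ge (Real.sin (Real.pi * (t - 1 / 4)) ^ 2) (2 * ε ^ 2) with h | h
    · have h2 : 0 ≤ Real.sin (2 * Real.pi * t) := by
        rw [sin_two_pi_eq]; nlinarith
      have h3 : D s t = 0 := by
        rw [← periodic_fract (hDp s)]
        simp only [D]
        rw [hs.circ _ (fract_mem_of_sin_nonneg h2), sub_self]
      rw [h3, smul_zero]
    · rw [cutoff_eq_zero hε h, zero_smul]
  refine ⟨fun s t => G s t + cutoff (1 / 4) ε t • D s t, ?_, fun s t => ?_, fun s hs => ?_, ?_, ?_,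
    ε, hε, fun s t h => ?_⟩
  · exact hG.add (((contDiff_cutoff _ _).comp contDiff_snd).smul hD)
  · simp only [(hk s).periodic t, hDp s t, cutoff_periodic (1 / 4) ε t]
  · refine (hk s).perturb (hbl s hs)
      ((contDiff_cutoff _ _).smul (contDiff_unitCircle.sub (hk s).smooth)) (fun t => ?_)
      (fun t => hsmall ε ⟨hε, hε'⟩ s hs t) (by linarith)
    simp only [hDp s t, cutoff_periodic (1 / 4) ε t]
  · funext t
    simp only [hend 0 (h0 ▸ hc) t, h0, add_zero]
  · funext t
    simp only [hend 1 (h1 ▸ hd) t, h1, add_zero]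
  · simp only [cutoff_eq_one hε h, D, one_smul, add_sub_cancel]

theorem norm_le_of_coord {v : E3} {r : ℝ} (h : ∀ i, |v i| ≤ r) : ‖v‖ ≤ 2 * r := by
  have hr : 0 ≤ r := (abs_nonneg _).trans (h 0)
  rw [EuclideanSpace.norm_eq]
  refine Real.sqrt_le_iff.2 ⟨by positivity, ?_⟩
  rw [Fin.sum_univ_three]
  have : ∀ i, ‖v i‖ ^ 2 ≤ r ^ 2 := fun i => pow_le_pow_left₀ (norm_nonneg _) (h i) 2
  nlinarith [this 0, this 1, this 2]

theorem IsKnot.bounded {f : ℝ → E3} (hf : IsKnot f) : ∃ R > 0, ∀ t, ‖f t‖ ≤ R := by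
  obtain ⟨R, hR⟩ := (isCompact_Icc (a := (0 : ℝ)) (b := 1)).exists_bound_of_continuousOn
    hf.smooth.continuous.continuousOn
  refine ⟨max R 1, by positivity, fun t => ?_⟩
  rw [← periodic_fract hf.periodic]
  exact (hR _ ⟨Int.fract_nonneg t, (Int.fract_lt_one t).le⟩).trans (le_max_left _ _)

theorem unitCircle_quarter : unitCircle (1 / 4) = !₂[-1, 0, 0] := by
  have : 2 * Real.pi * (1 / 4) = Real.pi / 2 := by ring
  refine E3_ext ?_ ?_ ?_
  · rw [unitCircle_zero, this]; simp
  · rw [unitCircle_one, this]; simp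
  · rw [unitCircle_two]; simp

/-- `proj k` contracts bounded parts of the half-space `x ≤ 0` to the point `(-1, 0, 0)`. -/
theorem norm_proj_sub_le {w : E3} {R k : ℝ} (hw : ‖w‖ ≤ R) (h0 : w 0 ≤ 0) (hk : 1 ≤ k) :
    ‖proj k w - unitCircle (1 / 4)‖ ≤ 4 * (R + 1) / k := by
  have hR : 0 ≤ R := (norm_nonneg _).trans hw
  have hk0 : 0 < k := by linarith
  have hc : ∀ i, |w i| ≤ R := fun i => (PiLp.norm_apply_le w i).trans hw
  have hden : k * k ≤ projDen k w := by
    unfold projDen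
    nlinarith [mul_nonneg (show 0 ≤ k ^ 2 - 1 by nlinarith) (neg_nonneg.2 h0)]
  have hkk : 0 < k * k := by positivity
  have hpos : 0 < projDen k w := hkk.trans_le hden
  have hbound : ∀ y : ℝ, |y| ≤ 2 * k * (R + 1) → |y / projDen k w| ≤ 2 * (R + 1) / k := by
    intro y hy
    rw [abs_div, abs_of_pos hpos]
    calc |y| / projDen k w ≤ 2 * k * (R + 1) / (k * k) := by gcongr
      _ = _ := by field_simp
  have hk2 : ∀ i, |2 * k * w i| ≤ 2 * k * (R + 1) := fun i => by
    rw [abs_mul, abs_of_pos (by positivity : 0 < 2 * k)]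
    have := hc i
    gcongr
    linarith
  have : ∀ i, |(proj k w - unitCircle (1 / 4)) i| ≤ 2 * (R + 1) / k := by
    have h0 : |(proj k w - unitCircle (1 / 4)) 0| ≤ 2 * (R + 1) / k := by
      have e : (proj k w - unitCircle (1 / 4)) 0 = 2 * (w 0 + 1) / projDen k w := by
        rw [PiLp.sub_apply, proj_zero, unitCircle_quarter]
        simp only [Matrix.cons_val_zero]
        field_simp
        unfold projDen
        ring
      rw [e]
      refine hbound _ ?_
      rw [abs_mul, abs_of_pos (by norm_num : (0 : ℝ) < 2)]
      have h3 : |w 0 + 1| ≤ R + 1 := (abs_add_le _ _).trans (by simpa using hc 0)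
      nlinarith [abs_nonneg (w 0 + 1)]
    have h1 : |(proj k w - unitCircle (1 / 4)) 1| ≤ 2 * (R + 1) / k := by
      have e : (proj k w - unitCircle (1 / 4)) 1 = 2 * k * w 1 / projDen k w := by
        rw [PiLp.sub_apply, proj_one, unitCircle_quarter]
        simp
      rw [e]
      exact hbound _ (hk2 1)
    have h2 : |(proj k w - unitCircle (1 / 4)) 2| ≤ 2 * (R + 1) / k := by
      have e : (proj k w - unitCircle (1 / 4)) 2 = 2 * k * w 2 / projDen k w := by
        rw [PiLp.sub_apply, proj_two, unitCircle_quarter]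
        simp
      rw [e]
      exact hbound _ (hk2 2)
    intro i
    fin_cases i
    exacts [h0, h1, h2]
  refine (norm_le_of_coord this).trans (le_of_eq ?_)
  ring

theorem tendsto_arctan_ratio :
    Tendsto (fun k : ℝ => Real.arctan ((k - 1) / (k + 1))) atTop (𝓝 (Real.pi / 4)) := by
  rw [← Real.arctan_one]
  refine (Real.continuous_arctan.tendsto 1).comp ?_
  have h : Tendsto (fun k : ℝ => 1 - 2 / (k + 1)) atTop (𝓝 (1 - 0)) :=
    tendsto_const_nhds.sub (Tendsto.div_atTop tendsto_const_nhds
      (tendsto_atTop_add_const_right _ _ tendsto_id))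
  rw [sub_zero] at h
  refine h.congr' ?_
  filter_upwards [eventually_gt_atTop 0] with k hk
  field_simp
  ring

/-- One factor k has to achieve two things at once: a short parameter interval for the shrunken
semicircle and a small image of a bounded set. -/
theorem exists_large {ε r C : ℝ} (hε : 0 < ε) (hr : 0 < r) :
    ∃ k : ℝ, 1 ≤ k ∧ Real.pi / 4 - Real.arctan ((k - 1) / (k + 1)) ≤ ε ∧ C / k < r := by
  have h1 : ∀ᶠ k : ℝ in atTop, Real.pi / 4 - ε < Real.arctan ((k - 1) / (k + 1)) :=
    tendsto_arctan_ratio.eventually_const_lt (by linarith)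
  have h2 : ∀ᶠ k : ℝ in atTop, C / k < r :=
    (tendsto_const_nhds.div_atTop tendsto_id).eventually_lt_const hr
  obtain ⟨k, hk, h1, h2⟩ := ((eventually_ge_atTop 1).and (h1.and h2)).exists
  exact ⟨k, hk, by linarith, h2⟩

/-- The connected sum does not depend on the choice of the right half within its isotopy class. -/
theorem iso_glue_right {c₁ c₂ d₂ : ℝ → E3} (h₁ : LeftHalf c₁) (h₂ : RightHalf c₂)
    (h₂' : RightHalf d₂) (hiso : Iso c₂ d₂) : Iso (glue c₁ c₂) (glue c₁ d₂) := by
  obtain ⟨G, hG, hp, hk, h0, h1, ε, hε, hnear⟩ := exists_iso_fixed_near h₂ h₂' hiso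
  obtain ⟨m, hm, hbl⟩ := exists_biLipschitz hG hk
  obtain ⟨R, hR, hbound⟩ := h₁.isKnot.bounded
  have hpi := Real.pi_pos
  -- The first requirement puts the shrunken left semicircle where the isotopy is constant. The
  -- second makes the left arc closer to (-1, 0, 0) than the moving curve can come at parameters
  -- outside that region: there |u - 1/4| ≥ ε/π modulo 1, and `m` is the bi-Lipschitz constant.
  obtain ⟨k, hk1, harc, hsmall⟩ := exists_large (ε := ε) (C := 4 * (R + 1))
    (r := m * (ε / Real.pi)) hε (by positivity)
  have hk0 : 0 < k := by linarith
  refine ((iso_shrink h₁ h₂ hk1).trans ?_).trans (iso_shrink h₁ h₂' hk1).symm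
  have hsin : ∀ x : ℝ, |Real.sin (Real.pi * x)| ≤ Real.pi * |x| := fun x => by
    have := Real.abs_sin_le_abs (x := Real.pi * x)
    rwa [abs_mul Real.pi, abs_of_pos hpi] at this
  have hcirc : ∀ s, ∀ t ∈ Icc (0 : ℝ) (1 / 2), G s (lift k t) = unitCircle (lift k t) := by
    intro s t ht
    refine hnear s _ ?_
    rw [← sq_abs]
    refine pow_le_pow_left₀ (abs_nonneg _) ((hsin _).trans ?_) 2
    have h2 := lift_mem hk1 ht
    have e : Real.pi * (1 / 4 - Real.pi⁻¹ * Real.arctan ((k - 1) / (k + 1))) =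
        Real.pi / 4 - Real.arctan ((k - 1) / (k + 1)) := by field_simp
    have h3 := mul_le_mul_of_nonneg_left h2 hpi.le
    linarith
  have hA : IsKnot fun t => proj k (c₁ t) :=
    isKnot_proj h₁.isKnot hk0 fun t => (h₁.projDen_pos hk1 t).ne'
  have hC := isKnot_proj_unitCircle hk0
  have hBs : ContDiff ℝ ∞ fun p : ℝ × ℝ => G p.1 (lift k p.2) :=
    hG.comp (contDiff_fst.prodMk ((contDiff_lift_right hk0).comp contDiff_snd))
  have hgl := contDiff_glue_family (A := fun _ t => proj k (c₁ t)) (B := fun s t => G s (lift k t))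
    (C := fun _ t => proj k (unitCircle t)) (hA.smooth.comp contDiff_snd) hBs
    (hC.smooth.comp contDiff_snd) (fun _ => hA.periodic)
    (fun s t => by simp only [lift_add_one, hp s (lift k t)]) (fun _ => hC.periodic)
    (fun s t ht => by simp only [h₁.circ t ht])
    (fun s t ht => by simp only [hcirc s t ht, unitCircle_lift hk0])
  refine Iso.of_Icc' (fun s => glue (fun t => proj k (c₁ t)) (fun t => G s (lift k t))) hgl
    (fun s hs => isKnot_glue_of_isKnot hA (isKnot_comp_lift (hk s hs) hk0)
      (smooth_slice (H := fun s => glue (fun t => proj k (c₁ t)) (fun t => G s (lift k t))) hgl s)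
      fun t ht t' ht' e => ?_) (fun t => by simp only [h0]) (fun t => by simp only [h1])
  set u := lift k t' with hu
  -- Near the joint the curve is the fixed circle, already separated from the left arc; farther away
  -- the bi-Lipschitz bound keeps it at a distance greater than the size of that arc.
  rcases le_or_gt (Real.sin (Real.pi * (u - 1 / 4)) ^ 2) (ε ^ 2) with h | h
  · rw [hnear s u h] at e
    exact h₁.proj_ne hk1 ht ht' e
  · obtain ⟨n, hn⟩ := exists_int_abs_sub_le u (1 / 4)
    have e1 : G s (u - n) = G s u := by
      have := periodic_add_int (hp s) u (-n)
      push_cast at this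
      rwa [← sub_eq_add_neg] at this
    have h3 := hbl s hs (u - n) (1 / 4) hn
    rw [e1, ← e, hnear s (1 / 4) (by simp; positivity)] at h3
    have h4 := norm_proj_sub_le (hbound t) (h₁.neg t ht).le hk1
    have h5 : ε ≤ Real.pi * |u - n - 1 / 4| := by
      rw [← sq_abs (Real.sin _)] at h
      have := lt_of_pow_lt_pow_left₀ 2 (abs_nonneg _) h
      rw [← abs_sin_pi_sub_int (u - 1 / 4) n, sub_right_comm] at this
      exact this.le.trans (hsin _)
    have h6 : m * (ε / Real.pi) ≤ m * |u - n - 1 / 4| := by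
      gcongr
      rwa [div_le_iff₀ hpi, mul_comm]
    linarith

/-! ### Exchanging the summands; well-definedness of the connected sum. -/

/-- The rotation by `π` about the third axis. -/
def halfTurn : Matrix (Fin 3) (Fin 3) ℝ := Matrix.diagonal ![-1, -1, 1]

theorem halfTurn_apply (w : E3) :
    act halfTurn w 0 = -w 0 ∧ act halfTurn w 1 = -w 1 ∧ act halfTurn w 2 = w 2 := by
  simp [act_apply, halfTurn]

theorem det_halfTurn : halfTurn.det = 1 := by
  rw [halfTurn, Matrix.det_diagonal, Fin.prod_univ_three]
  simp

/-- The half turn of a curve, with its parameter shifted by half a period. -/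
def swap (c : ℝ → E3) (t : ℝ) : E3 := act halfTurn (c (t + 1 / 2))

theorem swap_zero (c : ℝ → E3) (t : ℝ) : swap c t 0 = -c (t + 1 / 2) 0 := (halfTurn_apply _).1

theorem iso_swap {c : ℝ → E3} (h : IsKnot c) : Iso c (swap c) := by
  have := Iso.affine (h.shift (1 / 2)) (M := halfTurn) (by rw [det_halfTurn]; norm_num) 0
  simp only [add_zero] at this
  exact (Iso.shift h (1 / 2)).trans this

theorem swap_unitCircle : swap unitCircle = unitCircle := by
  funext t
  have h := halfTurn_apply (unitCircle (t + 1 / 2))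
  have e : 2 * Real.pi * (t + 1 / 2) = 2 * Real.pi * t + Real.pi := by ring
  refine E3_ext ?_ ?_ ?_
  · rw [swap, h.1, unitCircle_zero, unitCircle_zero, e, Real.sin_add_pi, neg_neg]
  · rw [swap, h.2.1, unitCircle_one, unitCircle_one, e, Real.cos_add_pi, neg_neg]
  · rw [swap, h.2.2, unitCircle_two, unitCircle_two]

theorem swap_eq_unitCircle {c : ℝ → E3} {t : ℝ} (h : c (t + 1 / 2) = unitCircle (t + 1 / 2)) :
    swap c t = unitCircle t := by
  rw [swap, h]
  exact congrFun swap_unitCircle t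

theorem LeftHalf.swap {c : ℝ → E3} (h : LeftHalf c) : RightHalf (swap c) where
  isKnot := (iso_swap h.isKnot).right
  pos := fun t ht => by
    rw [swap_zero, ← h.isKnot.periodic.sub_eq]
    have := h.neg (t + 1 / 2 - 1) ⟨by linarith [ht.1], by linarith [ht.2]⟩
    linarith
  circ := fun t ht => swap_eq_unitCircle (h.circ _ ⟨by linarith [ht.1], by linarith [ht.2]⟩)

theorem RightHalf.swap {c : ℝ → E3} (h : RightHalf c) : LeftHalf (swap c) where
  isKnot := (iso_swap h.isKnot).right
  neg := fun t ht => by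
    rw [swap_zero]
    have := h.pos (t + 1 / 2) ⟨by linarith [ht.1], by linarith [ht.2]⟩
    linarith
  circ := fun t ht => by
    refine swap_eq_unitCircle ?_
    rw [← h.isKnot.periodic.sub_eq, ← unitCircle_periodic.sub_eq]
    exact h.circ _ ⟨by linarith [ht.1], by linarith [ht.2]⟩

/-- The half turn exchanges left and right halves, so invariance in the right summand yields
invariance in the left one. -/
theorem swap_glue {c₁ c₂ : ℝ → E3} (h₁ : LeftHalf c₁) (h₂ : RightHalf c₂) :
    swap (glue c₁ c₂) = glue (swap c₂) (swap c₁) := by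
  have hk := isKnot_glue_halves h₁ h₂
  refine eq_glue (iso_swap hk).right.periodic h₂.swap.isKnot.periodic h₁.swap.isKnot.periodic
    (fun t ht => ?_) (fun t ht => ?_)
  · unfold swap
    rw [glue_right hk.smooth.continuous h₂.isKnot.smooth.continuous
      ⟨by linarith [ht.1], by linarith [ht.2]⟩]
  · unfold swap
    rw [← hk.periodic.sub_eq, ← h₁.isKnot.periodic.sub_eq,
      glue_left ⟨by linarith [ht.1], by linarith [ht.2]⟩]

/-- The isotopy class of a connected sum depends only on those of the summands. -/
theorem iso_glue {c₁ c₂ d₁ d₂ : ℝ → E3} (h₁ : LeftHalf c₁) (h₂ : RightHalf c₂)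
    (h₁' : LeftHalf d₁) (h₂' : RightHalf d₂) (i₁ : Iso c₁ d₁) (i₂ : Iso c₂ d₂) :
    Iso (glue c₁ c₂) (glue d₁ d₂) := by
  refine (iso_glue_right h₁ h₂ h₂' i₂).trans ?_
  have h := iso_glue_right h₂'.swap h₁.swap h₁'.swap
    (((iso_swap h₁.isKnot).symm.trans i₁).trans (iso_swap h₁'.isKnot))
  rw [← swap_glue h₁ h₂', ← swap_glue h₁' h₂'] at h
  exact ((iso_swap (isKnot_glue_halves h₁ h₂')).trans h).trans
    (iso_swap (isKnot_glue_halves h₁' h₂')).symm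

/-! ### Polar angle, and counting maxima by a monotone angle. -/

/-- A smooth nowhere vanishing planar vector field along the line has a polar angle. -/
theorem exists_angle {a b : ℝ → ℝ} (ha : ContDiff ℝ ∞ a) (hb : ContDiff ℝ ∞ b)
    (h : ∀ t, 0 < a t ^ 2 + b t ^ 2) :
    ∃ θ A : ℝ → ℝ, (∀ t, HasDerivAt θ
      ((a t * deriv b t - deriv a t * b t) / (a t ^ 2 + b t ^ 2)) t) ∧
      (∀ t, θ t - θ 0 = ∫ r in (0 : ℝ)..t,
        (a r * deriv b r - deriv a r * b r) / (a r ^ 2 + b r ^ 2)) ∧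
      (∀ t, 0 < A t) ∧ (∀ t, a t = A t * Real.cos (θ t)) ∧ ∀ t, b t = A t * Real.sin (θ t) := by
  have ha' := contDiff_deriv ha
  have hb' := contDiff_deriv hb
  set w : ℝ → ℝ := fun t => (a t * deriv b t - deriv a t * b t) / (a t ^ 2 + b t ^ 2) with hw
  have hwc : Continuous w :=
    (((ha.mul hb').sub (ha'.mul hb)).div ((ha.pow 2).add (hb.pow 2)) fun t => (h t).ne').continuous
  let z : ℂ := ⟨a 0, b 0⟩
  let θ : ℝ → ℝ := fun t => Complex.arg z + ∫ r in (0 : ℝ)..t, w r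
  have hθ : ∀ t, HasDerivAt θ (w t) t := fun t =>
    (intervalIntegral.integral_hasDerivAt_right (hwc.intervalIntegrable _ _)
      (hwc.stronglyMeasurableAtFilter _ _) hwc.continuousAt).const_add _
  have hθ0 : θ 0 = Complex.arg z := by simp [θ]
  have da : ∀ t, HasDerivAt a (deriv a t) t := fun t => (ha.differentiable (by simp) t).hasDerivAt
  have db : ∀ t, HasDerivAt b (deriv b t) t := fun t => (hb.differentiable (by simp) t).hasDerivAt
  let B : ℝ → ℝ := fun t => -(a t * Real.sin (θ t)) + b t * Real.cos (θ t)
  let A : ℝ → ℝ := fun t => a t * Real.cos (θ t) + b t * Real.sin (θ t)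
  have hAB : ∀ t, A t ^ 2 + B t ^ 2 = a t ^ 2 + b t ^ 2 := fun t => by
    simp only [A, B]
    linear_combination (a t ^ 2 + b t ^ 2) * Real.sin_sq_add_cos_sq (θ t)
  have hB0 : B 0 = 0 := by
    have h1 := Complex.norm_mul_cos_arg z
    have h2 := Complex.norm_mul_sin_arg z
    simp only [B, hθ0]
    change _ = a 0 at h1
    change _ = b 0 at h2
    rw [← h1, ← h2]; ring
  have hA0 : 0 < A 0 := by
    have h1 := Complex.norm_mul_cos_arg z
    have h2 := Complex.norm_mul_sin_arg z
    change _ = a 0 at h1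
    change _ = b 0 at h2
    have hz : z ≠ 0 := fun hz => by
      have h3 : a 0 = 0 := congrArg Complex.re hz
      have h4 : b 0 = 0 := congrArg Complex.im hz
      have := h 0
      rw [h3, h4] at this
      norm_num at this
    have : A 0 = ‖z‖ := by
      simp only [A, hθ0]
      rw [← h1, ← h2]
      linear_combination ‖z‖ * Real.sin_sq_add_cos_sq (Complex.arg z)
    rw [this]
    exact norm_pos_iff.2 hz
  have hBz : ∀ t, B t = 0 := by
    -- `B` is the component of the field orthogonal to the direction θ. Its ratio to the length is
    -- the sine of the angle between the two, which is constant because θ was defined by integrating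
    -- the angular velocity, and is 0 at time 0.
    have hd : ∀ t, HasDerivAt (fun t => B t ^ 2 / (a t ^ 2 + b t ^ 2)) 0 t := by
      intro t
      have d1 : HasDerivAt B (-(deriv a t * Real.sin (θ t) + a t * (Real.cos (θ t) * w t)) +
          (deriv b t * Real.cos (θ t) + b t * (-Real.sin (θ t) * w t))) t :=
        (((da t).mul (hθ t).sin).neg).add ((db t).mul (hθ t).cos)
      have d2 := (d1.fun_pow 2).fun_div (((da t).fun_pow 2).fun_add ((db t).fun_pow 2)) (h t).ne'
      refine d2.congr_deriv ?_
      have hne := (h t).ne'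
      simp only [hw, B]
      field_simp
      ring
    have hc := is_const_of_deriv_eq_zero (fun t => (hd t).differentiableAt) fun t => (hd t).deriv
    intro t
    have h1 := hc t 0
    simp only [hB0] at h1
    rw [zero_pow two_ne_zero, zero_div, div_eq_zero_iff] at h1
    exact pow_eq_zero_iff two_ne_zero |>.1 (h1.resolve_right (h t).ne')
  have hAne : ∀ t, A t ≠ 0 := fun t h0 => by
    have := hAB t
    rw [h0, hBz t] at this
    have := h t
    norm_num at *
    linarith
  have hAc : Continuous A := by
    have : Continuous θ := continuous_iff_continuousAt.2 fun t => (hθ t).continuousAt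
    have := ha.continuous
    have := hb.continuous
    fun_prop
  have hApos : ∀ t, 0 < A t := fun t => by
    by_contra hn
    obtain ⟨x, hx⟩ := mem_range_of_exists_le_of_exists_ge hAc ⟨t, not_lt.1 hn⟩ ⟨0, hA0.le⟩
    exact hAne x hx
  refine ⟨θ, A, hθ, fun t => by simp [θ], hApos, fun t => ?_, fun t => ?_⟩
  · have h1 := hBz t
    simp only [A, B] at h1 ⊢
    linear_combination (-a t) * Real.sin_sq_add_cos_sq (θ t) - Real.sin (θ t) * h1
  · have h1 := hBz t
    simp only [A, B] at h1 ⊢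
    linear_combination (-b t) * Real.sin_sq_add_cos_sq (θ t) + Real.cos (θ t) * h1

/-- Centring at π/2 + 2πk makes the sign of the cosine on either side that of a sine of an angle
less than π in absolute value. -/
theorem cos_eq_neg_sin_sub (k : ℤ) (x : ℝ) :
    Real.cos x = -Real.sin (x - (Real.pi / 2 + 2 * Real.pi * k)) := by
  rw [← Real.cos_add_pi_div_two,
    show x - (Real.pi / 2 + 2 * Real.pi * k) + Real.pi / 2 = x - k * (2 * Real.pi) by ring,
    Real.cos_sub_int_mul_two_pi]

theorem const_of_cos_eq_zero {ψ h A : ℝ → ℝ}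
    (hd : ∀ t, HasDerivAt h (A t * Real.cos (ψ t)) t) {a b : ℝ} (hab : ∀ x ∈ Icc a b, Real.cos (ψ x) = 0) :
    ∀ x ∈ Icc a b, h x = h a := by
  intro x hx
  have := (convex_Icc a b).norm_image_sub_le_of_norm_hasDerivWithin_le (f := h) (C := 0)
    (fun y _ => (hd y).hasDerivWithinAt) (fun y hy => by rw [hab y hy]; simp)
    (left_mem_Icc.2 (hx.1.trans hx.2)) hx
  rw [zero_mul] at this
  exact sub_eq_zero.1 (norm_le_zero_iff.1 this)

/-- The function rises until ψ reaches a value π/2 + 2πk, is constant as long as ψ stays there, and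
falls afterwards. Zeros of the cosine at -π/2 modulo 2π are minima. The condition on earlier times
selects the beginning of a flat piece, so it counts once. -/
theorem maximumBeginsAt_iff {ψ h A : ℝ → ℝ} (hψc : Continuous ψ) (hψm : Monotone ψ)
    (hA : ∀ t, 0 < A t) (hd : ∀ t, HasDerivAt h (A t * Real.cos (ψ t)) t)
    (hunb : ∀ c, ∃ t, c < ψ t) (a : ℝ) : MaximumBeginsAt h a ↔
    ∃ k : ℤ, ψ a = Real.pi / 2 + 2 * Real.pi * k ∧ ∀ t < a, ψ t < ψ a := by
  have hpi := Real.pi_pos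
  have hhc : Continuous h := continuous_iff_continuousAt.2 fun t => (hd t).continuousAt
  have hder : ∀ t, deriv h t = A t * Real.cos (ψ t) := fun t => (hd t).deriv
  constructor
  · rintro ⟨b, hab, hconst, hl, hr⟩
    have hmax : IsLocalMax h a := by
      have hr' : ∀ᶠ t in 𝓝[≥] a, h t ≤ h a := by
        rcases hab.eq_or_lt with rfl | hab
        · rw [← nhdsGT_sup_nhdsWithin_singleton, eventually_sup]
          refine ⟨hr.mono fun t ht => ht.le, ?_⟩
          filter_upwards [self_mem_nhdsWithin] with x hx
          rw [mem_singleton_iff.1 hx]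
        · filter_upwards [Icc_mem_nhdsGE hab] with t ht using (hconst t ht).le
      change ∀ᶠ t in 𝓝 a, h t ≤ h a
      rw [← nhdsLT_sup_nhdsGE, eventually_sup]
      exact ⟨hl.mono fun t ht => ht.le, hr'⟩
    have hc0 : Real.cos (ψ a) = 0 :=
      (mul_eq_zero.1 (hmax.hasDerivAt_eq_zero (hd a))).resolve_left (hA a).ne'
    have hleft : ∀ t < a, ψ t < ψ a := by
      intro t ht
      refine (hψm ht.le).lt_of_ne fun e => ?_
      have hc : ∀ x ∈ Icc t a, h x = h t := const_of_cos_eq_zero hd fun x hx => by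
        have h1 := hψm hx.1
        have h2 := hψm hx.2
        rw [show ψ x = ψ a by linarith]
        exact hc0
      obtain ⟨x, hx, hx'⟩ := (hl.and (Ioo_mem_nhdsLT ht)).exists
      rw [hc x ⟨hx'.1.le, hx'.2.le⟩, hc a ⟨ht.le, le_rfl⟩] at hx
      exact lt_irrefl _ hx
    obtain ⟨m, hm⟩ := Real.cos_eq_zero_iff.1 hc0
    rcases Int.even_or_odd' m with ⟨k, rfl | rfl⟩
    · refine ⟨k, ?_, hleft⟩
      rw [hm]; push_cast; ring
    -- Here ψ a is 3π/2 modulo 2π, and the function does not increase just before `a`.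
    · exfalso
      have hev : ∀ᶠ t in 𝓝[<] a, ψ a - Real.pi < ψ t :=
        (hψc.continuousAt.eventually_const_lt (by linarith)).filter_mono nhdsWithin_le_nhds
      obtain ⟨x, ⟨hx, hx'⟩, hxa⟩ := ((hl.and hev).and self_mem_nhdsWithin).exists
      have hanti : AntitoneOn h (Icc x a) := by
        refine antitoneOn_of_deriv_nonpos (convex_Icc _ _) hhc.continuousOn
          (fun y _ => (hd y).differentiableAt.differentiableWithinAt) fun y hy => ?_
        rw [interior_Icc] at hy
        rw [hder]
        refine mul_nonpos_of_nonneg_of_nonpos (hA y).le ?_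
        rw [cos_eq_neg_sin_sub (k + 1), neg_nonpos]
        have h1 := hψm hy.1.le
        have h2 := hψm hy.2.le
        push_cast at hm ⊢
        rw [← Real.sin_add_two_pi]
        refine Real.sin_nonneg_of_nonneg_of_le_pi ?_ ?_ <;> linarith
      have := hanti (left_mem_Icc.2 (le_of_lt hxa)) (right_mem_Icc.2 (le_of_lt hxa)) (le_of_lt hxa)
      linarith
  · rintro ⟨k, hk, hleft⟩
    -- The flat piece ends at the last time at which ψ has the value ψ a; it exists because ψ
    -- exceeds every bound.
    let S := {t | ψ t ≤ ψ a}
    obtain ⟨T, hT⟩ := hunb (ψ a)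
    have hbdd : BddAbove S := ⟨T, fun t (ht : ψ t ≤ ψ a) => le_of_not_gt fun hlt => by
      linarith [hψm hlt.le]⟩
    have hclosed : IsClosed S := isClosed_le hψc continuous_const
    have haS : a ∈ S := le_refl (ψ a)
    have hbS : sSup S ∈ S := hclosed.csSup_mem ⟨a, haS⟩ hbdd
    set b := sSup S with hb
    have hab : a ≤ b := le_csSup hbdd haS
    have hgt : ∀ t, b < t → ψ a < ψ t := fun t ht => by
      by_contra hn
      exact absurd (le_csSup hbdd (show t ∈ S from not_lt.1 hn)) (not_le.2 ht)
    have hψb : ψ b = ψ a := le_antisymm hbS (hψm hab)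
    have hconst : ∀ x ∈ Icc a b, h x = h a := const_of_cos_eq_zero hd fun x hx => by
      have h1 := hψm hx.1
      have h2 := hψm hx.2
      rw [show ψ x = ψ a by linarith, cos_eq_neg_sin_sub k, hk, sub_self, Real.sin_zero, neg_zero]
    refine ⟨b, hab, hconst, ?_, ?_⟩
    · have hev : ∀ᶠ t in 𝓝[<] a, ψ a - Real.pi < ψ t :=
        (hψc.continuousAt.eventually_const_lt (by linarith)).filter_mono nhdsWithin_le_nhds
      filter_upwards [hev, self_mem_nhdsWithin] with x hx hxa
      have hmono : StrictMonoOn h (Icc x a) := by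
        refine strictMonoOn_of_deriv_pos (convex_Icc _ _) hhc.continuousOn fun y hy => ?_
        rw [interior_Icc] at hy
        rw [hder]
        refine mul_pos (hA y) ?_
        rw [cos_eq_neg_sin_sub k, neg_pos]
        have h1 := hψm hy.1.le
        have h2 := hleft y hy.2
        refine Real.sin_neg_of_neg_of_neg_pi_lt ?_ ?_ <;> linarith
      exact hmono (left_mem_Icc.2 (le_of_lt hxa)) (right_mem_Icc.2 (le_of_lt hxa)) hxa
    · have hev : ∀ᶠ t in 𝓝[>] b, ψ t < ψ a + Real.pi :=
        (hψc.continuousAt.eventually_lt_const (by linarith)).filter_mono nhdsWithin_le_nhds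
      filter_upwards [hev, self_mem_nhdsWithin] with x hx hxb
      have hanti : StrictAntiOn h (Icc b x) := by
        refine strictAntiOn_of_deriv_neg (convex_Icc _ _) hhc.continuousOn fun y hy => ?_
        rw [interior_Icc] at hy
        rw [hder]
        refine mul_neg_of_pos_of_neg (hA y) ?_
        rw [cos_eq_neg_sin_sub k, neg_lt_zero]
        have h1 := hψm hy.2.le
        have h2 := hgt y hy.1
        refine Real.sin_pos_of_pos_of_lt_pi ?_ ?_ <;> linarith
      rw [← hconst b (right_mem_Icc.2 hab)]
      exact hanti (left_mem_Icc.2 (le_of_lt hxb)) (right_mem_Icc.2 (le_of_lt hxb)) hxb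

/-- A function whose derivative has the sign of `cos ψ`, where `ψ` increases by `2πn` over a
period, has `n` maxima per period. -/
theorem numMaxima_eq {ψ h A : ℝ → ℝ} (hψc : Continuous ψ) (hψm : Monotone ψ)
    (hA : ∀ t, 0 < A t) (hd : ∀ t, HasDerivAt h (A t * Real.cos (ψ t)) t)
    {n : ℕ} (hn : 0 < n) (hper : ∀ t, ψ (t + 1) = ψ t + 2 * Real.pi * n) :
    numMaxima h = n := by
  have hpi := Real.pi_pos
  have hn' : (0 : ℝ) < n := by exact_mod_cast hn
  have hnat : ∀ (m : ℕ) (t : ℝ), ψ (t + m) = ψ t + 2 * Real.pi * n * m := by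
    intro m
    induction m with
    | zero => simp
    | succ m ih => intro t; push_cast; rw [← add_assoc, hper, ih]; ring
  have hunb : ∀ c, ∃ t, c < ψ t := fun c => by
    obtain ⟨m, hm⟩ := exists_nat_gt ((c - ψ 0) / (2 * Real.pi * n))
    rw [div_lt_iff₀ (by positivity)] at hm
    exact ⟨0 + m, by rw [hnat]; linarith⟩
  have hunb' : ∀ c, ∃ t, ψ t < c := fun c => by
    obtain ⟨m, hm⟩ := exists_nat_gt ((ψ 0 - c) / (2 * Real.pi * n))
    rw [div_lt_iff₀ (by positivity)] at hm
    refine ⟨-m, ?_⟩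
    have := hnat m (-m)
    rw [neg_add_cancel] at this
    linarith
  have hiff := maximumBeginsAt_iff hψc hψm hA hd hunb
  let c : ℤ → ℝ := fun k => Real.pi / 2 + 2 * Real.pi * k
  let S : ℤ → Set ℝ := fun k => {t | c k ≤ ψ t}
  -- The first time ψ reaches the k-th critical value. These times increase strictly with k and
  -- satisfy α (k + n) = α k + 1, so exactly n consecutive ones fall in [0, 1).
  let α : ℤ → ℝ := fun k => sInf (S k)
  have hbdd : ∀ k, BddBelow (S k) := fun k => by
    obtain ⟨T, hT⟩ := hunb' (c k)
    exact ⟨T, fun t (ht : c k ≤ ψ t) => le_of_not_gt fun hlt => by linarith [hψm hlt.le]⟩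
  have hne : ∀ k, (S k).Nonempty := fun k => by
    obtain ⟨T, hT⟩ := hunb (c k)
    exact ⟨T, hT.le⟩
  have hαS : ∀ k, c k ≤ ψ (α k) := fun k =>
    (isClosed_le continuous_const hψc).csInf_mem (hne k) (hbdd k)
  have hlt : ∀ k, ∀ t < α k, ψ t < c k := fun k t ht => by
    by_contra hn
    exact absurd (csInf_le (hbdd k) (show t ∈ S k from not_lt.1 hn)) (not_le.2 ht)
  have hαe : ∀ k, ψ (α k) = c k := fun k => by
    refine le_antisymm ?_ (hαS k)
    refine le_of_tendsto (f := ψ) (x := 𝓝[<] (α k))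
      (hψc.continuousAt.mono_left nhdsWithin_le_nhds) ?_
    filter_upwards [self_mem_nhdsWithin] with t ht using (hlt k t ht).le
  have huniq : ∀ k a, ψ a = c k → (∀ t < a, ψ t < ψ a) → a = α k := fun k a h1 h2 => by
    refine le_antisymm ?_ (csInf_le (hbdd k) (show a ∈ S k from h1.ge))
    by_contra hn
    have := h2 _ (not_le.1 hn)
    rw [hαe, h1] at this
    exact lt_irrefl _ this
  have hcmono : StrictMono c := fun k l hkl => by
    have : (k : ℝ) < l := by exact_mod_cast hkl
    simp only [c]
    have := mul_lt_mul_of_pos_left this (by positivity : 0 < 2 * Real.pi)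
    linarith
  have hαmono : StrictMono α := fun k l hkl => by
    by_contra hn
    have := hψm (not_lt.1 hn)
    rw [hαe, hαe] at this
    linarith [hcmono hkl]
  have hαn : ∀ k, α (k + n) = α k + 1 := fun k => by
    refine (huniq _ _ ?_ fun t ht => ?_).symm
    · rw [hper, hαe]
      simp only [c]
      push_cast
      ring
    · have := hper (t - 1)
      rw [sub_add_cancel] at this
      rw [this, hper, hαe]
      linarith [hlt k (t - 1) (by linarith)]
  obtain ⟨k₀, hk₀, hmin⟩ := Int.exists_least_of_bdd (P := fun k => 0 ≤ α k)
    (by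
      obtain ⟨m, hm⟩ := exists_int_lt ((ψ (-1) - Real.pi / 2) / (2 * Real.pi))
      refine ⟨m, fun z hz => ?_⟩
      by_contra hn
      have h1 := hcmono (not_le.1 hn)
      rw [lt_div_iff₀ (by positivity)] at hm
      have h2 : c m ≤ ψ (-1) := by simp only [c]; linarith
      have h3 : α m ≤ -1 := csInf_le (hbdd m) h2
      have h4 := hαmono (not_le.1 hn)
      linarith)
    (by
      obtain ⟨m, hm⟩ := exists_int_gt ((ψ 0 - Real.pi / 2) / (2 * Real.pi))
      refine ⟨m, ?_⟩
      rw [div_lt_iff₀ (by positivity)] at hm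
      by_contra hn
      have h1 := hψm (not_le.1 hn).le
      rw [hαe] at h1
      simp only [c] at h1
      linarith)
  have hset : {a ∈ Ico (0 : ℝ) 1 | MaximumBeginsAt h a} = α '' (Finset.Ico k₀ (k₀ + n) : Set ℤ) := by
    ext a
    simp only [mem_ofPred, Finset.coe_Ico, mem_image, mem_Ico]
    constructor
    · rintro ⟨⟨ha0, ha1⟩, hmax⟩
      obtain ⟨k, h1, h2⟩ := (hiff a).1 hmax
      have e := huniq k a h1 h2
      refine ⟨k, ⟨hmin k (e ▸ ha0), ?_⟩, e.symm⟩
      by_contra hn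
      have h3 := hαmono.monotone (not_lt.1 hn)
      rw [hαn, ← e] at h3
      linarith
    · rintro ⟨k, ⟨h1, h2⟩, rfl⟩
      refine ⟨⟨hk₀.trans (hαmono.monotone h1), ?_⟩,
        (hiff _).2 ⟨k, hαe k, fun t ht => (hlt k t ht).trans_eq (hαe k).symm⟩⟩
      by_contra hn
      have h3 : 0 ≤ α (k - n) := by
        have := hαn (k - n)
        rw [sub_add_cancel] at this
        linarith
      have := hmin _ h3
      omega
  rw [numMaxima, hset, hαmono.injective.encard_image, Set.encard_coe_eq_coe_finsetCard,
    Int.card_Ico]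
  simp

/-! ### Spirals: total curvature, regular homotopy, and affine and projective invariance. -/

/-- The squared speed of the projection of a curve to the first two coordinates. -/
def speedSq (f : ℝ → E3) (t : ℝ) : ℝ := deriv f t 0 ^ 2 + deriv f t 1 ^ 2

/-- The numerator of the signed curvature of the projection to the first two coordinates. -/
def kappa (f : ℝ → E3) (t : ℝ) : ℝ :=
  deriv f t 0 * deriv (deriv f) t 1 - deriv (deriv f) t 0 * deriv f t 1

/-- The total signed curvature of the projection to the first two coordinates. -/
def turn (f : ℝ → E3) : ℝ := ∫ t in (0 : ℝ)..1, kappa f t / speedSq f t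

/-- A knot whose projection to the first two coordinates is immersed and nonnegatively curved. -/
structure Spiral (f : ℝ → E3) : Prop where
  isKnot : IsKnot f
  planar : ∀ t, 0 < speedSq f t
  curv : ∀ t, 0 ≤ kappa f t

theorem contDiff_speedSq {f : ℝ → E3} (hf : ContDiff ℝ ∞ f) : ContDiff ℝ ∞ (speedSq f) :=
  ((contDiff_coord (contDiff_deriv hf) 0).pow 2).add ((contDiff_coord (contDiff_deriv hf) 1).pow 2)

theorem contDiff_kappa {f : ℝ → E3} (hf : ContDiff ℝ ∞ f) : ContDiff ℝ ∞ (kappa f) :=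
  ((contDiff_coord (contDiff_deriv hf) 0).mul
    (contDiff_coord (contDiff_deriv (contDiff_deriv hf)) 1)).sub
    ((contDiff_coord (contDiff_deriv (contDiff_deriv hf)) 0).mul
    (contDiff_coord (contDiff_deriv hf) 1))

theorem speedSq_periodic {f : ℝ → E3} (hf : Function.Periodic f 1) :
    Function.Periodic (speedSq f) 1 := fun t => by
  simp only [speedSq, deriv_periodic hf t]

theorem kappa_periodic {f : ℝ → E3} (hf : Function.Periodic f 1) :
    Function.Periodic (kappa f) 1 := fun t => by
  simp only [kappa, deriv_periodic hf t, deriv_periodic (deriv_periodic hf) t]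

theorem hasDerivAt_of_smooth {F : Type*} [NormedAddCommGroup F] [NormedSpace ℝ F] {f : ℝ → F}
    (hf : ContDiff ℝ ∞ f) (t : ℝ) : HasDerivAt f (deriv f t) t :=
  (hf.differentiable (by simp) t).hasDerivAt

theorem exists_tangent_angle {f : ℝ → E3} (hf : ContDiff ℝ ∞ f) (h : ∀ t, 0 < speedSq f t) :
    ∃ θ A : ℝ → ℝ, (∀ t, HasDerivAt θ (kappa f t / speedSq f t) t) ∧
      (θ 1 - θ 0 = turn f) ∧ (∀ t, 0 < A t) ∧ (∀ t, deriv f t 0 = A t * Real.cos (θ t)) ∧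
      ∀ t, deriv f t 1 = A t * Real.sin (θ t) := by
  have hf' := contDiff_deriv hf
  obtain ⟨θ, A, h1, h2, h3, h4, h5⟩ := exists_angle (contDiff_coord hf' 0) (contDiff_coord hf' 1) h
  simp only [deriv_coord hf'] at h1 h2
  exact ⟨θ, A, h1, h2 1, h3, h4, h5⟩

/-- The tangent vectors at times 0 and 1 agree, so the tangent angles differ by a multiple of 2π. -/
theorem turn_eq_int {f : ℝ → E3} (hf : ContDiff ℝ ∞ f) (hp : Function.Periodic f 1)
    (h : ∀ t, 0 < speedSq f t) : ∃ n : ℤ, turn f = 2 * Real.pi * n := by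
  obtain ⟨θ, A, -, h1, hA, h2, h3⟩ := exists_tangent_angle hf h
  have e : deriv f 1 = deriv f 0 := by
    have := deriv_periodic hp 0
    rwa [zero_add] at this
  have hAA : ∀ t, A t ^ 2 = speedSq f t := fun t => by
    rw [speedSq, h2, h3]
    linear_combination (-A t ^ 2) * Real.sin_sq_add_cos_sq (θ t)
  have eA : A 1 = A 0 := by
    have : A 1 ^ 2 = A 0 ^ 2 := by rw [hAA, hAA, speedSq, speedSq, e]
    exact (pow_left_inj₀ (hA 1).le (hA 0).le two_ne_zero).1 this
  have ec : Real.cos (θ 1) = Real.cos (θ 0) := by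
    have := h2 1
    rw [e, h2 0, eA] at this
    exact (mul_left_cancel₀ (hA 0).ne' this).symm
  have es : Real.sin (θ 1) = Real.sin (θ 0) := by
    have := h3 1
    rw [e, h3 0, eA] at this
    exact (mul_left_cancel₀ (hA 0).ne' this).symm
  obtain ⟨n, hn⟩ := Real.Angle.angle_eq_iff_two_pi_dvd_sub.1 (Real.Angle.cos_sin_inj ec es)
  exact ⟨n, by rw [← h1, hn]⟩

theorem exists_polar (α β : ℝ) (h : α ≠ 0 ∨ β ≠ 0) :
    ∃ r φ : ℝ, 0 < r ∧ α = r * Real.cos φ ∧ β = r * Real.sin φ := by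
  let z : ℂ := ⟨α, β⟩
  refine ⟨‖z‖, Complex.arg z, norm_pos_iff.2 fun hz => ?_, (Complex.norm_mul_cos_arg z).symm,
    (Complex.norm_mul_sin_arg z).symm⟩
  rcases h with h | h
  · exact h (congrArg Complex.re hz)
  · exact h (congrArg Complex.im hz)

/-- The total curvature of a spiral projection is `2πn`, where `n` is the number of maxima in any
direction. -/
theorem Spiral.exists_turn {f : ℝ → E3} (h : Spiral f) : ∃ n : ℕ, 0 < n ∧
    turn f = 2 * Real.pi * n ∧
    ∀ α β : ℝ, (α ≠ 0 ∨ β ≠ 0) → numMaxima (fun t => α * f t 0 + β * f t 1) = n := by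
  have hpi := Real.pi_pos
  have hsm := h.isKnot.smooth
  have hp := h.isKnot.periodic
  obtain ⟨θ, A, h0, h1, hA, h2, h3⟩ := exists_tangent_angle hsm h.planar
  obtain ⟨n, hn⟩ := turn_eq_int hsm hp h.planar
  have hmono : Monotone θ := monotone_of_deriv_nonneg (fun t => (h0 t).differentiableAt) fun t => by
    rw [(h0 t).deriv]
    exact div_nonneg (h.curv t) (h.planar t).le
  have hcont : Continuous θ := continuous_iff_continuousAt.2 fun t => (h0 t).continuousAt
  have hd : ∀ (α β t : ℝ), HasDerivAt (fun t => α * f t 0 + β * f t 1)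
      (α * deriv f t 0 + β * deriv f t 1) t := fun α β t =>
    ((hasDerivAt_coord (hasDerivAt_of_smooth hsm t) 0).const_mul α).add
      ((hasDerivAt_coord (hasDerivAt_of_smooth hsm t) 1).const_mul β)
  -- Without positive turning the monotone tangent angle would be constant over a period, and the
  -- curve would advance strictly in one direction and could not close up.
  have hn0 : 0 < n := by
    by_contra hneg
    have hle : turn f ≤ 0 := by
      have : (n : ℝ) ≤ 0 := by exact_mod_cast not_lt.1 hneg
      rw [hn]
      exact mul_nonpos_of_nonneg_of_nonpos (by positivity) this
    have hθ : ∀ t ∈ Icc (0 : ℝ) 1, θ t = θ 0 := fun t ht => by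
      have := hmono ht.1
      have := hmono ht.2
      linarith
    have hstrict : StrictMonoOn (fun t => Real.cos (θ 0) * f t 0 + Real.sin (θ 0) * f t 1)
        (Icc 0 1) := by
      refine strictMonoOn_of_deriv_pos (convex_Icc _ _)
        (fun t _ => (hd _ _ t).continuousAt.continuousWithinAt) fun t ht => ?_
      rw [interior_Icc] at ht
      rw [(hd _ _ t).deriv, h2, h3, hθ t ⟨ht.1.le, ht.2.le⟩]
      have : Real.cos (θ 0) * (A t * Real.cos (θ 0)) + Real.sin (θ 0) * (A t * Real.sin (θ 0)) =
          A t := by linear_combination A t * Real.sin_sq_add_cos_sq (θ 0)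
      rw [this]
      exact hA t
    have := hstrict (by norm_num) (by norm_num) (zero_lt_one)
    simp only at this
    have e := hp 0
    rw [zero_add] at e
    rw [e] at this
    exact lt_irrefl _ this
  lift n to ℕ using hn0.le
  have hn1 : 0 < n := by exact_mod_cast hn0
  refine ⟨n, hn1, by exact_mod_cast hn, fun α β hαβ => ?_⟩
  obtain ⟨r, φ, hr, rfl, rfl⟩ := exists_polar α β hαβ
  refine numMaxima_eq (ψ := fun t => θ t - φ) (A := fun t => r * A t) (hcont.sub continuous_const)
    (fun t t' ht => sub_le_sub_right (hmono ht) _) (fun t => mul_pos hr (hA t)) (fun t => ?_) hn1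
    fun t => ?_
  · refine (hd _ _ t).congr_deriv ?_
    rw [h2, h3, Real.cos_sub]
    ring
  · have hc : ∀ t, HasDerivAt (fun t => θ (t + 1) - θ t) 0 t := fun t => by
      have d1 := (h0 (t + 1)).comp_add_const t 1
      refine (d1.sub (h0 t)).congr_deriv ?_
      rw [kappa_periodic hp, speedSq_periodic hp, sub_self]
    have := is_const_of_deriv_eq_zero (fun t => (hc t).differentiableAt) (fun t => (hc t).deriv) t 0
    simp only [zero_add] at this
    push_cast at hn
    linarith

theorem contDiff_kappa_family {H : ℝ → ℝ → E3} (hs : ContDiff ℝ ∞ fun p : ℝ × ℝ => H p.1 p.2) :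
    ContDiff ℝ ∞ fun p : ℝ × ℝ => kappa (H p.1) p.2 := by
  have h1 := contDiff_deriv_right hs
  have h2 := contDiff_deriv_right (H := fun s t => deriv (H s) t) h1
  exact ((contDiff_coord h1 0).mul (contDiff_coord h2 1)).sub
    ((contDiff_coord h2 0).mul (contDiff_coord h1 1))

theorem contDiff_speedSq_family {H : ℝ → ℝ → E3} (hs : ContDiff ℝ ∞ fun p : ℝ × ℝ => H p.1 p.2) :
    ContDiff ℝ ∞ fun p : ℝ × ℝ => speedSq (H p.1) p.2 := by
  have h1 := contDiff_deriv_right hs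
  exact ((contDiff_coord h1 0).pow 2).add ((contDiff_coord h1 1).pow 2)

/-- The total curvature is invariant under regular homotopy. -/
theorem turn_homotopy {H : ℝ → ℝ → E3} (hs : ContDiff ℝ ∞ fun p : ℝ × ℝ => H p.1 p.2)
    (hp : ∀ s ∈ Icc (0 : ℝ) 1, Function.Periodic (H s) 1)
    (h : ∀ s ∈ Icc (0 : ℝ) 1, ∀ t, 0 < speedSq (H s) t) : turn (H 0) = turn (H 1) := by
  let φ := Real.smoothTransition
  have hs' : ContDiff ℝ ∞ fun p : ℝ × ℝ => H (φ p.1) p.2 :=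
    hs.comp ((Real.smoothTransition.contDiff.comp contDiff_fst).prodMk contDiff_snd)
  have hc : Continuous fun s => turn (H (φ s)) := by
    refine intervalIntegral.continuous_parametric_intervalIntegral_of_continuous' ?_ 0 1
    exact (contDiff_kappa_family (H := fun s => H (φ s)) hs').continuous.div
      (contDiff_speedSq_family (H := fun s => H (φ s)) hs').continuous
      fun p => (h _ (smoothTransition_mem _) _).ne'
  choose n hn using fun s => turn_eq_int (smooth_slice hs (φ s)) (hp _ (smoothTransition_mem s))
    (h _ (smoothTransition_mem s))
  -- The total curvature varies continuously in multiples of 2π, so it is constant on the connected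
  -- line of parameters.
  have hnc : Continuous n := by
    rw [Int.isClosedEmbedding_coe_real.isEmbedding.continuous_iff]
    have : ((↑) : ℤ → ℝ) ∘ n = fun s => turn (H (φ s)) / (2 * Real.pi) := by
      funext s
      have := Real.pi_ne_zero
      rw [hn]
      simp only [Function.comp_apply]
      field_simp
    rw [this]
    exact hc.div_const _
  have h01 : n 0 = n 1 := PreconnectedSpace.constant inferInstance hnc
  have h0 := hn 0
  have h1 := hn 1
  rw [h01] at h0
  have e0 : φ 0 = 0 := Real.smoothTransition.zero
  have e1 : φ 1 = 1 := Real.smoothTransition.one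
  rw [e0] at h0
  rw [e1] at h1
  rw [h0, h1]

theorem deriv_act_add {f : ℝ → E3} (hf : ContDiff ℝ ∞ f) (M : Matrix (Fin 3) (Fin 3) ℝ) (b : E3) :
    deriv (fun t => act M (f t) + b) = fun t => act M (deriv f t) :=
  funext fun t => (((act M).hasFDerivAt.comp_hasDerivAt t
    (hasDerivAt_of_smooth hf t)).add_const b).deriv

theorem deriv_deriv_act_add {f : ℝ → E3} (hf : ContDiff ℝ ∞ f) (M : Matrix (Fin 3) (Fin 3) ℝ)
    (b : E3) : deriv (deriv (fun t => act M (f t) + b)) = fun t => act M (deriv (deriv f) t) := by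
  rw [deriv_act_add hf]
  have := deriv_act_add (contDiff_deriv hf) M 0
  simpa using this

theorem det_of_planar {M : Matrix (Fin 3) (Fin 3) ℝ} (h0 : M 0 2 = 0) (h1 : M 1 2 = 0) :
    M.det = (M 0 0 * M 1 1 - M 0 1 * M 1 0) * M 2 2 := by
  rw [Matrix.det_fin_three, h0, h1]
  ring

theorem kappa_act {f : ℝ → E3} (hf : ContDiff ℝ ∞ f) {M : Matrix (Fin 3) (Fin 3) ℝ}
    (h0 : M 0 2 = 0) (h1 : M 1 2 = 0) (b : E3) (t : ℝ) :
    kappa (fun t => act M (f t) + b) t = (M 0 0 * M 1 1 - M 0 1 * M 1 0) * kappa f t := by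
  rw [kappa, deriv_deriv_act_add hf, deriv_act_add hf]
  simp only [act_apply, h0, h1, kappa]
  ring

theorem speedSq_act_pos {f : ℝ → E3} (hf : ContDiff ℝ ∞ f) {M : Matrix (Fin 3) (Fin 3) ℝ}
    (h0 : M 0 2 = 0) (h1 : M 1 2 = 0) (hM : 0 < M 0 0 * M 1 1 - M 0 1 * M 1 0) (b : E3) {t : ℝ}
    (h : 0 < speedSq f t) : 0 < speedSq (fun t => act M (f t) + b) t := by
  rw [speedSq, deriv_act_add hf]
  simp only [act_apply, h0, h1, zero_mul, add_zero]
  refine lt_of_le_of_ne (by positivity) fun e => ?_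
  set x := deriv f t 0 with hx
  set y := deriv f t 1 with hy
  have e1 : M 0 0 * x + M 0 1 * y = 0 := by nlinarith [sq_nonneg (M 1 0 * x + M 1 1 * y)]
  have e2 : M 1 0 * x + M 1 1 * y = 0 := by nlinarith [sq_nonneg (M 0 0 * x + M 0 1 * y)]
  have e3 : (M 0 0 * M 1 1 - M 0 1 * M 1 0) * x = 0 := by linear_combination M 1 1 * e1 - M 0 1 * e2
  have e4 : (M 0 0 * M 1 1 - M 0 1 * M 1 0) * y = 0 := by linear_combination M 0 0 * e2 - M 1 0 * e1
  have ex := (mul_eq_zero.1 e3).resolve_left hM.ne'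
  have ey := (mul_eq_zero.1 e4).resolve_left hM.ne'
  rw [speedSq, ← hx, ← hy, ex, ey] at h
  norm_num at h

theorem turn_add_const (f : ℝ → E3) (b : E3) : turn (fun t => f t + b) = turn f := by
  have : deriv (fun t => f t + b) = deriv f := funext fun t => deriv_add_const b
  simp only [turn, kappa, speedSq, this]

/-- Affine maps that preserve the vertical direction and the orientations preserve spirals. -/
theorem Spiral.affine {f : ℝ → E3} (h : Spiral f) {M : Matrix (Fin 3) (Fin 3) ℝ}
    (h0 : M 0 2 = 0) (h1 : M 1 2 = 0) (hM : 0 < M 0 0 * M 1 1 - M 0 1 * M 1 0) (h2 : M 2 2 ≠ 0)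
    (b : E3) : Spiral (fun t => act M (f t) + b) ∧ turn (fun t => act M (f t) + b) = turn f := by
  have hdet : M.det ≠ 0 := by
    rw [det_of_planar h0 h1]
    exact mul_ne_zero hM.ne' h2
  have hS : ∀ b, Spiral (fun t => act M (f t) + b) := fun b =>
    { isKnot := h.isKnot.linear_comp (act_injective hdet) b
      planar := fun t => speedSq_act_pos h.isKnot.smooth h0 h1 hM b (h.planar t)
      curv := fun t => by
        rw [kappa_act h.isKnot.smooth h0 h1]
        exact mul_nonneg hM.le (h.curv t) }
  refine ⟨hS b, ?_⟩
  -- Turning numbers are compared by counting maxima: the first coordinate of the image is, up to a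
  -- constant, a nonzero linear height function of the original curve.
  obtain ⟨n, -, hn, hmax⟩ := h.exists_turn
  obtain ⟨n', -, hn', hmax'⟩ := (hS 0).exists_turn
  have e1 := hmax' 1 0 (by simp)
  have e2 := hmax (M 0 0) (M 0 1) (by
    by_contra hc
    push Not at hc
    rw [hc.1, hc.2] at hM
    simp at hM)
  have e : (fun t => 1 * (act M (f t) + 0 : E3) 0 + 0 * (act M (f t) + 0 : E3) 1) =
      fun t => M 0 0 * f t 0 + M 0 1 * f t 1 := by
    funext t
    simp [act_apply, h0]
  rw [e, e2] at e1
  have e3 : n = n' := by exact_mod_cast e1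
  have := turn_add_const (fun t => act M (f t) + 0) b
  simp only [add_zero] at this hn'
  rw [this, hn', hn, e3]

theorem turn_shift {f : ℝ → E3} (hp : Function.Periodic f 1) (a : ℝ) :
    turn (fun t => f (t + a)) = turn f := by
  have e1 : deriv (fun t => f (t + a)) = fun t => deriv f (t + a) :=
    funext fun t => deriv_comp_add_const f a t
  have e2 : deriv (fun t => deriv f (t + a)) = fun t => deriv (deriv f) (t + a) :=
    funext fun t => deriv_comp_add_const (deriv f) a t
  have hper : Function.Periodic (fun t => kappa f t / speedSq f t) 1 := fun t => by
    simp only [kappa_periodic hp t, speedSq_periodic hp t]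
  have h := hper.intervalIntegral_add_eq a 0
  have h2 := intervalIntegral.integral_comp_add_right (a := 0) (b := 1)
    (fun t => kappa f t / speedSq f t) a
  simp only [zero_add] at h h2
  rw [add_comm 1 a] at h2
  rw [turn, turn, ← h, ← h2]
  simp only [kappa, speedSq, e1, e2]

theorem Spiral.shift {f : ℝ → E3} (h : Spiral f) (a : ℝ) : Spiral (fun t => f (t + a)) where
  isKnot := h.isKnot.shift a
  planar := fun t => by
    have := h.planar (t + a)
    rwa [speedSq, deriv_comp_add_const]
  curv := fun t => by
    have e1 : deriv (fun t => f (t + a)) = fun t => deriv f (t + a) :=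
      funext fun t => deriv_comp_add_const f a t
    have e2 : deriv (fun t => deriv f (t + a)) = fun t => deriv (deriv f) (t + a) :=
      funext fun t => deriv_comp_add_const (deriv f) a t
    have := h.curv (t + a)
    rw [kappa, e1, e2]
    exact this

theorem Spiral.swap {f : ℝ → E3} (h : Spiral f) : Spiral (swap f) ∧ turn (swap f) = turn f := by
  have := (h.shift (1 / 2)).affine (M := halfTurn) (by simp [halfTurn]) (by simp [halfTurn])
    (by simp [halfTurn]) (by simp [halfTurn]) 0
  simp only [add_zero] at this
  exact ⟨this.1, this.2.trans (turn_shift h.isKnot.periodic _)⟩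

/-- The half turn about the first axis. -/
def flip : Matrix (Fin 3) (Fin 3) ℝ := Matrix.diagonal ![1, -1, -1]

/-- A spiral knot with the opposite orientation, turned over, is again a spiral. -/
theorem Spiral.reverse {f : ℝ → E3} (h : Spiral f) :
    Spiral (fun t => act flip (f (-t))) ∧ turn (fun t => act flip (f (-t))) = turn f := by
  have hdet : flip.det = 1 := by
    rw [flip, Matrix.det_diagonal, Fin.prod_univ_three]
    simp
  have hk := h.isKnot.reverse.linear_comp (A := act flip) (act_injective (by simp [hdet])) 0
  simp only [add_zero] at hk
  have e1 : deriv (fun t => act flip (f (-t))) = fun t => -act flip (deriv f (-t)) := by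
    have := deriv_act_add (f := fun t => f (-t)) h.isKnot.reverse.smooth flip 0
    simp only [add_zero] at this
    rw [this]
    funext t
    rw [deriv_comp_neg, map_neg]
  have e2 : deriv (deriv (fun t => act flip (f (-t)))) =
      fun t => act flip (deriv (deriv f) (-t)) := by
    have hs : ContDiff ℝ ∞ fun t => deriv f (-t) :=
      (contDiff_deriv h.isKnot.smooth).comp contDiff_neg
    have := deriv_act_add hs flip 0
    simp only [add_zero] at this
    rw [e1]
    funext t
    rw [deriv.fun_neg, this]
    simp only
    rw [deriv_comp_neg, map_neg, neg_neg]
  -- Reversal negates first derivatives and the flip negates the second coordinate; the two signs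
  -- cancel in the curvature.
  have hkap : ∀ t, kappa (fun t => act flip (f (-t))) t = kappa f (-t) := fun t => by
    rw [kappa, e2, e1]
    simp [act_apply, flip, kappa]
  have hsp : ∀ t, speedSq (fun t => act flip (f (-t))) t = speedSq f (-t) := fun t => by
    rw [speedSq, e1]
    simp [act_apply, flip, speedSq]
  refine ⟨⟨hk, fun t => by rw [hsp]; exact h.planar _, fun t => by rw [hkap]; exact h.curv _⟩, ?_⟩
  have hp := h.isKnot.periodic
  have hper : Function.Periodic (fun t => kappa f t / speedSq f t) 1 := fun t => by
    simp only [kappa_periodic hp t, speedSq_periodic hp t]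
  have h1 := hper.intervalIntegral_add_eq (-1) 0
  have h2 := intervalIntegral.integral_comp_neg (a := 0) (b := 1)
    (fun t => kappa f t / speedSq f t)
  simp only [zero_add, neg_add_cancel, neg_zero] at h1 h2
  rw [turn, turn, ← h1, ← h2]
  simp only [hkap, hsp]

/-- The term with the second derivative of `g` is parallel to the velocity and drops out, so the
curvature numerator is multiplied by the cube of a positive number. -/
theorem Spiral.reparam {f : ℝ → E3} (h : Spiral f) {g : ℝ → ℝ} (hg : ContDiff ℝ ∞ g)
    (hk : IsKnot fun t => f (g t)) (hd : ∀ t, 0 < deriv g t) : Spiral (fun t => f (g t)) := by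
  have hs := h.isKnot.smooth
  have e1 : deriv (fun t => f (g t)) = fun t => deriv g t • deriv f (g t) := funext fun t =>
    ((hasDerivAt_of_smooth hs (g t)).scomp t (hasDerivAt_of_smooth hg t)).deriv
  have e2 : deriv (deriv (fun t => f (g t))) = fun t => deriv g t • (deriv g t •
      deriv (deriv f) (g t)) + deriv (deriv g) t • deriv f (g t) := by
    rw [e1]
    funext t
    have d1 := (hasDerivAt_of_smooth (contDiff_deriv hs) (g t)).scomp t (hasDerivAt_of_smooth hg t)
    exact ((hasDerivAt_of_smooth (contDiff_deriv hg) t).smul d1).deriv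
  refine ⟨hk, fun t => ?_, fun t => ?_⟩
  · have e : speedSq (fun t => f (g t)) t = deriv g t ^ 2 * speedSq f (g t) := by
      rw [speedSq, e1]
      simp only [PiLp.smul_apply, smul_eq_mul, speedSq]
      ring
    rw [e]
    exact mul_pos (pow_pos (hd t) 2) (h.planar _)
  · have e : kappa (fun t => f (g t)) t = deriv g t ^ 3 * kappa f (g t) := by
      rw [kappa, e2, e1]
      simp only [PiLp.smul_apply, PiLp.add_apply, smul_eq_mul, kappa]
      ring
    rw [e]
    exact mul_nonneg (pow_pos (hd t) 3).le (h.curv _)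

/-- The projective transformations `proj k` preserve spirals. -/
theorem Spiral.proj {f : ℝ → E3} (h : Spiral f) {k : ℝ} (hk : 0 < k)
    (hD : ∀ t, 0 < projDen k (f t)) : Spiral (fun t => proj k (f t)) := by
  have hs := h.isKnot.smooth
  have hK := isKnot_proj h.isKnot hk fun t => (hD t).ne'
  set P : ℝ → E3 := fun t => SpiralIndex.proj k (f t) with hP
  have hPs := hK.smooth
  have dD : ∀ t, HasDerivAt (fun t => projDen k (f t)) (-((k ^ 2 - 1) * deriv f t 0)) t := fun t =>
    ((hasDerivAt_coord (hasDerivAt_of_smooth hs t) 0).const_mul (k ^ 2 - 1)).const_sub (k ^ 2 + 1)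
  have e0 : (fun t => projDen k (f t) * P t 0) = fun t => (k ^ 2 + 1) * f t 0 - (k ^ 2 - 1) :=
    funext fun t => by rw [hP, proj_zero, mul_div_cancel₀ _ (hD t).ne']
  have e1 : (fun t => projDen k (f t) * P t 1) = fun t => 2 * k * f t 1 :=
    funext fun t => by rw [hP, proj_one, mul_div_cancel₀ _ (hD t).ne']
  -- Denominator times image is affine in `f`, so differentiating this product gives the derivatives
  -- of the image with no quotient rule.
  have a0 : ∀ t, -((k ^ 2 - 1) * deriv f t 0) * P t 0 + projDen k (f t) * deriv P t 0 =
      (k ^ 2 + 1) * deriv f t 0 := fun t => by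
    have d1 := (dD t).mul (hasDerivAt_coord (hasDerivAt_of_smooth hPs t) 0)
    have d2 := ((hasDerivAt_coord (hasDerivAt_of_smooth hs t) 0).const_mul (k ^ 2 + 1)).sub_const
      (k ^ 2 - 1)
    rw [Pi.mul_def, e0] at d1
    exact d1.unique d2
  have a1 : ∀ t, -((k ^ 2 - 1) * deriv f t 0) * P t 1 + projDen k (f t) * deriv P t 1 =
      2 * k * deriv f t 1 := fun t => by
    have d1 := (dD t).mul (hasDerivAt_coord (hasDerivAt_of_smooth hPs t) 1)
    have d2 := (hasDerivAt_coord (hasDerivAt_of_smooth hs t) 1).const_mul (2 * k)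
    rw [Pi.mul_def, e1] at d1
    exact d1.unique d2
  have hs' := contDiff_deriv hs
  have hPs' := contDiff_deriv hPs
  have b0 : ∀ t, projDen k (f t) * deriv (deriv P) t 0 = (k ^ 2 + 1) * deriv (deriv f) t 0 +
      (k ^ 2 - 1) * deriv (deriv f) t 0 * P t 0 + 2 * (k ^ 2 - 1) * deriv f t 0 * deriv P t 0 :=
    fun t => by
    have d1 := ((((hasDerivAt_coord (hasDerivAt_of_smooth hs' t) 0).const_mul (k ^ 2 - 1)).neg).mul
      (hasDerivAt_coord (hasDerivAt_of_smooth hPs t) 0)).add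
      ((dD t).mul (hasDerivAt_coord (hasDerivAt_of_smooth hPs' t) 0))
    have d2 := (hasDerivAt_coord (hasDerivAt_of_smooth hs' t) 0).const_mul (k ^ 2 + 1)
    rw [← funext a0] at d2
    have := d1.unique d2
    simp only [Pi.neg_apply] at this
    linear_combination this
  have b1 : ∀ t, projDen k (f t) * deriv (deriv P) t 1 = 2 * k * deriv (deriv f) t 1 +
      (k ^ 2 - 1) * deriv (deriv f) t 0 * P t 1 + 2 * (k ^ 2 - 1) * deriv f t 0 * deriv P t 1 :=
    fun t => by
    have d1 := ((((hasDerivAt_coord (hasDerivAt_of_smooth hs' t) 0).const_mul (k ^ 2 - 1)).neg).mul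
      (hasDerivAt_coord (hasDerivAt_of_smooth hPs t) 1)).add
      ((dD t).mul (hasDerivAt_coord (hasDerivAt_of_smooth hPs' t) 1))
    have d2 := (hasDerivAt_coord (hasDerivAt_of_smooth hs' t) 1).const_mul (2 * k)
    rw [← funext a1] at d2
    have := d1.unique d2
    simp only [Pi.neg_apply] at this
    linear_combination this
  have hq : ∀ t, projDen k (f t) * ((k ^ 2 + 1) + (k ^ 2 - 1) * P t 0) = 4 * k ^ 2 := fun t => by
    have := congrFun e0 t
    simp only at this
    have hDe : projDen k (f t) = (k ^ 2 + 1) - (k ^ 2 - 1) * f t 0 := rfl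
    linear_combination (k ^ 2 - 1) * this + (k ^ 2 + 1) * hDe
  have hk2 : 0 < 4 * k ^ 2 := by positivity
  refine ⟨hK, fun t => ?_, fun t => ?_⟩
  · refine lt_of_le_of_ne (by unfold speedSq; positivity) fun e => ?_
    rw [speedSq] at e
    have z0 : deriv P t 0 = 0 := by nlinarith [sq_nonneg (deriv P t 0), sq_nonneg (deriv P t 1)]
    have z1 : deriv P t 1 = 0 := by nlinarith [sq_nonneg (deriv P t 0), sq_nonneg (deriv P t 1)]
    have x0 : deriv f t 0 = 0 := by
      have h1 := a0 t
      have h2 := hq t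
      rw [z0] at h1
      have : 4 * k ^ 2 * deriv f t 0 = 0 := by
        rw [← h2]
        linear_combination (-projDen k (f t)) * h1
      exact (mul_eq_zero.1 this).resolve_left hk2.ne'
    have y0 : deriv f t 1 = 0 := by
      have h1 := a1 t
      rw [z1, x0] at h1
      have : 2 * k * deriv f t 1 = 0 := by linarith
      exact (mul_eq_zero.1 this).resolve_left (by positivity)
    have := h.planar t
    rw [speedSq, x0, y0] at this
    norm_num at this
  -- Projective maps preserve inflections: the curvature numerator changes only by a positive factor
  -- where the denominator is positive.
  · have hkey : projDen k (f t) ^ 3 * kappa P t = 8 * k ^ 3 * kappa f t := by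
      have h0 := a0 t
      have h1 := a1 t
      have h2 := b0 t
      have h3 := b1 t
      have h4 := hq t
      simp only [kappa]
      set D := projDen k (f t)
      set p0 := P t 0
      set p1 := P t 1
      set p0' := deriv P t 0
      set p1' := deriv P t 1
      set p0'' := deriv (deriv P) t 0
      set p1'' := deriv (deriv P) t 1
      set x' := deriv f t 0
      set y' := deriv f t 1
      set x'' := deriv (deriv f) t 0
      set y'' := deriv (deriv f) t 1
      have g0 : D * p0' = x' * ((k ^ 2 + 1) + (k ^ 2 - 1) * p0) := by linear_combination h0
      have g1 : D * p1' = 2 * k * y' + (k ^ 2 - 1) * x' * p1 := by linear_combination h1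
      calc D ^ 3 * (p0' * p1'' - p0'' * p1')
          = D * ((D * p0') * (D * p1'') - (D * p0'') * (D * p1')) := by ring
        _ = D * ((x' * ((k ^ 2 + 1) + (k ^ 2 - 1) * p0)) * (2 * k * y'' +
            (k ^ 2 - 1) * x'' * p1) - ((k ^ 2 + 1) * x'' + (k ^ 2 - 1) * x'' * p0) *
            (2 * k * y' + (k ^ 2 - 1) * x' * p1)
            + 2 * (k ^ 2 - 1) * x' * (p1' * (D * p0') - p0' * (D * p1'))) := by
              rw [h2, h3]
              linear_combination D * (2 * k * y'' + (k ^ 2 - 1) * x'' * p1) * g0 -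
                D * ((k ^ 2 + 1) * x'' + (k ^ 2 - 1) * x'' * p0) * g1
        _ = D * ((k ^ 2 + 1) + (k ^ 2 - 1) * p0) * (2 * k * (x' * y'' - x'' * y')) := by ring
        _ = 8 * k ^ 3 * (x' * y'' - x'' * y') := by rw [h4]; ring
    have h1 : 0 ≤ projDen k (f t) ^ 3 * kappa P t := by
      rw [hkey]
      exact mul_nonneg (by positivity) (h.curv t)
    exact nonneg_of_mul_nonneg_right h1 (pow_pos (hD t) 3)

/-! ### Making an outermost point that is passed only once. -/

/-- Small perturbations keep a planar immersed knot isotopic, with the same total curvature. -/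
theorem exists_perturb {f : ℝ → E3} (hf : IsKnot f) (hpl : ∀ t, 0 < speedSq f t) :
    ∃ m > 0, ∀ P : ℝ → E3, ContDiff ℝ ∞ P → Function.Periodic P 1 → (∀ t, ‖deriv P t‖ ≤ m) →
      Iso f (fun t => f t + P t) ∧ (∀ t, 0 < speedSq (fun t => f t + P t) t) ∧
      turn (fun t => f t + P t) = turn f := by
  obtain ⟨m, hm, hbl⟩ := exists_biLipschitz (H := fun _ => f) (hf.smooth.comp contDiff_snd)
    fun _ _ => hf
  obtain ⟨p, hp, hmin⟩ := (isCompact_Icc (a := (0 : ℝ)) (b := 1)).exists_isMinOn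
    ⟨0, by simp⟩ (contDiff_speedSq hf.smooth).continuous.continuousOn
  have hμ : ∀ t, speedSq f p ≤ speedSq f t := fun t => by
    rw [← periodic_fract (speedSq_periodic hf.periodic) t]
    exact isMinOn_iff.1 hmin _ ⟨Int.fract_nonneg t, (Int.fract_lt_one t).le⟩
  set μ := speedSq f p with hμe
  have hμ0 : 0 < μ := hpl p
  -- Half of the bi-Lipschitz constant keeps the curve a knot. The other bounds keep the projection
  -- immersed: at a cusp the original squared speed would be at most 2c² ≤ 2c ≤ μ/2, below its
  -- minimum μ.
  refine ⟨min (m / 2) (min 1 (μ / 4)), by positivity, fun P hP hPp hPd => ?_⟩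
  set c := min (m / 2) (min 1 (μ / 4))
  have hcm : c < m := (min_le_left _ _).trans_lt (by linarith)
  have hc1 : c ≤ 1 := (min_le_right _ _).trans (min_le_left _ _)
  have hcμ : c ≤ μ / 4 := (min_le_right _ _).trans (min_le_right _ _)
  let H : ℝ → ℝ → E3 := fun s t => f t + s • P t
  have hH : ContDiff ℝ ∞ fun p : ℝ × ℝ => H p.1 p.2 :=
    (hf.smooth.comp contDiff_snd).add (contDiff_fst.smul (hP.comp contDiff_snd))
  have hd : ∀ s t : ℝ, deriv (fun t => s • P t) t = s • deriv P t := fun s t =>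
    ((hasDerivAt_of_smooth hP t).fun_const_smul s).deriv
  have hbound : ∀ s ∈ Icc (0 : ℝ) 1, ∀ t, ‖s • deriv P t‖ ≤ c := fun s hs t => by
    rw [norm_smul, Real.norm_eq_abs, abs_of_nonneg hs.1]
    nlinarith [hPd t, norm_nonneg (deriv P t), hs.1, hs.2]
  have hk : ∀ s ∈ Icc (0 : ℝ) 1, IsKnot (H s) := fun s hs =>
    hf.perturb (hbl 0 (by simp)) (P := fun t => s • P t) ((contDiff_const (c := s)).smul hP)
      (fun t => by simp only [hPp t])
      (fun t => by rw [hd]; exact hbound s hs t) hcm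
  have hpl' : ∀ s ∈ Icc (0 : ℝ) 1, ∀ t, 0 < speedSq (H s) t := fun s hs t => by
    have e : deriv (H s) t = deriv f t + s • deriv P t :=
      ((hasDerivAt_of_smooth hf.smooth t).add ((hasDerivAt_of_smooth hP t).const_smul s)).deriv
    refine lt_of_le_of_ne (by unfold speedSq; positivity) fun h0 => ?_
    set q := s • deriv P t with hq
    have b0 : |q 0| ≤ c := (PiLp.norm_apply_le q 0).trans (hbound s hs t)
    have b1 : |q 1| ≤ c := (PiLp.norm_apply_le q 1).trans (hbound s hs t)
    rw [speedSq, e, PiLp.add_apply, PiLp.add_apply] at h0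
    have z0 : deriv f t 0 = -q 0 := by
      nlinarith [sq_nonneg (deriv f t 0 + q 0), sq_nonneg (deriv f t 1 + q 1)]
    have z1 : deriv f t 1 = -q 1 := by
      nlinarith [sq_nonneg (deriv f t 0 + q 0), sq_nonneg (deriv f t 1 + q 1)]
    have h1 := hμ t
    rw [speedSq, z0, z1, neg_sq, neg_sq, ← sq_abs (q 0), ← sq_abs (q 1)] at h1
    nlinarith [abs_nonneg (q 0), abs_nonneg (q 1)]
  have e1 : H 1 = fun t => f t + P t := funext fun t => by simp [H]
  have e0 : H 0 = f := funext fun t => by simp [H]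
  have h1 := Iso.of_Icc H hH hk
  have h2 := turn_homotopy hH (fun s hs => (hk s hs).periodic) hpl'
  have h3 := hpl' 1 (by simp)
  rw [e0, e1] at h1 h2
  rw [e1] at h3
  exact ⟨h1, h3, h2.symm⟩

/-- A positive second derivative would make the maximum a local minimum too, so the function would
be locally constant. -/
theorem deriv_deriv_nonpos_of_max {h : ℝ → ℝ} (hh : ContDiff ℝ ∞ h) {t₀ : ℝ}
    (hmax : ∀ t, h t ≤ h t₀) : deriv h t₀ = 0 ∧ deriv (deriv h) t₀ ≤ 0 := by
  have hloc : IsLocalMax h t₀ := Eventually.of_forall hmax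
  refine ⟨hloc.deriv_eq_zero, ?_⟩
  by_contra hn
  have hmin := isLocalMin_of_deriv_deriv_pos (not_le.1 hn) hloc.deriv_eq_zero
    hh.continuous.continuousAt
  have he : h =ᶠ[𝓝 t₀] fun _ => h t₀ := by
    filter_upwards [hmin] with t ht using le_antisymm (hmax t) ht
  have := he.deriv.deriv_eq
  simp at this
  exact hn this.le

/-- The squared distance of the planar projection from the origin. -/
def radiusSq (f : ℝ → E3) (t : ℝ) : ℝ := f t 0 ^ 2 + f t 1 ^ 2

theorem contDiff_radiusSq {f : ℝ → E3} (hf : ContDiff ℝ ∞ f) : ContDiff ℝ ∞ (radiusSq f) :=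
  ((contDiff_coord hf 0).pow 2).add ((contDiff_coord hf 1).pow 2)

theorem exists_max_of_periodic {h : ℝ → ℝ} (hc : Continuous h) (hp : Function.Periodic h 1) :
    ∃ t₀, ∀ t, h t ≤ h t₀ := by
  obtain ⟨t₀, -, hmax⟩ := (isCompact_Icc (a := (0 : ℝ)) (b := 1)).exists_isMaxOn
    ⟨0, by simp⟩ hc.continuousOn
  refine ⟨t₀, fun t => ?_⟩
  rw [← periodic_fract hp t]
  exact isMaxOn_iff.1 hmax _ ⟨Int.fract_nonneg t, (Int.fract_lt_one t).le⟩

theorem radiusSq_periodic {f : ℝ → E3} (hf : Function.Periodic f 1) :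
    Function.Periodic (radiusSq f) 1 := fun t => by
  simp only [radiusSq, hf t]

/-- A planar curve is strictly curved at the points farthest from the origin. -/
theorem kappa_ne_zero_of_farthest {f : ℝ → E3} (hf : ContDiff ℝ ∞ f) {t₀ : ℝ}
    (hpl : 0 < speedSq f t₀) (hmax : ∀ t, radiusSq f t ≤ radiusSq f t₀) :
    kappa f t₀ ≠ 0 ∧ 0 < radiusSq f t₀ := by
  have hf' := contDiff_deriv hf
  have d : ∀ (i : Fin 3) t, HasDerivAt (fun t => f t i) (deriv f t i) t := fun i t =>
    hasDerivAt_coord (hasDerivAt_of_smooth hf t) i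
  have d' : ∀ (i : Fin 3) t, HasDerivAt (fun t => deriv f t i) (deriv (deriv f) t i) t :=
    fun i t => hasDerivAt_coord (hasDerivAt_of_smooth hf' t) i
  have e1 : deriv (radiusSq f) = fun t => 2 * (f t 0 * deriv f t 0 + f t 1 * deriv f t 1) :=
    funext fun t => by
      have := (((d 0 t).fun_pow 2).fun_add ((d 1 t).fun_pow 2)).deriv
      refine this.trans ?_
      push_cast
      ring
  have e2 : deriv (deriv (radiusSq f)) t₀ = 2 * (deriv f t₀ 0 ^ 2 + f t₀ 0 * deriv (deriv f) t₀ 0 +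
      (deriv f t₀ 1 ^ 2 + f t₀ 1 * deriv (deriv f) t₀ 1)) := by
    rw [e1]
    have := ((((d 0 t₀).fun_mul (d' 0 t₀)).fun_add ((d 1 t₀).fun_mul (d' 1 t₀))).const_mul 2).deriv
    refine this.trans ?_
    ring
  obtain ⟨h1, h2⟩ := deriv_deriv_nonpos_of_max (contDiff_radiusSq hf) hmax
  rw [e1] at h1
  rw [e2] at h2
  simp only at h1
  rw [speedSq] at hpl
  rw [kappa, radiusSq]
  set x' := deriv f t₀ 0
  set y' := deriv f t₀ 1
  set x'' := deriv (deriv f) t₀ 0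
  set y'' := deriv (deriv f) t₀ 1
  set a := f t₀ 0
  set b := f t₀ 1
  -- Position is orthogonal to velocity, and its inner product with the acceleration is strictly
  -- negative. With zero curvature the acceleration would be parallel to the velocity, hence
  -- orthogonal to the position.
  have h3 : a * x' + b * y' = 0 := by linarith
  constructor
  · intro h0
    have hx : (a * x'' + b * y'') * x' = 0 := by linear_combination b * h0 + x'' * h3
    have hy : (a * x'' + b * y'') * y' = 0 := by linear_combination y'' * h3 - a * h0
    have h4 : a * x'' + b * y'' ≠ 0 := fun h => by nlinarith
    have hx' := (mul_eq_zero.1 hx).resolve_left h4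
    have hy' := (mul_eq_zero.1 hy).resolve_left h4
    rw [hx', hy'] at hpl
    norm_num at hpl
  · refine lt_of_le_of_ne (by positivity) fun h0 => ?_
    have ha : a = 0 := by nlinarith [sq_nonneg a, sq_nonneg b]
    have hb : b = 0 := by nlinarith [sq_nonneg a, sq_nonneg b]
    rw [ha, hb] at h2
    linarith

/-- A function of `(η, t)` positive for `η = 0` on a compact interval stays so for small `η`. -/
theorem eventually_pos_of_continuous {F : ℝ × ℝ → ℝ} (hF : Continuous F) {a b : ℝ}
    (h : ∀ t ∈ Icc a b, 0 < F (0, t)) : ∀ᶠ η in 𝓝 (0 : ℝ), ∀ t ∈ Icc a b, 0 < F (η, t) := by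
  refine isCompact_Icc.eventually_forall_of_forall_eventually fun t ht => ?_
  exact hF.continuousAt.eventually_const_lt (h t ht)

theorem exists_int_of_cutoff_ne_zero {a δ t : ℝ} (hδ : 0 < δ) (h : cutoff a δ t ≠ 0) :
    ∃ n : ℤ, |t - n - a| < δ := by
  obtain ⟨n, hn⟩ := exists_int_abs_sub_le t a
  refine ⟨n, ?_⟩
  by_contra hc
  refine h (cutoff_eq_zero hδ ?_)
  have h1 := two_mul_abs_le_abs_sin hn
  rw [sub_right_comm, abs_sin_pi_sub_int, sub_right_comm] at h1
  rw [← sq_abs (Real.sin _)]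
  nlinarith [not_lt.1 hc]

/-- The direction (u, v) is the planar velocity at the farthest point. Progress in it, an open
condition that survives small bumps, makes the projection injective on the short arc. -/
theorem Spiral.exists_farthest {f : ℝ → E3} (h : Spiral f) : ∃ t₀ δ u v : ℝ, 0 < δ ∧
    (∀ t, radiusSq f t ≤ radiusSq f t₀) ∧ 0 < radiusSq f t₀ ∧
    ∀ t ∈ Icc (t₀ - δ) (t₀ + δ), 0 < kappa f t ∧ 0 < u * deriv f t 0 + v * deriv f t 1 := by
  have hs := h.isKnot.smooth
  obtain ⟨t₀, ht₀⟩ := exists_max_of_periodic (contDiff_radiusSq hs).continuous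
    (radiusSq_periodic h.isKnot.periodic)
  obtain ⟨hk0, hR⟩ := kappa_ne_zero_of_farthest hs (h.planar t₀) ht₀
  have hκ : 0 < kappa f t₀ := lt_of_le_of_ne (h.curv t₀) hk0.symm
  obtain ⟨u, v, huv⟩ : ∃ u v, 0 < u * deriv f t₀ 0 + v * deriv f t₀ 1 := by
    refine ⟨deriv f t₀ 0, deriv f t₀ 1, ?_⟩
    have := h.planar t₀
    rw [speedSq] at this
    linarith
  have hcd : Continuous fun t => u * deriv f t 0 + v * deriv f t 1 :=
    ((contDiff_coord (contDiff_deriv hs) 0).continuous.const_mul u).add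
      ((contDiff_coord (contDiff_deriv hs) 1).continuous.const_mul v)
  have hev : ∀ᶠ t in 𝓝 t₀, 0 < kappa f t ∧ 0 < u * deriv f t 0 + v * deriv f t 1 :=
    ((contDiff_kappa hs).continuous.continuousAt.eventually_const_lt hκ).and
      (hcd.continuousAt.eventually_const_lt huv)
  obtain ⟨δ, hδ, hball⟩ := Metric.eventually_nhds_iff_ball.1 hev
  refine ⟨t₀, δ / 2, u, v, half_pos hδ, ht₀, hR, fun t ht => hball t ?_⟩
  rw [Metric.mem_ball, Real.dist_eq, abs_lt]
  constructor <;> linarith [ht.1, ht.2]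

theorem exists_int_of_sin_sq_le {a δ t : ℝ} (hδ : 0 ≤ δ)
    (h : Real.sin (Real.pi * (t - a)) ^ 2 ≤ 2 * δ ^ 2) : ∃ n : ℤ, |t - n - a| ≤ δ := by
  obtain ⟨n, hn⟩ := exists_int_abs_sub_le t a
  refine ⟨n, ?_⟩
  have h1 := two_mul_abs_le_abs_sin hn
  rw [sub_right_comm, abs_sin_pi_sub_int, sub_right_comm] at h1
  rw [← sq_abs (Real.sin _)] at h
  nlinarith [abs_nonneg (t - n - a), abs_nonneg (Real.sin (Real.pi * (t - a)))]

theorem periodic_sub_int {F : Type*} {f : ℝ → F} (hf : Function.Periodic f 1) (t : ℝ) (n : ℤ) :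
    f (t - n) = f t := by
  have := periodic_add_int hf t (-n)
  push_cast at this
  rwa [← sub_eq_add_neg] at this

/-- A small bump on a strictly curved arc keeps a spiral a spiral. -/
theorem Spiral.exists_bump {f : ℝ → E3} (h : Spiral f) {t₀ δ u v : ℝ} (hδ : 0 < δ)
    (hin : ∀ t ∈ Icc (t₀ - δ) (t₀ + δ), 0 < kappa f t ∧ 0 < u * deriv f t 0 + v * deriv f t 1)
    (w : E3) : ∃ η > 0, ∃ g : ℝ → E3, (∀ t, g t = f t + (η * cutoff t₀ δ t) • w) ∧ Iso f g ∧
      Spiral g ∧ turn g = turn f ∧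
      ∀ t ∈ Icc (t₀ - δ) (t₀ + δ), 0 < kappa g t ∧ 0 < u * deriv g t 0 + v * deriv g t 1 := by
  have hs := h.isKnot.smooth
  let H : ℝ → ℝ → E3 := fun η t => f t + (η * cutoff t₀ δ t) • w
  have hH : ContDiff ℝ ∞ fun p : ℝ × ℝ => H p.1 p.2 :=
    (hs.comp contDiff_snd).add ((contDiff_fst.mul ((contDiff_cutoff t₀ δ).comp contDiff_snd)).smul
      contDiff_const)
  have hH0 : H 0 = f := funext fun t => by simp [H]
  have hHd := contDiff_deriv_right hH
  have ev1 := eventually_pos_of_continuous (contDiff_kappa_family hH).continuous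
    (a := t₀ - δ) (b := t₀ + δ) (fun t ht => by simp only [hH0]; exact (hin t ht).1)
  have ev2 := eventually_pos_of_continuous
    (F := fun p : ℝ × ℝ => u * deriv (H p.1) p.2 0 + v * deriv (H p.1) p.2 1)
    (((contDiff_coord hHd 0).continuous.const_mul u).add
      ((contDiff_coord hHd 1).continuous.const_mul v))
    (a := t₀ - δ) (b := t₀ + δ) (fun t ht => by simp only [hH0]; exact (hin t ht).2)
  obtain ⟨m, hm, hpert⟩ := exists_perturb h.isKnot h.planar
  have hQ : ∀ η : ℝ, ContDiff ℝ ∞ fun t => (η * cutoff t₀ δ t) • w := fun η =>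
    ((contDiff_const (c := η)).mul (contDiff_cutoff _ _)).smul contDiff_const
  have hQp : ∀ η : ℝ, Function.Periodic (fun t => (η * cutoff t₀ δ t) • w) 1 := fun η t => by
    simp only [cutoff_periodic t₀ δ t]
  obtain ⟨C, hC⟩ := (isCompact_Icc (a := (0 : ℝ)) (b := 1)).exists_bound_of_continuousOn
    (contDiff_deriv (hQ 1)).continuous.continuousOn
  have hC' : ∀ t, ‖deriv (fun t => (1 * cutoff t₀ δ t) • w) t‖ ≤ C := fun t => by
    rw [← periodic_fract (deriv_periodic (hQp 1)) t]
    exact hC _ ⟨Int.fract_nonneg t, (Int.fract_lt_one t).le⟩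
  have ev3 : ∀ᶠ η : ℝ in 𝓝 0, η * C < m := by
    have : ContinuousAt (fun η : ℝ => η * C) 0 := by fun_prop
    exact this.eventually_lt_const (by simpa using hm)
  obtain ⟨η, ⟨⟨h1, h2⟩, h3⟩, hη⟩ := ((((ev1.and ev2).and ev3).filter_mono nhdsWithin_le_nhds).and
    (self_mem_nhdsWithin (s := Ioi (0 : ℝ)))).exists
  have hη : 0 < η := hη
  obtain ⟨hiso, hpl, hturn⟩ := hpert _ (hQ η) (hQp η) (fun t => by
    have e : (fun t => (η * cutoff t₀ δ t) • w) = fun t => η • (1 * cutoff t₀ δ t) • w :=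
      funext fun t => by rw [one_mul, mul_smul]
    rw [e, ((hasDerivAt_of_smooth (hQ 1) t).fun_const_smul η).deriv, norm_smul, Real.norm_eq_abs,
      abs_of_pos hη]
    have := mul_le_mul_of_nonneg_left (hC' t) hη.le
    linarith)
  refine ⟨η, hη, H η, fun t => rfl, hiso, ⟨hiso.right, hpl, fun t => ?_⟩, hturn,
    fun t ht => ⟨h1 t ht, h2 t ht⟩⟩
  -- Off the support of the bump nothing changes; on it the strict positivity of the curvature
  -- persists for small η by compactness.
  rcases lt_or_ge (2 * δ ^ 2) (Real.sin (Real.pi * (t - t₀)) ^ 2) with hlt | hge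
  · have : H η =ᶠ[𝓝 t] f := by
      filter_upwards [cutoff_eventuallyEq_zero hδ hlt] with x hx
      simp [H, hx]
    rw [kappa, this.deriv_eq, this.deriv.deriv_eq]
    exact h.curv t
  · obtain ⟨n, hn⟩ := exists_int_of_sin_sq_le hδ.le hge
    have hper : Function.Periodic (H η) 1 := hiso.right.periodic
    rw [abs_le] at hn
    rw [← periodic_sub_int (kappa_periodic hper) t n]
    exact (h1 _ ⟨by linarith, by linarith⟩).le

/-- Every spiral knot is isotopic to one whose projection has an outermost point that is passed
once, with positive curvature. -/
theorem Spiral.exists_tip {f : ℝ → E3} (h : Spiral f) : ∃ g, Iso f g ∧ Spiral g ∧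
    turn g = turn f ∧ ∃ t₁ p q : ℝ, 0 < kappa g t₁ ∧
      ∀ t, (∀ n : ℤ, t ≠ t₁ + n) → p * g t 0 + q * g t 1 < p * g t₁ 0 + q * g t₁ 1 := by
  obtain ⟨t₀, δ, u, v, hδ, ht₀, hR, hin⟩ := h.exists_farthest
  -- The bump pushes radially outwards, so that the point at `t₀` lies beyond every point off the
  -- bump: all farthest points of the new curve are on the bumped arc, where the projection is
  -- injective.
  obtain ⟨η, hη, g, hg, hiso, hsp, hturn, hin'⟩ := h.exists_bump hδ hin !₂[f t₀ 0, f t₀ 1, 0]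
  have hgs := hsp.isKnot.smooth
  have hgp := hsp.isKnot.periodic
  have c0 : ∀ t, g t 0 = f t 0 + η * cutoff t₀ δ t * f t₀ 0 := fun t => by simp [hg]
  have c1 : ∀ t, g t 1 = f t 1 + η * cutoff t₀ δ t * f t₀ 1 := fun t => by simp [hg]
  have hsupp : ∀ t, radiusSq f t₀ < radiusSq g t → ∃ n : ℤ, |t - n - t₀| < δ := fun t ht => by
    refine exists_int_of_cutoff_ne_zero hδ fun h0 => ?_
    have := ht₀ t
    simp only [radiusSq, c0, c1, h0, zero_mul, mul_zero, add_zero] at ht this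
    exact absurd ht (not_lt.2 this)
  obtain ⟨t₂, ht₂⟩ := exists_max_of_periodic (contDiff_radiusSq hgs).continuous
    (radiusSq_periodic hgp)
  have hbig : radiusSq f t₀ < radiusSq g t₂ := by
    refine lt_of_lt_of_le ?_ (ht₂ t₀)
    have e : cutoff t₀ δ t₀ = 1 := cutoff_eq_one hδ (by simp; positivity)
    have e2 : radiusSq g t₀ = (1 + η) ^ 2 * radiusSq f t₀ := by
      rw [radiusSq, radiusSq, c0, c1, e]
      ring
    rw [e2]
    nlinarith [mul_pos hη hR, mul_pos (mul_pos hη hη) hR]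
  obtain ⟨n₁, hn₁⟩ := hsupp t₂ hbig
  obtain ⟨t₁, ht₁⟩ : ∃ t₁, t₁ = t₂ - n₁ := ⟨_, rfl⟩
  have er : radiusSq g t₁ = radiusSq g t₂ := by
    rw [ht₁]; exact periodic_sub_int (radiusSq_periodic hgp) t₂ n₁
  rw [← ht₁, abs_lt] at hn₁
  have hmono : StrictMonoOn (fun t => u * g t 0 + v * g t 1) (Icc (t₀ - δ) (t₀ + δ)) := by
    have hd : ∀ t, HasDerivAt (fun t => u * g t 0 + v * g t 1)
        (u * deriv g t 0 + v * deriv g t 1) t := fun t =>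
      ((hasDerivAt_coord (hasDerivAt_of_smooth hgs t) 0).const_mul u).add
        ((hasDerivAt_coord (hasDerivAt_of_smooth hgs t) 1).const_mul v)
    refine strictMonoOn_of_deriv_pos (convex_Icc _ _)
      (fun t _ => (hd t).continuousAt.continuousWithinAt) fun t ht => ?_
    rw [interior_Icc] at ht
    rw [(hd t).deriv]
    exact (hin' t ⟨ht.1.le, ht.2.le⟩).2
  have hmem : t₁ ∈ Icc (t₀ - δ) (t₀ + δ) := ⟨by linarith [hn₁.1], by linarith [hn₁.2]⟩
  -- The height function is taken in the direction of the farthest point itself. A point at least as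
  -- high and no farther from the origin has the same projection, so it belongs to the same time
  -- modulo 1.
  refine ⟨g, hiso, hsp, hturn, t₁, g t₁ 0, g t₁ 1, (hin' t₁ hmem).1, fun t ht => ?_⟩
  by_contra hcon
  have hle := ht₂ t
  rw [← er] at hle
  have hz : (g t 0 - g t₁ 0) ^ 2 + (g t 1 - g t₁ 1) ^ 2 ≤ 0 := by
    rw [radiusSq, radiusSq] at hle
    linarith
  have z0 : g t 0 = g t₁ 0 := sub_eq_zero.1 (pow_eq_zero_iff two_ne_zero |>.1
    (by linarith [sq_nonneg (g t 0 - g t₁ 0), sq_nonneg (g t 1 - g t₁ 1)]))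
  have z1 : g t 1 = g t₁ 1 := sub_eq_zero.1 (pow_eq_zero_iff two_ne_zero |>.1
    (by linarith [sq_nonneg (g t 0 - g t₁ 0), sq_nonneg (g t 1 - g t₁ 1)]))
  obtain ⟨n, hn⟩ := hsupp t (by
    have : radiusSq g t = radiusSq g t₁ := by rw [radiusSq, radiusSq, z0, z1]
    rw [this, er]; exact hbig)
  have eg := periodic_sub_int hgp t n
  rw [abs_lt] at hn
  have := hmono.injOn (x₁ := t - n) (x₂ := t₁) ⟨by linarith [hn.1], by linarith [hn.2]⟩
    hmem (by simp only [eg, z0, z1])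
  exact ht n (by linarith)

/-! ### Replacing the tip by an arc of the unit circle. -/

/-- At a maximum the height has zero first and nonpositive second derivative. The product of this
second derivative with the tangential speed is -(p² + q²) times the curvature, so both are nonzero
with the stated signs. -/
theorem tip_derivs {f : ℝ → E3} (hs : ContDiff ℝ ∞ f) (hp : Function.Periodic f 1) {t₁ p q : ℝ}
    (hκ : 0 < kappa f t₁)
    (hm : ∀ t, (∀ n : ℤ, t ≠ t₁ + n) → p * f t 0 + q * f t 1 < p * f t₁ 0 + q * f t₁ 1) :
    0 < p ^ 2 + q ^ 2 ∧ p * deriv f t₁ 0 + q * deriv f t₁ 1 = 0 ∧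
    p * deriv (deriv f) t₁ 0 + q * deriv (deriv f) t₁ 1 < 0 ∧
    0 < -q * deriv f t₁ 0 + p * deriv f t₁ 1 := by
  have hd : ∀ (f : ℝ → E3) (_ : ContDiff ℝ ∞ f), deriv (fun t => p * f t 0 + q * f t 1) =
      fun t => p * deriv f t 0 + q * deriv f t 1 := fun f hs => funext fun t =>
    (((hasDerivAt_coord (hasDerivAt_of_smooth hs t) 0).const_mul p).add
      ((hasDerivAt_coord (hasDerivAt_of_smooth hs t) 1).const_mul q)).deriv
  have hsm : ContDiff ℝ ∞ fun t => p * f t 0 + q * f t 1 :=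
    ((contDiff_const (c := p)).mul (contDiff_coord hs 0)).add
      ((contDiff_const (c := q)).mul (contDiff_coord hs 1))
  have hmax : ∀ t, p * f t 0 + q * f t 1 ≤ p * f t₁ 0 + q * f t₁ 1 := fun t => by
    by_cases h : ∀ n : ℤ, t ≠ t₁ + n
    · exact (hm t h).le
    · push Not at h
      obtain ⟨n, rfl⟩ := h
      rw [periodic_add_int hp]
  obtain ⟨h1, h2⟩ := deriv_deriv_nonpos_of_max hsm hmax
  rw [hd f hs] at h1 h2
  rw [hd _ (contDiff_deriv hs)] at h2
  simp only at h1
  have hpq : 0 < p ^ 2 + q ^ 2 := by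
    refine lt_of_le_of_ne (by positivity) fun h0 => ?_
    have hp0 : p = 0 := by nlinarith [sq_nonneg p, sq_nonneg q]
    have hq0 : q = 0 := by nlinarith [sq_nonneg p, sq_nonneg q]
    have := hm (t₁ + 1 / 2) fun n hn => by
      have h3 : (2 * n : ℝ) = 1 := by linarith
      have h4 : 2 * n = 1 := by exact_mod_cast h3
      omega
    simp [hp0, hq0] at this
  have key : -((p * deriv (deriv f) t₁ 0 + q * deriv (deriv f) t₁ 1) *
      (-q * deriv f t₁ 0 + p * deriv f t₁ 1)) = (p ^ 2 + q ^ 2) * kappa f t₁ := by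
    rw [kappa]
    linear_combination (q * deriv (deriv f) t₁ 0 - p * deriv (deriv f) t₁ 1) * h1
  have hpos := mul_pos hpq hκ
  rw [← key] at hpos
  have h3 : p * deriv (deriv f) t₁ 0 + q * deriv (deriv f) t₁ 1 < 0 :=
    lt_of_le_of_ne h2 fun h0 => by rw [h0] at hpos; simp at hpos
  exact ⟨hpq, h1, h3, by nlinarith⟩

theorem unitCircle_tip : unitCircle (3 / 4) = !₂[1, 0, 0] ∧
    deriv unitCircle (3 / 4) = !₂[0, 2 * Real.pi, 0] := by
  have e : 2 * Real.pi * (3 / 4) = Real.pi / 2 + Real.pi := by ring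
  have hs : Real.sin (2 * Real.pi * (3 / 4)) = -1 := by
    rw [e, Real.sin_add_pi, Real.sin_pi_div_two]
  have hc : Real.cos (2 * Real.pi * (3 / 4)) = 0 := by
    rw [e, Real.cos_add_pi, Real.cos_pi_div_two, neg_zero]
  constructor
  · refine E3_ext ?_ ?_ ?_ <;> simp [unitCircle, hs, hc]
  · refine E3_ext ?_ ?_ ?_
    · rw [deriv_unitCircle_zero]; simp [hc]
    · rw [deriv_unitCircle_one]; simp [hs]
    · rw [deriv_unitCircle_two]; simp

/-- Every spiral knot is isotopic to one that touches the line `x = 1` only at time `3/4`, where it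
has the same tangent and the same horizontal acceleration as the unit circle. -/
theorem Spiral.exists_normal {f : ℝ → E3} (h : Spiral f) : ∃ g, Iso f g ∧ Spiral g ∧
    turn g = turn f ∧ g (3 / 4) = unitCircle (3 / 4) ∧
    deriv g (3 / 4) = deriv unitCircle (3 / 4) ∧ deriv (deriv g) (3 / 4) 0 = -4 * Real.pi ^ 2 ∧
    ∀ t : ℝ, (∀ n : ℤ, t ≠ 3 / 4 + n) → g t 0 < 1 := by
  have hpi := Real.pi_pos
  obtain ⟨f₁, i₁, s₁, e₁, t₁, p, q, hκ, hm⟩ := h.exists_tip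
  obtain ⟨hpq, hX, ha, hd⟩ := tip_derivs s₁.isKnot.smooth s₁.isKnot.periodic hκ hm
  obtain ⟨f₂, hf₂⟩ : ∃ f₂, f₂ = fun t => f₁ (t + (t₁ - 3 / 4)) := ⟨_, rfl⟩
  have i₂ : Iso f₁ f₂ := hf₂ ▸ Iso.shift s₁.isKnot _
  have s₂ : Spiral f₂ := hf₂ ▸ s₁.shift _
  have e₂ : turn f₂ = turn f₁ := hf₂ ▸ turn_shift s₁.isKnot.periodic _
  have v0 : f₂ (3 / 4) = f₁ t₁ := by simp only [hf₂, add_sub_cancel]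
  have v1 : deriv f₂ (3 / 4) = deriv f₁ t₁ := by
    rw [hf₂, deriv_comp_add_const]; congr 1; ring
  have v2 : deriv (deriv f₂) (3 / 4) = deriv (deriv f₁) t₁ := by
    have : deriv f₂ = fun t => deriv f₁ (t + (t₁ - 3 / 4)) :=
      funext fun t => by rw [hf₂, deriv_comp_add_const]
    rw [this, deriv_comp_add_const]; congr 1; ring
  have hm₂ : ∀ t : ℝ, (∀ n : ℤ, t ≠ 3 / 4 + n) →
      p * f₂ t 0 + q * f₂ t 1 < p * f₂ (3 / 4) 0 + q * f₂ (3 / 4) 1 := fun t ht => by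
    rw [v0, hf₂]
    refine hm _ fun n hn => ht n ?_
    linarith
  rw [← v1] at hX hd
  rw [← v2] at ha
  clear v0 v1 v2 hf₂
  obtain ⟨a, ea⟩ : ∃ a, a = p * deriv (deriv f₂) (3 / 4) 0 + q * deriv (deriv f₂) (3 / 4) 1 :=
    ⟨_, rfl⟩
  obtain ⟨d, ed⟩ : ∃ d, d = -q * deriv f₂ (3 / 4) 0 + p * deriv f₂ (3 / 4) 1 := ⟨_, rfl⟩
  obtain ⟨z, ez⟩ : ∃ z, z = deriv f₂ (3 / 4) 2 := ⟨_, rfl⟩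
  rw [← ea] at ha
  rw [← ed] at hd
  have hα : 0 < -4 * Real.pi ^ 2 / a := div_pos_of_neg_of_neg (by nlinarith [pow_pos hpi 2]) ha
  have hβ : 0 < 2 * Real.pi / d := by positivity
  have hαa : -4 * Real.pi ^ 2 / a * a = -4 * Real.pi ^ 2 := div_mul_cancel₀ _ ha.ne
  have hβd : 2 * Real.pi / d * d = 2 * Real.pi := div_mul_cancel₀ _ hd.ne'
  have hγd : z / d * d = z := div_mul_cancel₀ _ hd.ne'
  obtain ⟨α, eα⟩ : ∃ α, α = -4 * Real.pi ^ 2 / a := ⟨_, rfl⟩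
  obtain ⟨β, eβ⟩ : ∃ β, β = 2 * Real.pi / d := ⟨_, rfl⟩
  obtain ⟨γ, eγ⟩ : ∃ γ, γ = z / d := ⟨_, rfl⟩
  rw [← eα] at hα hαa
  rw [← eβ] at hβ hβd
  rw [← eγ] at hγd
  -- The rows are the outward normal scaled to give acceleration -4π², the tangent scaled to give
  -- speed 2π, and a shear of the vertical axis that removes the vertical velocity.
  let M : Matrix (Fin 3) (Fin 3) ℝ := !![α * p, α * q, 0; -(β * q), β * p, 0; γ * q, -(γ * p), 1]
  let X := p * f₂ (3 / 4) 0 + q * f₂ (3 / 4) 1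
  let Y := -q * f₂ (3 / 4) 0 + p * f₂ (3 / 4) 1
  let b : E3 := !₂[1 - α * X, -(β * Y), γ * Y - f₂ (3 / 4) 2]
  have hM2 : 0 < M 0 0 * M 1 1 - M 0 1 * M 1 0 := by
    have : M 0 0 * M 1 1 - M 0 1 * M 1 0 = α * β * (p ^ 2 + q ^ 2) := by simp [M]; ring
    rw [this]
    positivity
  have hdet : 0 < M.det := by
    rw [det_of_planar (by simp [M]) (by simp [M])]
    simpa [M] using hM2
  have haff := s₂.affine (M := M) (by simp [M]) (by simp [M]) hM2 (by simp [M]) b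
  obtain ⟨u0, u1⟩ := unitCircle_tip
  refine ⟨fun t => act M (f₂ t) + b, (i₁.trans i₂).trans (Iso.affine s₂.isKnot hdet b), haff.1,
    haff.2.trans (e₂.trans e₁), ?_, ?_, ?_, fun t ht => ?_⟩
  · rw [u0]
    refine E3_ext ?_ ?_ ?_ <;> simp [act_apply, M, b, X, Y] <;> ring
  · rw [u1, deriv_act_add s₂.isKnot.smooth]
    refine E3_ext ?_ ?_ ?_ <;> simp [act_apply, M]
    · linear_combination α * hX
    · rw [ed] at hβd; linear_combination hβd
    · rw [ed] at hγd; linear_combination -hγd - ez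
  · rw [deriv_deriv_act_add s₂.isKnot.smooth]
    simp [act_apply, M]
    rw [ea] at hαa
    linear_combination hαa
  · have := mul_lt_mul_of_pos_left (hm₂ t ht) hα
    simp [act_apply, M, b, X]
    linarith

theorem exists_bound_of_periodic {F : Type*} [NormedAddCommGroup F] {f : ℝ → F}
    (hf : Continuous f) (hp : Function.Periodic f 1) : ∃ C > 0, ∀ t, ‖f t‖ ≤ C := by
  obtain ⟨C, hC⟩ := (isCompact_Icc (a := (0 : ℝ)) (b := 1)).exists_bound_of_continuousOn
    hf.continuousOn
  refine ⟨max C 1, by positivity, fun t => ?_⟩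
  rw [← periodic_fract hp t]
  exact (hC _ ⟨Int.fract_nonneg t, (Int.fract_lt_one t).le⟩).trans (le_max_left _ _)

/-- One integration gains one power. For a periodic function |sin π(t - a)| replaces |t - a| and
makes the bound valid on the whole line. -/
theorem exists_sin_bound_of_deriv {f : ℝ → ℝ} (hf : ContDiff ℝ ∞ f) (hp : Function.Periodic f 1)
    {a : ℝ} (h0 : f a = 0) {n : ℕ}
    (h : ∃ C > 0, ∀ t, ‖deriv f t‖ ≤ C * |Real.sin (Real.pi * (t - a))| ^ n) :
    ∃ C > 0, ∀ t, ‖f t‖ ≤ C * |Real.sin (Real.pi * (t - a))| ^ (n + 1) := by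
  obtain ⟨C, hC, hb⟩ := h
  have hpi := Real.pi_pos
  have key := norm_le_pow_of_deriv (n := n) hf (by positivity : 0 ≤ C * Real.pi ^ n) h0
    fun t _ => (hb t).trans (by
      rw [mul_assoc, ← mul_pow]
      gcongr
      refine (Real.abs_sin_le_abs (x := Real.pi * (t - a))).trans ?_
      rw [abs_mul, abs_of_pos hpi])
  refine ⟨C * Real.pi ^ n, by positivity, fun t => ?_⟩
  obtain ⟨m, hm⟩ := exists_int_abs_sub_le t a
  rw [← periodic_sub_int hp t m]
  have e2 : |Real.sin (Real.pi * (t - a))| = |Real.sin (Real.pi * (t - m - a))| := by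
    rw [← abs_sin_pi_sub_int (t - a) m, sub_right_comm]
  rw [e2]
  refine (key _ hm).trans ?_
  have hle : |t - m - a| ≤ |Real.sin (Real.pi * (t - m - a))| := by
    linarith [two_mul_abs_le_abs_sin hm, abs_nonneg (t - m - a)]
  gcongr

/-- Derivative bounds for `(1 - χ) D`, where `χ` is a cutoff at scale `ε`. -/
theorem cutoff_compl_bound {D : ℝ → ℝ} (hD : ContDiff ℝ ∞ D) {a ε B M t : ℝ} (hε : 0 < ε)
    (hc1 : |deriv (cutoff a ε) t| ≤ B / ε)
    (hc2 : |deriv (deriv (cutoff a ε)) t| ≤ B / ε ^ 2) (h0 : |D t| ≤ M * ε ^ 2)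
    (h1 : |deriv D t| ≤ M * ε) (h2 : |deriv (deriv D) t| ≤ M) :
    |deriv (fun t => (1 - cutoff a ε t) * D t) t| ≤ M * ε * (1 + B) ∧
    |deriv (deriv (fun t => (1 - cutoff a ε t) * D t)) t| ≤ M * (1 + 3 * B) := by
  have hc := contDiff_cutoff a ε
  have hM : 0 ≤ M := (abs_nonneg _).trans h2
  have hB : 0 ≤ B := by
    have := (abs_nonneg _).trans hc1
    exact (div_nonneg_iff.1 this).elim (fun h => h.1) fun h => absurd hε (not_lt.2 h.2)
  have e1 : deriv (fun t => (1 - cutoff a ε t) * D t) = fun t =>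
      (1 - cutoff a ε t) * deriv D t - deriv (cutoff a ε) t * D t := funext fun t => by
    rw [(((hasDerivAt_of_smooth hc t).const_sub 1).fun_mul (hasDerivAt_of_smooth hD t)).deriv]
    ring
  have e2 : deriv (deriv (fun t => (1 - cutoff a ε t) * D t)) t =
      (1 - cutoff a ε t) * deriv (deriv D) t - 2 * (deriv (cutoff a ε) t * deriv D t) -
      deriv (deriv (cutoff a ε)) t * D t := by
    have hc' := contDiff_deriv hc
    have hD' := contDiff_deriv hD
    rw [e1, ((((hasDerivAt_of_smooth hc t).const_sub 1).fun_mul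
      (hasDerivAt_of_smooth hD' t)).fun_sub
      ((hasDerivAt_of_smooth hc' t).fun_mul (hasDerivAt_of_smooth hD t))).deriv]
    ring
  have hχ : |1 - cutoff a ε t| ≤ 1 := by
    have := cutoff_mem a ε t
    rw [abs_le]
    constructor <;> linarith [this.1, this.2]
  have m0 : |(1 - cutoff a ε t) * deriv D t| ≤ 1 * (M * ε) := by
    rw [abs_mul]
    exact mul_le_mul hχ h1 (abs_nonneg _) zero_le_one
  have m1 : |deriv (cutoff a ε) t * D t| ≤ M * ε * B := by
    rw [abs_mul]
    refine (mul_le_mul hc1 h0 (abs_nonneg _) (by positivity)).trans (le_of_eq ?_)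
    field_simp
  have m2 : |(1 - cutoff a ε t) * deriv (deriv D) t| ≤ 1 * M := by
    rw [abs_mul]
    exact mul_le_mul hχ h2 (abs_nonneg _) zero_le_one
  have m3 : |deriv (cutoff a ε) t * deriv D t| ≤ M * B := by
    rw [abs_mul]
    refine (mul_le_mul hc1 h1 (abs_nonneg _) (by positivity)).trans (le_of_eq ?_)
    field_simp
  have m4 : |deriv (deriv (cutoff a ε)) t * D t| ≤ M * B := by
    rw [abs_mul]
    refine (mul_le_mul hc2 h0 (abs_nonneg _) (by positivity)).trans (le_of_eq ?_)
    field_simp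
  rw [e2, e1]
  simp only
  rw [abs_le] at *
  rw [abs_le]
  constructor <;> constructor <;> linarith

theorem hasDerivAt_two_pi_mul (t : ℝ) : HasDerivAt (fun t => 2 * Real.pi * t) (2 * Real.pi) t := by
  simpa using (hasDerivAt_id t).const_mul (2 * Real.pi)

theorem deriv_deriv_unitCircle_zero (t : ℝ) :
    deriv (deriv unitCircle) t 0 = 4 * Real.pi ^ 2 * Real.sin (2 * Real.pi * t) := by
  rw [← deriv_coord (contDiff_deriv contDiff_unitCircle), funext deriv_unitCircle_zero,
    ((hasDerivAt_two_pi_mul t).cos.const_mul (2 * Real.pi)).fun_neg.deriv]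
  ring

theorem deriv_deriv_unitCircle_one (t : ℝ) :
    deriv (deriv unitCircle) t 1 = -(4 * Real.pi ^ 2 * Real.cos (2 * Real.pi * t)) := by
  rw [← deriv_coord (contDiff_deriv contDiff_unitCircle), funext deriv_unitCircle_one,
    ((hasDerivAt_two_pi_mul t).sin.const_mul (2 * Real.pi)).fun_neg.deriv]
  ring

theorem unitCircle_near_tip (t : ℝ) :
    unitCircle t 0 = 1 - 2 * Real.sin (Real.pi * (t - 3 / 4)) ^ 2 ∧
    |deriv unitCircle t 0| ≤ 4 * Real.pi * |Real.sin (Real.pi * (t - 3 / 4))| ∧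
    deriv unitCircle t 1 = 2 * Real.pi * (1 - 2 * Real.sin (Real.pi * (t - 3 / 4)) ^ 2) ∧
    deriv (deriv unitCircle) t 0 =
      -(4 * Real.pi ^ 2 * (1 - 2 * Real.sin (Real.pi * (t - 3 / 4)) ^ 2)) ∧
    |deriv (deriv unitCircle) t 1| ≤ 8 * Real.pi ^ 2 * |Real.sin (Real.pi * (t - 3 / 4))| := by
  have hpi := Real.pi_pos
  have e : 2 * Real.pi * t = 2 * (Real.pi * (t - 3 / 4)) + Real.pi / 2 + Real.pi := by ring
  have hs : Real.sin (2 * Real.pi * t) = -(1 - 2 * Real.sin (Real.pi * (t - 3 / 4)) ^ 2) := by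
    rw [e, Real.sin_add_pi, Real.sin_add_pi_div_two, Real.cos_two_mul]
    linarith [Real.sin_sq_add_cos_sq (Real.pi * (t - 3 / 4))]
  have hc : Real.cos (2 * Real.pi * t) =
      2 * Real.sin (Real.pi * (t - 3 / 4)) * Real.cos (Real.pi * (t - 3 / 4)) := by
    rw [e, Real.cos_add_pi, Real.cos_add_pi_div_two, Real.sin_two_mul, neg_neg]
  have hc' : |Real.cos (2 * Real.pi * t)| ≤ 2 * |Real.sin (Real.pi * (t - 3 / 4))| := by
    rw [hc, abs_mul, abs_mul, abs_two]
    exact mul_le_of_le_one_right (by positivity) (Real.abs_cos_le_one _)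
  refine ⟨?_, ?_, ?_, ?_, ?_⟩
  · rw [unitCircle_zero, hs, neg_neg]
  · rw [deriv_unitCircle_zero, abs_neg, abs_mul, abs_of_pos (by positivity : 0 < 2 * Real.pi)]
    nlinarith
  · rw [deriv_unitCircle_one, hs]
    ring
  · rw [deriv_deriv_unitCircle_zero, hs]
    ring
  · rw [deriv_deriv_unitCircle_one, abs_neg, abs_mul, abs_of_pos (by positivity : 0 < 4 * Real.pi ^ 2)]
    nlinarith [pow_pos hpi 2]

/-- The arithmetic behind the curvature estimate for a small modification of the unit circle. -/
theorem curvature_estimate {u0' u1' u0'' u1'' e0' e1' e0'' e1'' K ε σ : ℝ} (hK : 0 ≤ K)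
    (hε : 0 < ε) (hsmall : ε * ((32 + K) * (256 + K)) ≤ 1) (hσ : σ ^ 2 ≤ 2 * ε ^ 2)
    (h0' : |u0'| ≤ 4 * Real.pi * |σ|) (h1' : u1' = 2 * Real.pi * (1 - 2 * σ ^ 2))
    (h0'' : u0'' = -(4 * Real.pi ^ 2 * (1 - 2 * σ ^ 2))) (h1'' : |u1''| ≤ 8 * Real.pi ^ 2 * |σ|)
    (b0' : |e0'| ≤ K * ε) (b1' : |e1'| ≤ K * ε) (b0'' : |e0''| ≤ K * ε) (b1'' : |e1''| ≤ K) :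
    0 ≤ (u0' - e0') * (u1'' - e1'') - (u0'' - e0'') * (u1' - e1') := by
  have hpi3 := Real.pi_gt_three
  have hpi4 := Real.pi_le_four
  have hKε : 0 ≤ K * ε := by positivity
  have hsm : ε * 8192 + K * ε * 288 + K * ε * K ≤ 1 := by linarith
  have hKε1 : K * ε ≤ 1 := by nlinarith
  have hε1 : ε ≤ 1 / 8192 := by nlinarith
  have hσ2 : 2 * σ ^ 2 ≤ 1 / 2 := by nlinarith
  have hσa : |σ| ≤ 2 * ε := by
    refine abs_le_of_sq_le_sq' ?_ (by positivity) |>.2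
    rw [sq_abs]
    nlinarith
  have hσ1 : |σ| ≤ 1 := by linarith
  have a0 : |u0' - e0'| ≤ (32 + K) * ε := by
    refine (abs_sub _ _).trans ?_
    have : 4 * Real.pi * |σ| ≤ 4 * 4 * (2 * ε) := by gcongr
    linarith
  have a1 : |u1'' - e1''| ≤ 256 + K := by
    refine (abs_sub _ _).trans ?_
    have : 8 * Real.pi ^ 2 * |σ| ≤ 8 * 4 ^ 2 * 1 := by gcongr
    linarith
  -- The mixed product is at most 1 in absolute value because its first factor is O(ε), while the
  -- main product, close to that of the circle, is at least 1. Thus the second derivative error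
  -- `e1''` need only be bounded, unlike the others, which must be O(ε).
  have hprod : |(u0' - e0') * (u1'' - e1'')| ≤ 1 := by
    rw [abs_mul]
    refine (mul_le_mul a0 a1 (abs_nonneg _) (by positivity)).trans ?_
    linarith
  have c1 : 1 ≤ u1' - e1' := by
    have : 2 * Real.pi * (1 / 2) ≤ u1' := by rw [h1']; gcongr; linarith
    linarith [(abs_le.1 b1').2]
  have c0 : 1 ≤ -(u0'' - e0'') := by
    have h9 : (4 : ℝ) * 3 ^ 2 * (1 / 2) ≤ -u0'' := by
      rw [h0'', neg_neg]
      gcongr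
      linarith
    linarith [(abs_le.1 b0'').1, (abs_le.1 b0'').2]
  have := one_le_mul_of_one_le_of_one_le c0 c1
  linarith [(abs_le.1 hprod).1]

theorem exists_third_order_bound {f : ℝ → ℝ} (hf : ContDiff ℝ ∞ f) (hp : Function.Periodic f 1)
    {a : ℝ} (h0 : f a = 0) (h1 : deriv f a = 0) (h2 : deriv (deriv f) a = 0) :
    ∃ C > 0, ∀ t, |f t| ≤ C * |Real.sin (Real.pi * (t - a))| ^ 3 ∧
      |deriv f t| ≤ C * |Real.sin (Real.pi * (t - a))| ^ 2 ∧
      |deriv (deriv f) t| ≤ C * |Real.sin (Real.pi * (t - a))| := by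
  have hf1 := contDiff_deriv hf
  have hf2 := contDiff_deriv hf1
  have hp1 := deriv_periodic hp
  have hp2 := deriv_periodic hp1
  obtain ⟨C₃, hC₃, b₃⟩ := exists_bound_of_periodic (contDiff_deriv hf2).continuous
    (deriv_periodic hp2)
  obtain ⟨C₂, hC₂, b₂⟩ := exists_sin_bound_of_deriv hf2 hp2 h2 (n := 0)
    ⟨C₃, hC₃, fun t => by simpa using b₃ t⟩
  obtain ⟨C₁, hC₁, b₁⟩ := exists_sin_bound_of_deriv hf1 hp1 h1 ⟨C₂, hC₂, b₂⟩
  obtain ⟨C₀, hC₀, b₀⟩ := exists_sin_bound_of_deriv hf hp h0 ⟨C₁, hC₁, b₁⟩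
  refine ⟨max C₀ (max C₁ C₂), by positivity, fun t => ⟨(b₀ t).trans ?_, (b₁ t).trans ?_,
    (b₂ t).trans ?_⟩⟩
  · gcongr
    exact le_max_left _ _
  · gcongr
    exact (le_max_left _ _).trans (le_max_right _ _)
  · rw [zero_add, pow_one]
    gcongr
    exact (le_max_right _ _).trans (le_max_right _ _)

theorem exists_second_order_bound' {f : ℝ → ℝ} (hf : ContDiff ℝ ∞ f) (hp : Function.Periodic f 1)
    {a : ℝ} (h0 : f a = 0) (h1 : deriv f a = 0) :
    ∃ C > 0, ∀ t, |f t| ≤ C * |Real.sin (Real.pi * (t - a))| ^ 2 ∧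
      |deriv f t| ≤ C * |Real.sin (Real.pi * (t - a))| ∧ |deriv (deriv f) t| ≤ C := by
  have hf1 := contDiff_deriv hf
  have hp1 := deriv_periodic hp
  obtain ⟨C₂, hC₂, b₂⟩ := exists_bound_of_periodic (contDiff_deriv hf1).continuous
    (deriv_periodic hp1)
  obtain ⟨C₁, hC₁, b₁⟩ := exists_sin_bound_of_deriv hf1 hp1 h1 (n := 0)
    ⟨C₂, hC₂, fun t => by simpa using b₂ t⟩
  obtain ⟨C₀, hC₀, b₀⟩ := exists_sin_bound_of_deriv hf hp h0 ⟨C₁, hC₁, b₁⟩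
  refine ⟨max C₀ (max C₁ C₂), by positivity, fun t => ⟨(b₀ t).trans ?_, (b₁ t).trans ?_,
    (b₂ t).trans ?_⟩⟩
  · gcongr
    exact le_max_left _ _
  · rw [zero_add, pow_one]
    gcongr
    exact (le_max_left _ _).trans (le_max_right _ _)
  · exact (le_max_right _ _).trans (le_max_right _ _)

/-- The blended curve is the unit circle minus the error (1 - χ)(circle - g), whose derivatives are
the quantities estimated by `cutoff_compl_bound`. -/
theorem kappa_blend {g : ℝ → E3} (hs : ContDiff ℝ ∞ g) (a ε t : ℝ) :
    kappa (fun t => g t + cutoff a ε t • (unitCircle t - g t)) t =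
    (deriv unitCircle t 0 - deriv (fun t => (1 - cutoff a ε t) * (unitCircle t 0 - g t 0)) t) *
    (deriv (deriv unitCircle) t 1 -
      deriv (deriv (fun t => (1 - cutoff a ε t) * (unitCircle t 1 - g t 1))) t) -
    (deriv (deriv unitCircle) t 0 -
      deriv (deriv (fun t => (1 - cutoff a ε t) * (unitCircle t 0 - g t 0))) t) *
    (deriv unitCircle t 1 - deriv (fun t => (1 - cutoff a ε t) * (unitCircle t 1 - g t 1)) t) := by
  have hu := contDiff_unitCircle
  obtain ⟨L, hL⟩ : ∃ L, L = fun t => g t + cutoff a ε t • (unitCircle t - g t) := ⟨_, rfl⟩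
  obtain ⟨E, hEe⟩ : ∃ E : Fin 3 → ℝ → ℝ,
      E = fun i t => (1 - cutoff a ε t) * (unitCircle t i - g t i) := ⟨_, rfl⟩
  have hLs : ContDiff ℝ ∞ L := hL ▸ hs.add ((contDiff_cutoff _ _).smul (hu.sub hs))
  have hE : ∀ i, ContDiff ℝ ∞ (E i) := fun i => hEe ▸
    (contDiff_const.sub (contDiff_cutoff _ _)).mul ((contDiff_coord hu i).sub (contDiff_coord hs i))
  have hLE : ∀ i, (fun t => L t i) = fun t => unitCircle t i - E i t := fun i => funext fun t => by
    simp only [hL, hEe, PiLp.add_apply, PiLp.smul_apply, PiLp.sub_apply, smul_eq_mul]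
    ring
  have l1 : ∀ i t, deriv L t i = deriv unitCircle t i - deriv (E i) t := fun i t => by
    rw [← deriv_coord hLs, hLE]
    exact ((hasDerivAt_coord (hasDerivAt_of_smooth hu t) i).sub
      (hasDerivAt_of_smooth (hE i) t)).deriv
  have l2 : ∀ i t, deriv (deriv L) t i = deriv (deriv unitCircle) t i - deriv (deriv (E i)) t :=
    fun i t => by
    rw [← deriv_coord (contDiff_deriv hLs), funext (l1 i)]
    exact ((hasDerivAt_coord (hasDerivAt_of_smooth (contDiff_deriv hu) t) i).sub
      (hasDerivAt_of_smooth (contDiff_deriv (hE i)) t)).deriv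
  rw [← hL, kappa, l1, l1, l2, l2, hEe]

/-- Replacing a curve near `t = 3/4` by the unit circle keeps the curvature nonnegative, provided
the two agree there up to the horizontal second derivative. -/
theorem exists_kappa_cutoff_nonneg {g : ℝ → E3} (hs : ContDiff ℝ ∞ g) (hp : Function.Periodic g 1)
    (hκ : ∀ t, 0 ≤ kappa g t) (h0 : g (3 / 4) = unitCircle (3 / 4))
    (h1 : deriv g (3 / 4) = deriv unitCircle (3 / 4))
    (h2 : deriv (deriv g) (3 / 4) 0 = -4 * Real.pi ^ 2) :
    ∃ ε₀ > 0, ∀ ε ∈ Ioo 0 ε₀, ∀ t,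
      0 ≤ kappa (fun t => g t + cutoff (3 / 4) ε t • (unitCircle t - g t)) t := by
  have hu := contDiff_unitCircle
  have hsx : ∀ i, ContDiff ℝ ∞ fun t => unitCircle t i - g t i := fun i =>
    (contDiff_coord hu i).sub (contDiff_coord hs i)
  have hpx : ∀ i, Function.Periodic (fun t => unitCircle t i - g t i) 1 := fun i t => by
    simp only [hp t, unitCircle_periodic t]
  have d1 : ∀ i t, deriv (fun t => unitCircle t i - g t i) t =
      deriv unitCircle t i - deriv g t i := fun i t =>
    ((hasDerivAt_coord (hasDerivAt_of_smooth hu t) i).sub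
      (hasDerivAt_coord (hasDerivAt_of_smooth hs t) i)).deriv
  have d2 : ∀ i t, deriv (deriv (fun t => unitCircle t i - g t i)) t =
      deriv (deriv unitCircle) t i - deriv (deriv g) t i := fun i t => by
    rw [funext (d1 i)]
    exact ((hasDerivAt_coord (hasDerivAt_of_smooth (contDiff_deriv hu) t) i).sub
      (hasDerivAt_coord (hasDerivAt_of_smooth (contDiff_deriv hs) t) i)).deriv
  -- In x the contact is of third order because the accelerations agree, so all its error
  -- derivatives up to the second are O(ε). In y second order contact suffices: that second
  -- derivative enters the curvature multiplied by the small horizontal speed.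
  obtain ⟨C₀, hC₀, bx⟩ := exists_third_order_bound (hsx 0) (hpx 0) (a := 3 / 4)
    (by simp [h0]) (by rw [d1, h1, sub_self]) (by
      rw [d2, h2, (unitCircle_near_tip _).2.2.2.1]
      simp)
  obtain ⟨C₁, hC₁, byy⟩ := exists_second_order_bound' (hsx 1) (hpx 1) (a := 3 / 4)
    (by simp [h0]) (by rw [d1, h1, sub_self])
  obtain ⟨B, hB, hc⟩ := exists_cutoff_bound
  obtain ⟨C, hC, hCC₀, hCC₁⟩ : ∃ C > 0, C₀ ≤ C ∧ C₁ ≤ C :=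
    ⟨max C₀ C₁, lt_max_of_lt_left hC₀, le_max_left _ _, le_max_right _ _⟩
  obtain ⟨K, hK⟩ : ∃ K, K = 8 * C * (1 + 3 * B) := ⟨_, rfl⟩
  have hK0 : 0 < K := by rw [hK]; positivity
  refine ⟨min 1 (1 / ((32 + K) * (256 + K))), by positivity, fun ε hε t => ?_⟩
  have hε0 : 0 < ε := hε.1
  have hε1 : ε ≤ 1 := (hε.2.trans_le (min_le_left _ _)).le
  have hεK : ε * ((32 + K) * (256 + K)) ≤ 1 := by
    rw [← le_div_iff₀ (by positivity)]
    exact (hε.2.trans_le (min_le_right _ _)).le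
  rcases lt_or_ge (2 * ε ^ 2) (Real.sin (Real.pi * (t - 3 / 4)) ^ 2) with hlt | hge
  · have : (fun t => g t + cutoff (3 / 4) ε t • (unitCircle t - g t)) =ᶠ[𝓝 t] g := by
      filter_upwards [cutoff_eventuallyEq_zero hε0 hlt] with x hx
      simp [hx]
    rw [kappa, this.deriv_eq, this.deriv.deriv_eq]
    exact hκ t
  obtain ⟨σ, hσ⟩ : ∃ σ, σ = Real.sin (Real.pi * (t - 3 / 4)) := ⟨_, rfl⟩
  obtain ⟨-, u1, u2, u3, u4⟩ := unitCircle_near_tip t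
  obtain ⟨bx0, bx1, bx2⟩ := bx t
  obtain ⟨by0, by1, by2⟩ := byy t
  rw [← hσ] at hge u1 u2 u3 u4 bx0 bx1 bx2 by0 by1
  have hσ2 : |σ| ^ 2 ≤ 2 * ε ^ 2 := by rwa [sq_abs]
  have hσ1 : |σ| ≤ 2 * ε := abs_le_of_sq_le_sq' (by rw [mul_pow]; linarith [sq_nonneg ε]) (by positivity) |>.2
  obtain ⟨c1, c2⟩ := hc (3 / 4) t ε ⟨hε0, hε1⟩
  have hσ3 : |σ| ^ 3 ≤ 4 * ε ^ 3 := by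
    calc |σ| ^ 3 = |σ| ^ 2 * |σ| := by ring
      _ ≤ 2 * ε ^ 2 * (2 * ε) := by gcongr
      _ = 4 * ε ^ 3 := by ring
  have ex := cutoff_compl_bound (hsx 0) (M := 4 * C * ε) hε0 c1 c2
    (bx0.trans (by
      calc C₀ * |σ| ^ 3 ≤ C * (4 * ε ^ 3) := by gcongr
        _ = 4 * C * ε * ε ^ 2 := by ring))
    (bx1.trans (by
      calc C₀ * |σ| ^ 2 ≤ C * (2 * ε ^ 2) := by gcongr
        _ ≤ C * (4 * ε ^ 2) := by gcongr; norm_num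
        _ = 4 * C * ε * ε := by ring))
    (bx2.trans (by
      calc C₀ * |σ| ≤ C * (2 * ε) := by gcongr
        _ ≤ C * (4 * ε) := by gcongr; norm_num
        _ = 4 * C * ε := by ring))
  have ey := cutoff_compl_bound (hsx 1) (M := 4 * C) hε0 c1 c2
    (by0.trans (by
      calc C₁ * |σ| ^ 2 ≤ C * (2 * ε ^ 2) := by gcongr
        _ ≤ C * (4 * ε ^ 2) := by gcongr; norm_num
        _ = 4 * C * ε ^ 2 := by ring))
    (by1.trans (by
      calc C₁ * |σ| ≤ C * (2 * ε) := by gcongr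
        _ ≤ C * (4 * ε) := by gcongr; norm_num
        _ = 4 * C * ε := by ring))
    (by2.trans (by linarith))
  have hCB : 0 ≤ C * B := by positivity
  have hCBε : 0 ≤ C * B * ε := by positivity
  have hCε : 0 ≤ C * ε := by positivity
  have hKε : 4 * C * ε * (1 + B) ≤ K * ε := by rw [hK]; linarith
  rw [kappa_blend hs]
  refine curvature_estimate hK0.le hε0 hεK hge u1 u2 u3 u4 (ex.1.trans ?_) (ey.1.trans hKε)
    (ex.2.trans ?_) (ey.2.trans ?_)
  · have := mul_le_mul_of_nonneg_right hε1 (by positivity : 0 ≤ 4 * C * ε * (1 + B))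
    linarith
  · rw [hK]; linarith
  · rw [hK]; linarith

theorem sin_sq_pos_of_ne {a t : ℝ} (h : ∀ n : ℤ, t ≠ a + n) :
    0 < Real.sin (Real.pi * (t - a)) ^ 2 := by
  refine lt_of_le_of_ne (sq_nonneg _) fun h0 => ?_
  obtain ⟨n, hn⟩ := Real.sin_eq_zero_iff.1 (pow_eq_zero_iff two_ne_zero |>.1 h0.symm)
  refine h n ?_
  have := mul_left_cancel₀ Real.pi_ne_zero ((mul_comm _ _).trans hn)
  linarith

/-- Every spiral knot is isotopic to one that runs along the unit circle near time `3/4` and is in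
`x < 1` otherwise. -/
theorem Spiral.exists_circle_tip {f : ℝ → E3} (h : Spiral f) : ∃ g, Iso f g ∧ Spiral g ∧
    turn g = turn f ∧ (∀ t : ℝ, (∀ n : ℤ, t ≠ 3 / 4 + n) → g t 0 < 1) ∧
    ∃ r > 0, ∀ t, |t - 3 / 4| ≤ r → g t = unitCircle t := by
  have hpi := Real.pi_pos
  obtain ⟨g, i₁, s₁, e₁, h0, h1, h2, hlt⟩ := h.exists_normal
  have hs := s₁.isKnot.smooth
  have hp := s₁.isKnot.periodic
  have hu := contDiff_unitCircle
  obtain ⟨m, hm, hpert⟩ := exists_perturb s₁.isKnot s₁.planar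
  obtain ⟨ε₁, hε₁, hκ⟩ := exists_kappa_cutoff_nonneg hs hp s₁.curv h0 h1 h2
  have hD : Function.Periodic (fun t => unitCircle t - g t) 1 := fun t => by
    simp only [hp t, unitCircle_periodic t]
  have hDs : ContDiff ℝ ∞ fun t => unitCircle t - g t := hu.sub hs
  obtain ⟨ε₂, hε₂, hsmall⟩ := exists_cutoff_small (D := fun _ t => unitCircle t - g t)
    (a := 3 / 4) (hDs.comp contDiff_snd) (fun _ _ => hD)
    (fun _ _ => by rw [h0, sub_self]) (fun _ _ => by
      rw [((hasDerivAt_of_smooth hu _).fun_sub (hasDerivAt_of_smooth hs _)).deriv, h1, sub_self]) hm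
  obtain ⟨ε, hε, hεm⟩ := exists_between (lt_min hε₁ hε₂)
  have hεi₁ : ε ∈ Ioo 0 ε₁ := ⟨hε, hεm.trans_le (min_le_left _ _)⟩
  have hεi₂ : ε ∈ Ioo 0 ε₂ := ⟨hε, hεm.trans_le (min_le_right _ _)⟩
  obtain ⟨i₂, p₂, e₂⟩ := hpert (fun t => cutoff (3 / 4) ε t • (unitCircle t - g t))
    ((contDiff_cutoff _ _).smul hDs)
    (fun t => by simp only [cutoff_periodic _ _ t, hp t, unitCircle_periodic t])
    (hsmall ε hεi₂ 0 (by simp))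
  -- The radius ε/π works because |sin πx| ≤ π|x|, so the cutoff is 1 there.
  refine ⟨_, i₁.trans i₂, ⟨i₂.right, p₂, hκ ε hεi₁⟩, e₂.trans e₁, fun t ht => ?_, ε / Real.pi,
    by positivity, fun t ht => ?_⟩
  · have hχ := cutoff_mem (3 / 4) ε t
    have c1 := hlt t ht
    have c2 : unitCircle t 0 < 1 := by
      rw [(unitCircle_near_tip t).1]
      linarith [sin_sq_pos_of_ne ht]
    simp only [PiLp.add_apply, PiLp.smul_apply, PiLp.sub_apply, smul_eq_mul]
    rcases hχ.2.eq_or_lt with e | e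
    · rw [e]; linarith
    · nlinarith [mul_pos (sub_pos.2 e) (sub_pos.2 c1), mul_nonneg hχ.1 (sub_pos.2 c2).le]
  · have : cutoff (3 / 4) ε t = 1 := by
      refine cutoff_eq_one hε ?_
      rw [← sq_abs]
      gcongr
      refine Real.abs_sin_le_abs.trans ?_
      rw [abs_mul, abs_of_pos hpi]
      rwa [le_div_iff₀ hpi, mul_comm] at ht
    simp [this]

/-! ### Stretching the circular tip to a semicircle. -/

theorem deriv_lift_pos {k : ℝ} (hk : 0 < k) (t : ℝ) : 0 < deriv (lift k) t :=
  lt_of_le_of_ne ((lift_strictMono hk).monotone.deriv_nonneg) (deriv_lift_ne_zero hk t).symm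

/-- The reparametrisation by `lift k⁻¹` undoes the motion of `proj k` along the unit circle, so
circular arcs of the curve keep their standard parametrisation. -/
theorem Spiral.proj_lift {g : ℝ → E3} (h : Spiral g) {k : ℝ} (hk : 1 ≤ k) (hg : ∀ t, g t 0 ≤ 1) :
    Spiral fun t => SpiralIndex.proj k (g (lift k⁻¹ t)) :=
  have hk0 : 0 < k := by linarith
  (h.reparam (contDiff_lift_right (inv_pos.2 hk0)) (isKnot_comp_lift h.isKnot (inv_pos.2 hk0))
    (deriv_lift_pos (inv_pos.2 hk0))).proj hk0 fun t => projDen_pos_of_le hk (hg _)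

theorem proj_unitCircle_lift_inv {k : ℝ} (hk : 0 < k) (t : ℝ) :
    proj k (unitCircle (lift k⁻¹ t)) = unitCircle t := by
  rw [unitCircle_lift (inv_pos.2 hk)]
  have := proj_inv_proj (inv_pos.2 hk)
    (projDen_pos_of_mem (inv_pos.2 hk) (unitCircle_zero_mem t)).ne'
  rwa [inv_inv] at this

/-- As k grows the right half period is drawn into any neighbourhood of 3/4, in particular into the
one where the curve is the circle. -/
theorem abs_lift_inv_sub_le {k t : ℝ} (hk : 0 < k) (ht : t ∈ Icc (1 / 2 : ℝ) 1) :
    |lift k⁻¹ t - 3 / 4| ≤ Real.pi⁻¹ * (Real.pi / 4 - Real.arctan ((k - 1) / (k + 1))) := by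
  have e : (k⁻¹ - 1) / (k⁻¹ + 1) = -((k - 1) / (k + 1)) := by
    field_simp
    ring
  have hmono := (lift_strictMono (inv_pos.2 hk)).monotone
  have h1 := hmono ht.1
  have h2 := hmono ht.2
  rw [lift_half, e, Real.arctan_neg] at h1
  rw [lift_one_right, e, Real.arctan_neg] at h2
  have e2 : Real.pi⁻¹ * (Real.pi / 4) = 1 / 4 := by
    field_simp
  rw [mul_sub, e2, abs_le]
  constructor <;> linarith

/-- A curve in `x < 1` off the times `3/4 + n` is bounded away from `x = 1` far from these. -/
theorem exists_gap {g : ℝ → E3} (hc : Continuous fun t => g t 0) (hp : Function.Periodic g 1)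
    (hlt : ∀ t : ℝ, (∀ n : ℤ, t ≠ 3 / 4 + n) → g t 0 < 1) {r : ℝ} (hr : 0 < r) :
    ∃ η > 0, ∀ t : ℝ, (∀ n : ℤ, r < |t - n - 3 / 4|) → g t 0 ≤ 1 - η := by
  let S := Icc (1 / 4 : ℝ) (5 / 4) ∩ {t | r ≤ |t - 3 / 4|}
  have hS : IsCompact S := isCompact_Icc.inter_right
    (isClosed_le continuous_const (by fun_prop))
  have hSlt : ∀ t ∈ S, g t 0 < 1 := fun t ht => by
    refine hlt t fun n hn => ?_
    have hr' : r ≤ |t - 3 / 4| := ht.2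
    rw [hn, add_sub_cancel_left] at hr'
    have h1 := ht.1.1
    have h2 := ht.1.2
    rw [hn] at h1 h2
    have h3 : (-1 : ℤ) < n := by
      have : ((-1 : ℤ) : ℝ) < n := by push_cast; linarith
      exact_mod_cast this
    have h4 : n < (1 : ℤ) := by
      have : (n : ℝ) < ((1 : ℤ) : ℝ) := by push_cast; linarith
      exact_mod_cast this
    have : n = 0 := by omega
    rw [this] at hr'
    simp at hr'
    linarith
  have hmem : ∀ t : ℝ, (∀ n : ℤ, r < |t - n - 3 / 4|) → ∃ t' ∈ S, g t = g t' := fun t ht => by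
    obtain ⟨n, hn⟩ := exists_int_abs_sub_le t (3 / 4)
    refine ⟨t - n, ⟨?_, (ht n).le⟩, (periodic_sub_int hp t n).symm⟩
    rw [abs_le] at hn
    constructor <;> linarith [hn.1, hn.2]
  rcases S.eq_empty_or_nonempty with h0 | h0
  · refine ⟨1, one_pos, fun t ht => ?_⟩
    obtain ⟨t', h, -⟩ := hmem t ht
    rw [h0] at h
    exact h.elim
  · obtain ⟨p, hpS, hmax⟩ := hS.exists_isMaxOn h0 hc.continuousOn
    refine ⟨1 - g p 0, sub_pos.2 (hSlt p hpS), fun t ht => ?_⟩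
    obtain ⟨t', h, e⟩ := hmem t ht
    rw [e, sub_sub_cancel]
    exact isMaxOn_iff.1 hmax t' h

/-- Every spiral knot is isotopic, without change of the total curvature, to one in `x < 0` except
for the right half of the unit circle. -/
theorem Spiral.exists_leftHalf {f : ℝ → E3} (h : Spiral f) :
    ∃ d, Iso f d ∧ LeftHalf d ∧ Spiral d ∧ turn d = turn f := by
  have hpi := Real.pi_pos
  obtain ⟨g, i₁, s₁, e₁, hlt, r, hr, hcirc⟩ := h.exists_circle_tip
  have hs := s₁.isKnot.smooth
  have hp := s₁.isKnot.periodic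
  obtain ⟨η, hη, hgap⟩ := exists_gap (contDiff_coord hs 0).continuous hp hlt hr
  have hcirc' : ∀ (t : ℝ) (n : ℤ), |t - n - 3 / 4| ≤ r → g t = unitCircle t := fun t n ht => by
    rw [← periodic_sub_int hp t n, hcirc _ ht, periodic_sub_int unitCircle_periodic t n]
  have hle : ∀ t, g t 0 ≤ 1 := fun t => by
    by_cases hn : ∀ n : ℤ, t ≠ 3 / 4 + n
    · exact (hlt t hn).le
    · push Not at hn
      obtain ⟨n, hn⟩ := hn
      rw [hcirc' t n (by rw [hn]; simp [hr.le])]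
      exact (unitCircle_zero_mem t).2
  -- The first bound makes the whole right half of the image come from the circular tip. The second
  -- gives 1 - η < (k² - 1)/(k² + 1), the value of x that is sent to 0, so the points away from the
  -- tip land in x < 0.
  obtain ⟨k, hk1, harc, hsmall⟩ := exists_large (ε := Real.pi * r) (C := 2) (r := η)
    (by positivity) hη
  have hk0 : 0 < k := by linarith
  let K : ℝ → ℝ := fun s => 1 + s ^ 2 * (k - 1)
  have hK1 : ∀ s, 1 ≤ K s := fun s => by
    have : 0 ≤ s ^ 2 * (k - 1) := mul_nonneg (sq_nonneg s) (by linarith)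
    simp only [K]; linarith
  have hK0 : ∀ s, 0 < K s := fun s => by linarith [hK1 s]
  have hKs : ContDiff ℝ ∞ fun p : ℝ × ℝ => K p.1 := by simp only [K]; fun_prop
  let H : ℝ → ℝ → E3 := fun s t => SpiralIndex.proj (K s) (g (lift (K s)⁻¹ t))
  have hH : ContDiff ℝ ∞ fun p : ℝ × ℝ => H p.1 p.2 :=
    contDiff_proj (hs.comp (contDiff_lift (hKs.inv fun p => (hK0 _).ne') contDiff_snd
      fun p => inv_pos.2 (hK0 _))) hKs fun p => (projDen_pos_of_le (hK1 _) (hle _)).ne'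
  have hsp : ∀ s, Spiral (H s) := fun s => s₁.proj_lift (hK1 s) hle
  have e0 : H 0 = g := funext fun t => by simp [H, K, lift_one, proj_one_eq]
  have hKk : K 1 = k := by simp [K]
  have e1 : H 1 = fun t => SpiralIndex.proj k (g (lift k⁻¹ t)) := by
    funext t
    simp only [H, hKk]
  have iso := Iso.of_Icc H hH fun s _ => (hsp s).isKnot
  have et := turn_homotopy hH (fun s _ => (hsp s).isKnot.periodic) fun s _ => (hsp s).planar
  have s1 := hsp 1
  rw [e0] at iso et
  refine ⟨H 1, i₁.trans iso, ⟨s1.isKnot, fun t ht => ?_, fun t ht => ?_⟩, s1, et.symm.trans e₁⟩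
  · rw [e1]
    by_cases hn : ∀ n : ℤ, r < |lift k⁻¹ t - n - 3 / 4|
    · have h1 := hgap _ hn
      have hk2 : 0 < k ^ 2 + 1 := by positivity
      have h2 : 2 / (k ^ 2 + 1) < η := lt_of_le_of_lt (by gcongr; nlinarith) hsmall
      rw [div_lt_iff₀ hk2] at h2
      simp only [proj_zero]
      refine div_neg_of_neg_of_pos ?_ (projDen_pos_of_le hk1 (hle _))
      have := mul_le_mul_of_nonneg_left h1 hk2.le
      linarith
    · push Not at hn
      obtain ⟨n, hn⟩ := hn
      simp only [hcirc' _ n hn, proj_unitCircle_lift_inv hk0]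
      exact unitCircle_zero_neg ht
  · rw [e1]
    simp only
    rw [hcirc _ ((abs_lift_inv_sub_le hk0 ht).trans _), proj_unitCircle_lift_inv hk0]
    have := mul_le_mul_of_nonneg_left harc (inv_pos.2 hpi).le
    rwa [inv_mul_cancel_left₀ hpi.ne'] at this

/-! ### Total curvature of the glued spiral. -/

theorem deriv_eqOn_Icc {F : Type*} [NormedAddCommGroup F] [NormedSpace ℝ F] {f g : ℝ → F}
    (hf : ContDiff ℝ ∞ f) (hg : ContDiff ℝ ∞ g) {a b : ℝ} (hab : a < b) (h : EqOn f g (Icc a b)) :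
    EqOn (deriv f) (deriv g) (Icc a b) := by
  have hc : IsClosed {t | deriv f t = deriv g t} :=
    isClosed_eq (hf.continuous_deriv (by simp)) (hg.continuous_deriv (by simp))
  have : closure (Ioo a b) ⊆ {t | deriv f t = deriv g t} := by
    refine hc.closure_subset_iff.2 fun t ht => Filter.EventuallyEq.deriv_eq ?_
    filter_upwards [Ioo_mem_nhds ht.1 ht.2] with x hx using h ⟨hx.1.le, hx.2.le⟩
  rwa [closure_Ioo hab.ne] at this

theorem kappa_speedSq_eqOn {f g : ℝ → E3} (hf : ContDiff ℝ ∞ f) (hg : ContDiff ℝ ∞ g) {a b : ℝ}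
    (hab : a < b) (h : EqOn f g (Icc a b)) :
    EqOn (kappa f) (kappa g) (Icc a b) ∧ EqOn (speedSq f) (speedSq g) (Icc a b) := by
  have h1 := deriv_eqOn_Icc hf hg hab h
  have h2 := deriv_eqOn_Icc (contDiff_deriv hf) (contDiff_deriv hg) hab h1
  refine ⟨fun t ht => ?_, fun t ht => ?_⟩
  · rw [kappa, kappa, h1 ht, h2 ht]
  · rw [speedSq, speedSq, h1 ht]

/-- The total curvature of a curve that agrees with `A` on the first half of the period and with
`B` on the second. -/
theorem turn_eq_add {f A B : ℝ → E3} (hf : ContDiff ℝ ∞ f) (hA : ContDiff ℝ ∞ A)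
    (hB : ContDiff ℝ ∞ B) (hpl : ∀ t, 0 < speedSq f t) (h1 : EqOn f A (Icc 0 (1 / 2)))
    (h2 : EqOn f B (Icc (1 / 2) 1)) :
    turn f = (∫ t in (0 : ℝ)..(1 / 2), kappa A t / speedSq A t) +
      ∫ t in (1 / 2 : ℝ)..1, kappa B t / speedSq B t := by
  have hc : Continuous fun t => kappa f t / speedSq f t :=
    (contDiff_kappa hf).continuous.div (contDiff_speedSq hf).continuous fun t => (hpl t).ne'
  obtain ⟨k1, s1⟩ := kappa_speedSq_eqOn hf hA (by norm_num) h1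
  obtain ⟨k2, s2⟩ := kappa_speedSq_eqOn hf hB (by norm_num) h2
  rw [turn, ← intervalIntegral.integral_add_adjacent_intervals (hc.intervalIntegrable 0 (1 / 2))
    (hc.intervalIntegrable (1 / 2) 1)]
  congr 1
  · refine intervalIntegral.integral_congr fun t ht => ?_
    rw [uIcc_of_le (by norm_num)] at ht
    simp only [k1 ht, s1 ht]
  · refine intervalIntegral.integral_congr fun t ht => ?_
    rw [uIcc_of_le (by norm_num)] at ht
    simp only [k2 ht, s2 ht]

theorem speedSq_unitCircle (t : ℝ) : speedSq unitCircle t = 4 * Real.pi ^ 2 := by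
  rw [speedSq, deriv_unitCircle_zero, deriv_unitCircle_one]
  linear_combination 4 * Real.pi ^ 2 * Real.sin_sq_add_cos_sq (2 * Real.pi * t)

theorem kappa_unitCircle (t : ℝ) : kappa unitCircle t = 8 * Real.pi ^ 3 := by
  rw [kappa, deriv_unitCircle_zero, deriv_unitCircle_one, deriv_deriv_unitCircle_zero,
    deriv_deriv_unitCircle_one]
  linear_combination 8 * Real.pi ^ 3 * Real.sin_sq_add_cos_sq (2 * Real.pi * t)

theorem turn_unitCircle : turn unitCircle = 2 * Real.pi := by
  have := Real.pi_ne_zero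
  simp only [turn, speedSq_unitCircle, kappa_unitCircle, intervalIntegral.integral_const,
    smul_eq_mul]
  field_simp
  norm_num

/-- The connected sum of two spirals is a spiral, whose total curvature is that of a circle less
than the sum. -/
theorem Spiral.glue {d₁ d₂ : ℝ → E3} (h₁ : LeftHalf d₁) (h₂ : RightHalf d₂) (s₁ : Spiral d₁)
    (s₂ : Spiral d₂) : Spiral (SpiralIndex.glue d₁ d₂) ∧
      turn (SpiralIndex.glue d₁ d₂) + 2 * Real.pi = turn d₁ + turn d₂ := by
  have hk := isKnot_glue_halves h₁ h₂
  have c₁ := s₁.isKnot.smooth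
  have c₂ := s₂.isKnot.smooth
  have e₁ : EqOn (SpiralIndex.glue d₁ d₂) d₁ (Icc 0 (1 / 2)) := fun t ht => glue_left ht
  have e₂ : EqOn (SpiralIndex.glue d₁ d₂) d₂ (Icc (1 / 2) 1) := fun t ht =>
    glue_right hk.smooth.continuous c₂.continuous ht
  obtain ⟨k1, q1⟩ := kappa_speedSq_eqOn hk.smooth c₁ (by norm_num) e₁
  obtain ⟨k2, q2⟩ := kappa_speedSq_eqOn hk.smooth c₂ (by norm_num) e₂
  have hcase : ∀ t : ℝ, Int.fract t ∈ Icc (0 : ℝ) (1 / 2) ∨ Int.fract t ∈ Icc (1 / 2 : ℝ) 1 :=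
    fun t => (le_total (Int.fract t) (1 / 2)).imp (fun h => ⟨Int.fract_nonneg t, h⟩)
      fun h => ⟨h, (Int.fract_lt_one t).le⟩
  have hpl : ∀ t, 0 < speedSq (SpiralIndex.glue d₁ d₂) t := fun t => by
    rw [← periodic_fract (speedSq_periodic hk.periodic)]
    rcases hcase t with h | h
    · rw [q1 h]; exact s₁.planar _
    · rw [q2 h]; exact s₂.planar _
  have hpu : ∀ t, 0 < speedSq unitCircle t := fun t => by
    rw [speedSq_unitCircle]
    have := Real.pi_pos
    positivity
  refine ⟨⟨hk, hpl, fun t => ?_⟩, ?_⟩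
  · rw [← periodic_fract (kappa_periodic hk.periodic)]
    rcases hcase t with h | h
    · rw [k1 h]; exact s₁.curv _
    · rw [k2 h]; exact s₂.curv _
  · have hu := contDiff_unitCircle
    -- All four integrals are split at 1/2. The semicircles missing from the sum are the two halves
    -- of one unit circle, whose total curvature is the 2π on the left.
    rw [← turn_unitCircle, turn_eq_add hk.smooth c₁ c₂ hpl e₁ e₂,
      turn_eq_add c₁ c₁ hu s₁.planar (fun _ _ => rfl) h₁.circ,
      turn_eq_add c₂ hu c₂ s₂.planar h₂.circ (fun _ _ => rfl),
      turn_eq_add hu hu hu hpu (fun _ _ => rfl) (fun _ _ => rfl)]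
    ring

/-! ### From projections in spiral form to `Spiral` and back; the inequality. -/

theorem inner_E3 (v w : E3) : inner ℝ v w = v 0 * w 0 + v 1 * w 1 + v 2 * w 2 := by
  simp only [PiLp.inner_apply, Fin.sum_univ_three, RCLike.inner_apply, conj_trivial]
  ring

theorem norm_sq_E3 (v : E3) : ‖v‖ ^ 2 = v 0 ^ 2 + v 1 ^ 2 + v 2 ^ 2 := by
  rw [EuclideanSpace.norm_sq_eq, Fin.sum_univ_three]
  simp

/-- The triple product of three vectors. -/
def triple (u v w : E3) : ℝ :=
  u 0 * (v 1 * w 2 - v 2 * w 1) - u 1 * (v 0 * w 2 - v 2 * w 0) + u 2 * (v 0 * w 1 - v 1 * w 0)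

theorem planarCurvature_eq (v : E3) (p : ℝ → E3) (t : ℝ) :
    planarCurvature v p t = triple v (deriv p t) (deriv (deriv p) t) / ‖deriv p t‖ ^ 3 := by
  rw [planarCurvature, Matrix.det_fin_three, triple]
  simp only [Matrix.of_apply, Matrix.cons_val]
  ring

theorem projection_eq (K : Knot) {v : E3} (hv : ‖v‖ = 1) :
    projection K v = fun t => K t - (inner ℝ v (K t) : ℝ) • v := funext fun t => by
  rw [projection, Submodule.starProjection_orthogonal_val, Submodule.starProjection_unit_singleton ℝ hv]

theorem deriv_sub_inner_smul {f : ℝ → E3} (hf : ContDiff ℝ ∞ f) (v : E3) :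
    deriv (fun t => f t - (inner ℝ v (f t) : ℝ) • v) =
      fun t => deriv f t - (inner ℝ v (deriv f t) : ℝ) • v := funext fun t => by
  have h := hasDerivAt_of_smooth hf t
  have h2 : HasDerivAt (fun t => (inner ℝ v (f t) : ℝ)) (inner ℝ v (deriv f t)) t :=
    (innerSL ℝ v).hasFDerivAt.comp_hasDerivAt t h
  exact (h.fun_sub (h2.smul_const v)).deriv

/-- Components along v do not matter, so the planar curvature can be computed from the space curve
itself. -/
theorem triple_sub_smul (v a b : E3) (r s : ℝ) :
    triple v (a - r • v) (b - s • v) = triple v a b := by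
  simp only [triple, PiLp.sub_apply, PiLp.smul_apply, smul_eq_mul]
  ring

theorem exists_orthogonal (v : E3) : ∃ e : E3, 0 < ‖e‖ ∧ inner ℝ v e = 0 := by
  by_cases h : v 0 = 0 ∧ v 1 = 0
  · refine ⟨!₂[1, 0, 0], norm_pos_iff.2 fun h0 => ?_, by simp [inner_E3, h.1]⟩
    have := congrArg (fun w : E3 => w 0) h0
    simp at this
  · refine ⟨!₂[-v 1, v 0, 0], norm_pos_iff.2 fun h0 => h ?_, by simp [inner_E3, mul_comm]⟩
    have h1 := congrArg (fun w : E3 => w 0) h0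
    have h2 := congrArg (fun w : E3 => w 1) h0
    simp at h1 h2
    exact ⟨h2, h1⟩

/-- Viewing the same shadow from the other side changes the sign of the curvature, which reduces the
nonpositive case to the nonnegative one. -/
theorem projection_neg_left {K : Knot} {v : E3} (hv : ‖v‖ = 1) : projection K (-v) = projection K v ∧
    ∀ p t, planarCurvature (-v) p t = -planarCurvature v p t := by
  refine ⟨?_, fun p t => ?_⟩
  · rw [projection_eq K hv, projection_eq K (by rwa [norm_neg])]
    simp
  · rw [planarCurvature_eq, planarCurvature_eq, ← neg_div]
    congr 1
    simp only [triple, PiLp.neg_apply]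
    ring

/-- The matrix with rows e, v × e and v has determinant ‖e‖² > 0 and turns v into the vertical
direction. As e is not normalised, curvature and squared speed acquire harmless factors ‖e‖². -/
theorem exists_spiral_of_nonneg {K : Knot} {v : E3} {n : ℕ∞} (hv : ‖v‖ = 1)
    (hr : ∀ t, deriv (projection K v) t ≠ 0) (hc : ∀ t, 0 ≤ planarCurvature v (projection K v) t)
    (hn : HasSpiralNumber K v n) :
    ∃ f, ∃ m : ℕ, Iso K f ∧ Spiral f ∧ turn f = 2 * Real.pi * m ∧ n = m := by
  have hK := K.isKnot
  have hs := hK.smooth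
  obtain ⟨e, he, hve⟩ := exists_orthogonal v
  have hd1 : deriv (projection K v) = fun t => deriv K t - (inner ℝ v (deriv K t) : ℝ) • v := by
    rw [projection_eq K hv, deriv_sub_inner_smul hs]
  have hd2 : deriv (deriv (projection K v)) =
      fun t => deriv (deriv K) t - (inner ℝ v (deriv (deriv K) t) : ℝ) • v := by
    rw [hd1, deriv_sub_inner_smul (contDiff_deriv hs)]
  let c : E3 := !₂[v 1 * e 2 - v 2 * e 1, v 2 * e 0 - v 0 * e 2, v 0 * e 1 - v 1 * e 0]
  let M : Matrix (Fin 3) (Fin 3) ℝ := !![e 0, e 1, e 2; c 0, c 1, c 2; v 0, v 1, v 2]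
  have hv2 : v 0 ^ 2 + v 1 ^ 2 + v 2 ^ 2 = 1 := by rw [← norm_sq_E3, hv]; norm_num
  have he2 : 0 < e 0 ^ 2 + e 1 ^ 2 + e 2 ^ 2 := by rw [← norm_sq_E3]; positivity
  rw [inner_E3] at hve
  have hdet : 0 < M.det := by
    have : M.det = e 0 ^ 2 + e 1 ^ 2 + e 2 ^ 2 := by
      rw [Matrix.det_fin_three]
      simp [M, c]
      linear_combination (e 0 ^ 2 + e 1 ^ 2 + e 2 ^ 2) * hv2 -
        (v 0 * e 0 + v 1 * e 1 + v 2 * e 2) * hve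
    rw [this]; exact he2
  have hiso := Iso.affine hK hdet 0
  have hD1 := deriv_act_add hs M 0
  have hD2 := deriv_deriv_act_add hs M 0
  simp only [add_zero] at hiso hD1 hD2
  have hkap : ∀ t, kappa (fun t => act M (K t)) t = (e 0 ^ 2 + e 1 ^ 2 + e 2 ^ 2) *
      (planarCurvature v (projection K v) t * ‖deriv (projection K v) t‖ ^ 3) := fun t => by
    have h3 : ‖deriv (projection K v) t‖ ^ 3 ≠ 0 := pow_ne_zero _ (norm_ne_zero_iff.2 (hr t))
    rw [planarCurvature_eq, div_mul_cancel₀ _ h3, hd2, hd1, triple_sub_smul, kappa, hD2, hD1]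
    simp only [act_apply, triple]
    simp [M, c]
    set a := deriv K t
    set b := deriv (deriv K) t
    linear_combination (-(e 0 * (a 1 * b 2 - a 2 * b 1)) + e 1 * (a 0 * b 2 - a 2 * b 0) -
      e 2 * (a 0 * b 1 - a 1 * b 0)) * hve
  have hsp : ∀ t, speedSq (fun t => act M (K t)) t =
      (e 0 ^ 2 + e 1 ^ 2 + e 2 ^ 2) * ‖deriv (projection K v) t‖ ^ 2 := fun t => by
    rw [norm_sq_E3, hd1, speedSq, hD1]
    simp only [act_apply, inner_E3, PiLp.sub_apply, PiLp.smul_apply, smul_eq_mul]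
    simp [M, c]
    set a := deriv K t
    linear_combination ((e 0 ^ 2 + e 1 ^ 2 + e 2 ^ 2) * (a 0 ^ 2 + a 1 ^ 2 + a 2 ^ 2) -
      (e 0 * a 0 + e 1 * a 1 + e 2 * a 2) ^ 2 - (e 0 ^ 2 + e 1 ^ 2 + e 2 ^ 2) *
      (v 0 * a 0 + v 1 * a 1 + v 2 * a 2) ^ 2) * hv2 +
      (2 * (e 0 * a 0 + e 1 * a 1 + e 2 * a 2) * (v 0 * a 0 + v 1 * a 1 + v 2 * a 2) -
      (v 0 * e 0 + v 1 * e 1 + v 2 * e 2) * (a 0 ^ 2 + a 1 ^ 2 + a 2 ^ 2)) * hve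
  have hS : Spiral fun t => act M (K t) := ⟨hiso.right, fun t => by
    rw [hsp]
    have := norm_pos_iff.2 (hr t)
    positivity, fun t => by
    rw [hkap]
    have := hc t
    positivity⟩
  obtain ⟨m, -, hm, hmax⟩ := hS.exists_turn
  refine ⟨_, m, hiso, hS, hm, ?_⟩
  -- One direction suffices to identify the two counts: the height along e is the first coordinate
  -- of the moved knot.
  have h1 := hn (‖e‖⁻¹ • e) (by rw [norm_smul, norm_inv, norm_norm, inv_mul_cancel₀ he.ne'])
    (by rw [real_inner_smul_right, inner_E3, hve, mul_zero])
  rw [← h1, ← hmax ‖e‖⁻¹ 0 (Or.inl (inv_ne_zero he.ne')), projection_eq K hv]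
  congr 1
  funext t
  rw [real_inner_smul_right, inner_sub_left, real_inner_smul_left]
  have : inner ℝ v e = 0 := by rw [inner_E3, hve]
  have e0 : act M (K t) 0 = e 0 * K t 0 + e 1 * K t 1 + e 2 * K t 2 := by simp [act_apply, M]
  rw [this, inner_E3, e0]
  ring

/-- A projection in spiral form comes from a knot that is a spiral over the first two
coordinates. -/
theorem exists_spiral_of_isSpiralForm {K : Knot} {v : E3} {n : ℕ∞} (hv : ‖v‖ = 1)
    (hK : IsSpiralForm K v) (hn : HasSpiralNumber K v n) :
    ∃ f, ∃ m : ℕ, Iso K f ∧ Spiral f ∧ turn f = 2 * Real.pi * m ∧ n = m := by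
  obtain ⟨hr, hc | hc⟩ := hK
  · exact exists_spiral_of_nonneg hv hr hc hn
  · obtain ⟨e1, e2⟩ := projection_neg_left (K := K) hv
    refine exists_spiral_of_nonneg (v := -v) (by rwa [norm_neg]) (by rwa [e1]) (fun t => ?_)
      fun w hw hvw => ?_
    · rw [e1, e2]
      exact neg_nonneg.2 (hc t)
    · rw [e1]
      exact hn w hw (by rwa [inner_neg_left, neg_eq_zero] at hvw)

/-- If the orientations disagree, reversing the spiral and turning it over by the rotation `flip`
gives a spiral of the opposite orientation with the same turning number. -/
theorem exists_spiral_of_sameType {K c : Knot} (h : SameType K c) {v : E3} {n : ℕ∞} (hv : ‖v‖ = 1)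
    (hK : IsSpiralForm K v) (hn : HasSpiralNumber K v n) :
    ∃ f, ∃ m : ℕ, Iso c f ∧ Spiral f ∧ turn f = 2 * Real.pi * m ∧ n = m := by
  obtain ⟨f, m, i, s, e, hm⟩ := exists_spiral_of_isSpiralForm hv hK hn
  rcases (sameType_iff K c).1 h with h | h
  · exact ⟨f, m, h.symm.trans i, s, e, hm⟩
  · have hdet : 0 < flip.det := by
      rw [flip, Matrix.det_diagonal, Fin.prod_univ_three]
      simp
    have h2 := Iso.affine s.isKnot.reverse hdet 0
    simp only [add_zero] at h2
    exact ⟨_, m, (h.symm.trans i.reverse).trans h2, s.reverse.1, s.reverse.2.trans e, hm⟩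

/-- A knot that is a spiral over the first two coordinates has a projection in spiral form. -/
theorem Spiral.hasSpiralNumber {K : Knot} (h : Spiral K) {m : ℕ}
    (hm : turn K = 2 * Real.pi * m) : ∃ v : E3, ‖v‖ = 1 ∧ IsSpiralForm K v ∧
      HasSpiralNumber K v m := by
  have hs := h.isKnot.smooth
  let v : E3 := !₂[0, 0, 1]
  have hv : ‖v‖ = 1 := by
    have : ‖v‖ ^ 2 = 1 := by rw [norm_sq_E3]; simp [v]
    exact (pow_eq_one_iff_of_nonneg (norm_nonneg _) two_ne_zero).1 this
  have hd1 : deriv (projection K v) = fun t => deriv K t - (inner ℝ v (deriv K t) : ℝ) • v := by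
    rw [projection_eq K hv, deriv_sub_inner_smul hs]
  have hd2 : deriv (deriv (projection K v)) =
      fun t => deriv (deriv K) t - (inner ℝ v (deriv (deriv K) t) : ℝ) • v := by
    rw [hd1, deriv_sub_inner_smul (contDiff_deriv hs)]
  refine ⟨v, hv, ⟨fun t h0 => ?_, Or.inl fun t => ?_⟩, fun w hw hvw => ?_⟩
  · rw [hd1] at h0
    have z0 := congrArg (fun w : E3 => w 0) h0
    have z1 := congrArg (fun w : E3 => w 1) h0
    simp [v] at z0 z1
    have := h.planar t
    rw [speedSq, z0, z1] at this
    norm_num at this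
  · rw [planarCurvature_eq, hd2, hd1, triple_sub_smul]
    refine div_nonneg ?_ (by positivity)
    have hk := h.curv t
    rw [kappa] at hk
    simp [triple, v]
    linarith
  · obtain ⟨n, -, hn, hmax⟩ := h.exists_turn
    have hnm : n = m := by
      rw [hm] at hn
      have := mul_left_cancel₀ Real.two_pi_pos.ne' hn
      exact_mod_cast this.symm
    have hw2 : w 2 = 0 := by
      rw [inner_E3] at hvw
      simpa [v] using hvw
    have hw0 : w 0 ≠ 0 ∨ w 1 ≠ 0 := by
      by_contra hc
      push Not at hc
      have := norm_sq_E3 w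
      rw [hw, hc.1, hc.2, hw2] at this
      norm_num at this
    rw [← hnm, ← hmax _ _ hw0, projection_eq K hv]
    congr 1
    funext t
    rw [inner_E3]
    simp [v, hw2]
    ring

/-- A conformation of `K` realises any finite spiral index. -/
theorem exists_spiral_of_spiralIndex {K c : Knot} (hc : SameType K c) (h : spiralIndex K ≠ ⊤) :
    ∃ f, ∃ m : ℕ, Iso c f ∧ Spiral f ∧ turn f = 2 * Real.pi * m ∧ spiralIndex K = m := by
  have hne : {n | ∃ (K' : Knot) (v : E3), SameType K K' ∧ ‖v‖ = 1 ∧ IsSpiralForm K' v ∧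
      HasSpiralNumber K' v n}.Nonempty := by
    by_contra hc
    rw [Set.not_nonempty_iff_eq_empty] at hc
    exact h (by rw [spiralIndex, hc, sInf_empty])
  -- Infima of nonempty sets in `ℕ∞` are attained.
  obtain ⟨K', v, hK', hv, hsf, hn⟩ := csInf_mem hne
  exact exists_spiral_of_sameType (hK'.symm.trans hc) hv hsf hn

theorem spiralIndex_add_one_le {K K₁ K₂ : Knot} (hK : IsConnectedSum K K₁ K₂) :
    spiralIndex K + 1 ≤ spiralIndex K₁ + spiralIndex K₂ := by
  obtain ⟨c, c₁, c₂, hKc, hK₁, hK₂, l1, l2, r1, r2, g1, g2⟩ := hK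
  by_cases ht₁ : spiralIndex K₁ = ⊤
  · rw [ht₁, top_add]
    exact le_top
  by_cases ht₂ : spiralIndex K₂ = ⊤
  · rw [ht₂, add_top]
    exact le_top
  obtain ⟨f₁, m₁, i₁, s₁, e₁, hm₁⟩ := exists_spiral_of_spiralIndex hK₁ ht₁
  obtain ⟨f₂, m₂, i₂, s₂, e₂, hm₂⟩ := exists_spiral_of_spiralIndex hK₂ ht₂
  obtain ⟨d₁, j₁, h₁, t₁, q₁⟩ := s₁.exists_leftHalf
  obtain ⟨d₂, j₂, h₂, t₂, q₂⟩ := s₂.exists_leftHalf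
  -- Both spirals are brought into left position; the half turn makes the second one a right half
  -- and keeps its turning number.
  obtain ⟨sD, eD⟩ := Spiral.glue h₁ h₂.swap t₁ t₂.swap.1
  have hL : LeftHalf c₁ := ⟨c₁.isKnot, l1, l2⟩
  have hR : RightHalf c₂ := ⟨c₂.isKnot, r1, r2⟩
  have hcg : (c : ℝ → E3) = SpiralIndex.glue c₁ c₂ :=
    eq_glue c.periodic c₁.periodic c₂.periodic g1 g2
  have hiso := iso_glue hL hR h₁ h₂.swap (i₁.trans j₁)
    ((i₂.trans j₂).trans (iso_swap h₂.isKnot))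
  rw [← hcg] at hiso
  obtain ⟨n, -, hn, -⟩ := sD.exists_turn
  rw [hn, t₂.swap.2, q₁, q₂, e₁, e₂] at eD
  -- The circle lost in the gluing accounts for the 1.
  have hnm : n + 1 = m₁ + m₂ := by
    have h2 : 2 * Real.pi * ((n : ℝ) + 1) = 2 * Real.pi * (m₁ + m₂) := by linear_combination eD
    have := mul_left_cancel₀ Real.two_pi_pos.ne' h2
    exact_mod_cast this
  let D : Knot := sD.isKnot.toKnot
  have hD : Spiral D := sD
  obtain ⟨v, hv, hsf, hnum⟩ := hD.hasSpiralNumber hn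
  have hle : spiralIndex K ≤ n :=
    sInf_le ⟨D, v, hKc.trans ((sameType_iff c D).2 (Or.inl hiso)), hv, hsf, hnum⟩
  calc spiralIndex K + 1 ≤ n + 1 := by gcongr
    _ = spiralIndex K₁ + spiralIndex K₂ := by
      rw [hm₁, hm₂]
      exact_mod_cast hnm

end

end SpiralIndex

theorem mainTheorem8 (K K₁ K₂ : SpiralIndex.Knot)
    (hK : SpiralIndex.IsConnectedSum K K₁ K₂) :
    SpiralIndex.spiralIndex K + 1 ≤
      SpiralIndex.spiralIndex K₁ + SpiralIndex.spiralIndex K₂ := by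
  exact SpiralIndex.spiralIndex_add_one_le hK
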